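/- **Setting.** Let $\mathcal X$ be a countable set of agent types. An agent of type $x$ has $d_x^+$ incoming and $d_x^-$ outgoing links, initial capital $\gamma_x>0$, a continuous non-decreasing premium function $\alpha_x$ on $[0,\infty)$ and external debt $\delta_x$; its initial shock $\epsilon_x\in[0,1]$ and its (positive, i.i.d.) incoming losses $L_x^{(1)},L_x^{(2)},\dots$ have distributions with densities that depend on $x$ only. For each $n$ there are $n$ agents, a fraction $\mu_x^{(n)}$ of which has type $x$. Assume that $\mu_x^{(n)}\to\mu_x$ for all $x$, where $\mu$ is a probability distribution on $\mathcal X$, that $\lambda^{(n)}:=\sum_x d_x^+\mu_x^{(n)}=\sum_x d_x^-\mu_x^{(n)}\to\lambda$, and that $\lambda=\sum_x d_x^+\mu_x=\sum_x d_x^-\mu_x\in(0,\infty)$. Outgoing half-edges are matched with incoming half-edges uniformly at random (configuration model); the matching, the shocks and the losses are independent. With reveals at times $0<t_1<t_2<\cdots$, the capital of agent $i$ of type $x$ is $C_i(t)=\gamma_x(1-\epsilon_i)+\alpha_x(t)-\delta_x-(\text{losses revealed on the incoming half-edges of } i \text{ up to } t)$, and $i$ is ruined from the first time at which $C_i\le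 0$. At each reveal one unrevealed outgoing half-edge of a ruined agent, chosen on the basis of the past, is revealed: its partner half-edge suffers its loss. After the reveal at $t_k$ (and from $t_0=0$) the next one occurs after an exponential time of parameter $\mathcal R_n(t_k)\ge 0$ (never, if this is $0$), where $\mathcal R_n$ is constant between reveals and may depend on the past and on additional independent randomness. Let $W_n(t)$ be the number of unrevealed outgoing half-edges of agents ruined by time $t$, $\tau_n^\star=\inf\{t\ge 0:W_n(t)=0\}$ (with $\inf\emptyset=\infty$), and let $D^{(n)}(\tau^\star_n)$ and $D_x^{(n)}(\tau^\star_n)$ be the numbers of agents, respectively of agents of type $x$, ruined by time $\tau_n^\star$. Assume that $\mathcal R_n(t)=0$ for $t>\tau_n^\star$, and that $\sup_{t<\tau_n^\star}|\mathcal R_n(t)/n-\mathfrak R(t)|\to 0$ in probability, where $\mathfrak R:[0,\infty)\to(0,\infty)$ is continuous and integrable. **Limit functions.** Let $b(d,z,\theta)=\binom d\theta z^\theta(1-z)^{d-\theta}$, $t_{\mathfrak R}(\lambda)=\inf\{t\ge0:\int_0^t\mathfrak R(s)\,ds\ge\lambda\}$ and $\phi^{\mathfrak R}(t)=\lambda^{-1}\int_0^{t\wedge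 t_{\mathfrak R}(\lambda)}\mathfrak R(s)\,ds$. For $\theta=0,1,\dots,d_x^+$ let $\tau_{x,\theta}=\inf\{t\ge0:\gamma_x(1-\epsilon_x)+\alpha_x(t)-\delta_x\ge\sum_{i\le\theta}L_x^{(i)}\}$ and $$\mathcal S^{\mathfrak R}_{x,\theta}(t)=\mathbb P\bigl(\tau_{x,0}=0,\ U^{t}_{(1)}>\tau_{x,1},\dots,U^{t}_{(\theta)}>\tau_{x,\theta}\bigr),$$ where $U^t_{(1)}\le\dots\le U^t_{(\theta)}$ are the order statistics of $\theta$ i.i.d. variables with density $\mathfrak R/\int_0^t\mathfrak R$ on $[0,t]$, independent of the shock $\epsilon_x$ and the losses. (At $t=0$ only $\theta=0$ matters.) Let $$f_W(t)=\lambda(1-\phi^{\mathfrak R}(t))-\sum_{x}\mu_xd_x^-\sum_{\theta=0}^{d_x^+}b(d_x^+,\phi^{\mathfrak R}(t),\theta)\,\mathcal S^{\mathfrak R}_{x,\theta}(t),\qquad t^\star=\inf\{t\ge0:f_W(t)=0\}.$$ A zero $t$ of $f_W$ is *stable* if $f_W<0$ on $(t,t+\epsilon)$ for some $\epsilon>0$.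 **Theorem.** As $n\to\infty$: (i) If $\int_0^{t^\star}\mathfrak R(s)\,ds=\lambda$ and $d_x^-\ge1$ for every $x$ with $\mu_x>0$, then $D^{(n)}(\tau_n^\star)/n\to1$ in probability. (ii) If $t^\star<\infty$ is a stable zero of $f_W$ and $\int_0^{t^\star}\mathfrak R(s)\,ds<\lambda$, then in probability, for every $x$ with $\mu_x>0$, $$\frac{D_x^{(n)}(\tau_n^\star)}{n\mu_x^{(n)}}\to1-\sum_{\theta=0}^{d_x^+}b(d_x^+,\phi^{\mathfrak R}(t^\star),\theta)\,\mathcal S^{\mathfrak R}_{x,\theta}(t^\star),$$ $$\frac{D^{(n)}(\tau_n^\star)}n\to\sum_x\mu_x\Bigl(1-\sum_{\theta=0}^{d_x^+}b(d_x^+,\phi^{\mathfrak R}(t^\star),\theta)\,\mathcal S^{\mathfrak R}_{x,\theta}(t^\star)\Bigr).$$ (iii) If $t^\star=\infty$ and $\|\mathfrak R\|_{L^1}<\lambda$, and if $\mathcal R_n/n$ approximates $\mathfrak R$ also in $L^1$, i.e. $\int_0^{\tau_n^\star}|\mathcal R_n(t)/n-\mathfrak R(t)|\,dt\to0$ in probability,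 then the limits $\mathcal S^{\mathfrak R}_{x,\theta}(\infty)=\lim_{t\to\infty}\mathcal S^{\mathfrak R}_{x,\theta}(t)$ exist for all $x$ and $\theta\le d_x^+$, and in probability, for every $x$ with $\mu_x>0$, $$\frac{D_x^{(n)}(\tau_n^\star)}{n\mu_x^{(n)}}\to1-\sum_{\theta=0}^{d_x^+}b(d_x^+,\|\mathfrak R\|_{L^1}/\lambda,\theta)\,\mathcal S^{\mathfrak R}_{x,\theta}(\infty),$$ $$\frac{D^{(n)}(\tau_n^\star)}n\to\sum_x\mu_x\Bigl(1-\sum_{\theta=0}^{d_x^+}b(d_x^+,\|\mathfrak R\|_{L^1}/\lambda,\theta)\,\mathcal S^{\mathfrak R}_{x,\theta}(\infty)\Bigr).$$ -/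

import Mathlib

open MeasureTheory ProbabilityTheory Filter Topology
open scoped NNReal ENNReal

noncomputable section

namespace RuinNetwork

/-- The type-dependent characteristics of the agents.  The shock and loss laws have densities,
which is expressed by absolute continuity with respect to Lebesgue measure. -/
structure Params (X : Type*) where
  /-- number `d⁺` of incoming links -/
  inDeg : X → ℕ
  /-- number `d⁻` of outgoing links -/
  outDeg : X → ℕ
  /-- initial capital -/
  γ : X → ℝ
  γ_pos : ∀ x, 0 < γ x
  /-- accumulated premium as a function of time -/
  α : X → ℝ → ℝ
  α_cont : ∀ x, ContinuousOn (α x) (Set.Ici 0)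
  α_mono : ∀ x, MonotoneOn (α x) (Set.Ici 0)
  /-- external debt -/
  δ : X → ℝ
  /-- law of the initial proportional shock -/
  shockLaw : X → Measure ℝ
  shockLaw_prob : ∀ x, IsProbabilityMeasure (shockLaw x)
  shockLaw_ac : ∀ x, shockLaw x ≪ volume
  shockLaw_supp : ∀ x, shockLaw x (Set.Icc 0 1)ᶜ = 0
  /-- law of an incoming loss -/
  lossLaw : X → Measure ℝ
  lossLaw_prob : ∀ x, IsProbabilityMeasure (lossLaw x)
  lossLaw_ac : ∀ x, lossLaw x ≪ volume
  lossLaw_supp : ∀ x, lossLaw x (Set.Iic 0) = 0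

/-! ### The limit functions -/

section Limit

variable {X : Type*} (p : Params X) (μ : X → ℝ) (lam : ℝ) (R : ℝ → ℝ)

/-- `∫₀ᵀ R(s) ds`, for `T ∈ [0, ∞]`. -/
def cumul (T : ℝ≥0∞) : ℝ := ∫ s in {s : ℝ | 0 ≤ s ∧ ENNReal.ofReal s ≤ T}, R s

/-- The `L¹` norm of `R` on `[0, ∞)`. -/
def normL1 : ℝ := ∫ s in Set.Ici (0 : ℝ), |R s|

/-- `t_R(λ) = inf {t ≥ 0 : ∫₀ᵗ R ≥ λ}`, with `inf ∅ = ∞`. -/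
def exhaustTime : ℝ≥0∞ := ⨅ (t : ℝ≥0) (_ : lam ≤ cumul R t), (t : ℝ≥0∞)

/-- `φ(t) = λ⁻¹ ∫₀^{t ∧ t_R(λ)} R`. -/
def phi (t : ℝ≥0) : ℝ := cumul R (min (t : ℝ≥0∞) (exhaustTime lam R)) / lam

/-- The binomial probability `P(Bin(d, z) = l)`. -/
def binom (d : ℕ) (z : ℝ) (l : ℕ) : ℝ := (d.choose l : ℝ) * z ^ l * (1 - z) ^ (d - l)

/-- The threshold time: the smallest time at which an agent of type `x` with shock `e` has
accumulated enough capital to absorb a total loss `a` (`∞` if there is none). -/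
def threshold (x : X) (e a : ℝ) : ℝ≥0∞ :=
  ⨅ (t : ℝ≥0) (_ : a ≤ p.γ x * (1 - e) + p.α x t - p.δ x), (t : ℝ≥0∞)

/-- The law on `[0, t]` with density `R / ∫₀ᵗ R`. -/
def arrivalLaw (t : ℝ≥0) : Measure ℝ :=
  (ENNReal.ofReal (cumul R t))⁻¹ •
    (volume.restrict (Set.Icc 0 (t : ℝ))).withDensity (fun s => ENNReal.ofReal (R s))

/-- The survival event, in the shock `e`, the losses `l` and the unordered arrival times `u`:
the agent is initially solvent, and for each `k = 1, …, θ` the `k`-th smallest arrival time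
exceeds the threshold time of the first `k` losses. -/
def survivalEvent (x : X) (θ : ℕ) : Set (ℝ × (Fin θ → ℝ) × (Fin θ → ℝ)) :=
  {w | threshold p x w.1 0 = 0 ∧
    ∀ k : Fin θ, threshold p x w.1 (∑ i ∈ Finset.univ.filter (fun i => i ≤ k), w.2.1 i) <
      ENNReal.ofReal (w.2.2 (Tuple.sort w.2.2 k))}

/-- The survival probability `S_{x,θ}(t)`: shock, losses and arrival times are independent.
For `θ = 0` this is the probability of being initially solvent. -/
def survival (x : X) (θ : ℕ) (t : ℝ≥0) : ℝ :=
  ((p.shockLaw x).prod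
    ((Measure.pi (fun _ : Fin θ => p.lossLaw x)).prod
      (Measure.pi (fun _ : Fin θ => arrivalLaw R t)))).real (survivalEvent p x θ)

/-- The limiting fraction `f_W(t)` of unrevealed ruinous outgoing half-edges. -/
def fW (t : ℝ≥0) : ℝ :=
  lam * (1 - phi lam R t) -
    ∑' x, μ x * (p.outDeg x : ℝ) *
      ∑ θ ∈ Finset.range (p.inDeg x + 1),
        binom (p.inDeg x) (phi lam R t) θ * survival p R x θ t

/-- `t* = inf {t ≥ 0 : f_W(t) = 0}`, with `inf ∅ = ∞`. -/
def tStar : ℝ≥0∞ := ⨅ (t : ℝ≥0) (_ : fW p μ lam R t = 0), (t : ℝ≥0∞)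

/-- `t` is a stable zero of `f_W`: the function is negative immediately to the right of `t`. -/
def IsStableZero (t : ℝ≥0) : Prop :=
  fW p μ lam R t = 0 ∧ ∃ e : ℝ≥0, 0 < e ∧ ∀ s : ℝ≥0, t < s → s < t + e → fW p μ lam R s < 0

end Limit

/-! ### The loss reveal process on the configuration model -/

section Cascade

variable {X : Type*} (p : Params X) {n : ℕ} (ty : Fin n → X)

/-- Incoming half-edges of the agents `0, …, n - 1`, agent `i` being of type `ty i`. -/
abbrev InHalf := Σ i : Fin n, Fin (p.inDeg (ty i))

/-- Outgoing half-edges. -/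
abbrev OutHalf := Σ i : Fin n, Fin (p.outDeg (ty i))

/-- The number of links. -/
abbrev numLinks : ℕ := ∑ i : Fin n, p.outDeg (ty i)

/-- The random ingredients of a loss reveal process. -/
structure Reveal (Ω : Type*) where
  /-- shock of each agent -/
  shock : Fin n → Ω → ℝ
  /-- loss carried by each incoming half-edge -/
  loss : InHalf p ty → Ω → ℝ
  /-- unit exponential clock between the `k`-th and the `(k + 1)`-th reveal -/
  clock : ℕ → Ω → ℝ
  /-- the configuration: the matching of outgoing with incoming half-edges -/
  config : Ω → (OutHalf p ty ≃ InHalf p ty)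
  /-- the order in which outgoing half-edges are revealed (only its initial part, up to the
  end of the cascade, plays a role) -/
  order : Ω → (Fin (numLinks p ty) ≃ OutHalf p ty)
  /-- intensity of loss reveal after the `k`-th reveal, until the next one -/
  rate : ℕ → Ω → ℝ
  /-- additional randomness on which the order and the intensity may depend -/
  aux : MeasurableSpace Ω

namespace Reveal

variable {p ty} {Ω : Type*} (C : Reveal p ty Ω)

/-- The incoming half-edge that suffers the `(k + 1)`-th revealed loss. -/
def hit (k : Fin (numLinks p ty)) (ω : Ω) : InHalf p ty := C.config ω (C.order ω k)

/-- The time of the `k`-th reveal (`0` for `k = 0`).  After the `k`-th reveal one waits an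
exponential time with parameter `rate k`, that is, forever if `rate k = 0`. -/
def revealTime : ℕ → Ω → ℝ≥0∞
  | 0, _ => 0
  | k + 1, ω => revealTime k ω +
      (open Classical in if C.rate k ω = 0 then ⊤ else ENNReal.ofReal (C.clock k ω / C.rate k ω))

/-- The number of reveals up to time `t`. -/
def revealCount (t : ℝ≥0) (ω : Ω) : ℕ :=
  {k : Fin (numLinks p ty) | C.revealTime ((k : ℕ) + 1) ω ≤ t}.ncard

/-- The loss reveal intensity `R_n(t)`; it is constant between successive reveals. -/
def intensity (t : ℝ≥0) (ω : Ω) : ℝ := C.rate (C.revealCount t ω) ω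

/-- The capital of agent `i` at time `t`. -/
def capital (i : Fin n) (t : ℝ≥0) (ω : Ω) : ℝ :=
  p.γ (ty i) * (1 - C.shock i ω) + p.α (ty i) t - p.δ (ty i) -
    (open Classical in
      ∑ k : Fin (numLinks p ty),
        if C.revealTime ((k : ℕ) + 1) ω ≤ t ∧ (C.hit k ω).1 = i then C.loss (C.hit k ω) ω else 0)

/-- The set of agents ruined by time `T ∈ [0, ∞]`. -/
def ruined (T : ℝ≥0∞) (ω : Ω) : Set (Fin n) :=
  {i | ∃ s : ℝ≥0, (s : ℝ≥0∞) ≤ T ∧ C.capital i s ω ≤ 0}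

/-- `W_n(t)`: the number of unrevealed outgoing half-edges of agents ruined by time `t`. -/
def numRuinous (t : ℝ≥0) (ω : Ω) : ℕ :=
  {k : Fin (numLinks p ty) |
    (t : ℝ≥0∞) < C.revealTime ((k : ℕ) + 1) ω ∧ (C.order ω k).1 ∈ C.ruined t ω}.ncard

/-- `τ*_n`: the first time at which `W_n` vanishes (`∞` if there is none). -/
def stopTime (ω : Ω) : ℝ≥0∞ := ⨅ (t : ℝ≥0) (_ : C.numRuinous t ω = 0), (t : ℝ≥0∞)

/-- The final number of ruined agents. -/
def finalRuined (ω : Ω) : ℕ := (C.ruined (C.stopTime ω) ω).ncard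

/-- The final number of ruined agents of type `x`. -/
def finalRuinedOf (x : X) (ω : Ω) : ℕ := {i | i ∈ C.ruined (C.stopTime ω) ω ∧ ty i = x}.ncard

/-- The information available after `k` reveals: the shocks, the additional randomness, and
for the first `k` reveals the two half-edges, the loss and the clock. -/
@[reducible] def history (k : ℕ) : MeasurableSpace Ω :=
  C.aux ⊔ (⨆ i, MeasurableSpace.comap (C.shock i) inferInstance) ⊔
    ⨆ (j : Fin (numLinks p ty)) (_ : (j : ℕ) < k),
      (MeasurableSpace.comap (fun ω => C.order ω j) ⊤ ⊔
        MeasurableSpace.comap (C.hit j) ⊤ ⊔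
        MeasurableSpace.comap (fun ω => C.loss (C.hit j ω) ω) inferInstance ⊔
        MeasurableSpace.comap (C.clock j) inferInstance)

end Reveal

variable {p ty}

/-- Labels of the independent sources of randomness. -/
inductive Source (p : Params X) (ty : Fin n → X)
  | shock (i : Fin n)
  | loss (h : InHalf p ty)
  | clock (k : ℕ)
  | config
  | aux

/-- The σ-algebra generated by a source of randomness. -/
@[reducible] def Reveal.sourceAlg {Ω : Type*} (C : Reveal p ty Ω) : Source p ty → MeasurableSpace Ω
  | .shock i => MeasurableSpace.comap (C.shock i) inferInstance
  | .loss h => MeasurableSpace.comap (C.loss h) inferInstance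
  | .clock k => MeasurableSpace.comap (C.clock k) inferInstance
  | .config => MeasurableSpace.comap C.config ⊤
  | .aux => C.aux

/-- `C` is a loss reveal process on the configuration model: the sources of randomness are
independent, with a uniform configuration; the next half-edge to be revealed and the intensity
are chosen according to the past; and only half-edges of ruined agents are revealed. -/
structure IsLossReveal {Ω : Type*} [MeasurableSpace Ω] (P : Measure Ω) (C : Reveal p ty Ω) :
    Prop where
  measurable_source : ∀ s, C.sourceAlg s ≤ ‹MeasurableSpace Ω›
  indep : iIndep C.sourceAlg P
  shock_law : ∀ i, P.map (C.shock i) = p.shockLaw (ty i)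
  loss_law : ∀ h, P.map (C.loss h) = p.lossLaw (ty h.1)
  clock_law : ∀ k, P.map (C.clock k) = expMeasure 1
  config_law : ∀ σ : OutHalf p ty ≃ InHalf p ty,
    P {ω | C.config ω = σ} = (Nat.card (OutHalf p ty ≃ InHalf p ty) : ℝ≥0∞)⁻¹
  order_adapted : ∀ k : Fin (numLinks p ty),
    Measurable[C.history k, ⊤] (fun ω => C.order ω k)
  order_ruinous : ∀ᵐ ω ∂P, ∀ (k : Fin (numLinks p ty)) (t : ℝ≥0),
    C.revealTime k ω = t → C.numRuinous t ω ≠ 0 → (C.order ω k).1 ∈ C.ruined t ω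
  rate_nonneg : ∀ k ω, 0 ≤ C.rate k ω
  rate_adapted : ∀ k, Measurable[C.history k] (C.rate k)

end Cascade

/-! ### Asymptotics -/

/-- Convergence in probability to a constant, on probability spaces that may vary with `n`. -/
def ConvInProb {Ω : ℕ → Type*} [∀ n, MeasurableSpace (Ω n)] (P : ∀ n, Measure (Ω n))
    (Z : ∀ n, Ω n → ℝ) (c : ℝ) : Prop :=
  ∀ η : ℝ, 0 < η → Tendsto (fun n => P n {ω | η ≤ |Z n ω - c|}) atTop (𝓝 0)

/-- The fraction of agents of type `x`. -/
def typeFraction {X : Type*} {n : ℕ} (ty : Fin n → X) (x : X) : ℝ :=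
  ({i | ty i = x}.ncard : ℝ) / n

/-- The types of the agents have the limiting distribution `μ`, and the mean degrees converge to
those under `μ`, which are finite and positive. -/
structure NetworkLimit {X : Type*} (p : Params X) (ty : ∀ n : ℕ, Fin n → X) (μ : X → ℝ)
    (lam : ℝ) : Prop where
  μ_nonneg : ∀ x, 0 ≤ μ x
  μ_sum : HasSum μ 1
  fraction : ∀ x, Tendsto (fun n => typeFraction (ty n) x) atTop (𝓝 (μ x))
  lam_pos : 0 < lam
  mean_in : HasSum (fun x => μ x * (p.inDeg x : ℝ)) lam
  mean_out : HasSum (fun x => μ x * (p.outDeg x : ℝ)) lam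
  balanced : ∀ n, ∑ i, p.inDeg (ty n i) = ∑ i, p.outDeg (ty n i)
  mean_tendsto :
    Tendsto (fun n : ℕ => (∑ i, (p.inDeg (ty n i) : ℝ)) / n) atTop (𝓝 lam)

section Intensity

variable {X : Type*} {p : Params X} {ty : ∀ n : ℕ, Fin n → X} {Ω : ℕ → Type*}
  [∀ n, MeasurableSpace (Ω n)]

/-- The intensity vanishes after the end of the cascade, and `R_n = n R + o_p(n)` uniformly
before, where `R` is continuous, positive and integrable on `[0, ∞)`. -/
structure IntensityLimit (P : ∀ n, Measure (Ω n)) (C : ∀ n, Reveal p (ty n) (Ω n))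
    (R : ℝ → ℝ) : Prop where
  cont : ContinuousOn R (Set.Ici 0)
  pos : ∀ t, 0 ≤ t → 0 < R t
  integrable : IntegrableOn R (Set.Ici 0)
  stopped : ∀ n, ∀ᵐ ω ∂(P n), ∀ t : ℝ≥0, (C n).stopTime ω < t → (C n).intensity t ω = 0
  uniform : ∀ η : ℝ, 0 < η → Tendsto (fun n => P n {ω | ∃ t : ℝ≥0,
    (t : ℝ≥0∞) < (C n).stopTime ω ∧ η ≤ |(C n).intensity t ω / n - R t|}) atTop (𝓝 0)

/-- `R_n = n R + o_p(n)` in `L¹` of the duration of the cascade. -/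
def IntensityLimitL1 (P : ∀ n, Measure (Ω n)) (C : ∀ n, Reveal p (ty n) (Ω n))
    (R : ℝ → ℝ) : Prop :=
  ∀ η : ℝ≥0∞, 0 < η → Tendsto (fun n => P n {ω | η ≤
    ∫⁻ t in {t : ℝ | 0 ≤ t ∧ ENNReal.ofReal t < (C n).stopTime ω},
      ENNReal.ofReal |(C n).intensity t.toNNReal ω / n - R t|}) atTop (𝓝 0)

end Intensity

end RuinNetwork

end

noncomputable section

namespace RuinNetwork

/-! Write `mass R t` for the integral of `R` over `[0, t]`, and let `K` be the number of reveals
made before the cascade ends (`finalCount`). The proof shows that after `k` reveals with `k / n`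
near `mass R t`, about `n μ_x surviveProb(t)` agents of type `x` are solvent, and then determines `K
/ n`. Three ideas carry it.

Exchangeability. The matching is uniform and independent of the shocks, losses, clocks and extra
randomness. Hence the sequence of hit half-edges is a uniformly random ordering, however adaptively
the outgoing half-edges are chosen (`IsLossReveal.measure_hits_inter_le`). I.i.d. atomless times
attached to the incoming half-edges are also ordered uniformly. So an event about order, shocks and
losses is at most as likely as the same event on a product space (`IsLossReveal.measure_le_canon`).
There the agents are independent. If the times have density `R / lam` up to a horizon, about `n *
mass R t` half-edges are hit by time `t`. An agent of type `x` is then solvent up to `t` with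
probability `surviveProb`: the number of its hits is binomial (`agentLaw_mix`), and its i.i.d.
losses may be renumbered in the order of occurrence (`measure_sortedSolvent`).

Time change. Rate times waiting time is a unit exponential clock. By the law of large numbers for
the clocks, the `k`-th reveal happens when `mass R` is close to `k / n` (`whp_revealTime`). The
premium at that moment is thus close to a deterministic function of `k / n`. A margin `η` in
`Solvent` absorbs the discrepancy. It costs little because shocks and losses have no atoms, so the
capital is almost surely never exactly zero at a hit (`exists_margin_lower`, `exists_margin_upper`).

Conservation. Up to the end of the cascade every revealed outgoing half-edge belongs to a ruined
agent, and if the cascade stops, no half-edge of a ruined agent is left unrevealed. The ruinous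
half-edges minus the `k` revealed ones number about `n * fW(t)`. Hence the cascade cannot stop where
`fW` is positive (`whp_finalCount_lower`, by compactness) and cannot pass a point where `fW` is
negative (`whp_finalCount_upper`).

The three regimes follow. If the intensity up to `t*` exhausts `lam`, almost all links are revealed,
so the solvent agents have few outgoing half-edges in total and are therefore few. At a stable zero,
`K / n` is squeezed around `mass R t*`. If `t*` is infinite and the intensity is too small to
exhaust the links, `L¹` convergence bounds `K / n` above by `normL1 R` up to a small error, and
positivity of `fW` gives the matching lower bound. -/

/-- Solvency up to time `y0` of an agent of type `x` with shock `e`, whose in-half-edges carry the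
losses `l` and are hit at the times `y`, with a safety margin `η`; `b` is the accumulated premium
at the hitting times. -/
def Solvent {X : Type*} {ι τ : Type*} [Fintype ι] [LinearOrder τ] (p : Params X) (x : X)
    (e η : ℝ) (l : ι → ℝ) (y : ι → τ) (b : τ → ℝ) (y0 : τ) : Prop :=
  η < p.γ x * (1 - e) + p.α x 0 - p.δ x ∧
    ∀ j, y j ≤ y0 → η < p.γ x * (1 - e) + b (y j) - p.δ x - ∑ i with y i ≤ y j, l i

/-! ### Pathwise analysis: ruin and the end of the cascade in terms of the number of reveals. -/

namespace Reveal

variable {X : Type*} {p : Params X} {n : ℕ} {ty : Fin n → X} {Ω : Type*} (C : Reveal p ty Ω)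
  (ω : Ω)

/-- The sequence of hit half-edges. -/
def hits : Fin (numLinks p ty) ≃ InHalf p ty := (C.order ω).trans (C.config ω)

/-- The number of the reveal at which a half-edge is hit. -/
def rank (h : InHalf p ty) : ℕ := (C.hits ω).symm h + 1

lemma rank_hits (k : Fin (numLinks p ty)) : C.rank ω (C.hits ω k) = k + 1 := by
  simp [rank]

lemma rank_le (h : InHalf p ty) : C.rank ω h ≤ numLinks p ty := by
  have := ((C.hits ω).symm h).2
  simp only [rank]; omega

lemma rank_pos (h : InHalf p ty) : 0 < C.rank ω h := by simp [rank]

lemma rank_injective : Function.Injective (C.rank ω) := by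
  intro a b h
  simpa [rank, Fin.val_inj] using h

/-- The pathwise properties of a loss reveal process that hold almost surely. -/
structure Regular : Prop where
  clock_pos : ∀ k, 0 < C.clock k ω
  rate_nonneg : ∀ k, 0 ≤ C.rate k ω
  ruinous : ∀ (k : Fin (numLinks p ty)) (t : ℝ≥0),
    C.revealTime k ω = t → C.numRuinous t ω ≠ 0 → (C.order ω k).1 ∈ C.ruined t ω

variable {C ω}

lemma revealTime_mono : Monotone (fun k => C.revealTime k ω) :=
  monotone_nat_of_le_succ fun k => by simp [revealTime]

lemma revealTime_ne_top {k l : ℕ} (h : k ≤ l) (hl : C.revealTime l ω ≠ ⊤) :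
    C.revealTime k ω ≠ ⊤ := ne_top_of_le_ne_top hl (revealTime_mono h)

lemma revealTime_lt_succ (hr : C.Regular ω) {k : ℕ} (hk : C.revealTime k ω ≠ ⊤) :
    C.revealTime k ω < C.revealTime (k + 1) ω := by
  rw [revealTime]
  apply ENNReal.lt_add_right hk
  split_ifs with h
  · simp
  · have := hr.clock_pos k
    have h2 := (hr.rate_nonneg k).lt_of_ne' h
    simp only [ne_eq, ENNReal.ofReal_eq_zero, not_le]
    positivity

lemma revealTime_lt (hr : C.Regular ω) {k l : ℕ} (h : k < l) (hk : C.revealTime k ω ≠ ⊤) :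
    C.revealTime k ω < C.revealTime l ω :=
  (revealTime_lt_succ hr hk).trans_le (revealTime_mono h)

variable (C ω) in
open Classical in
/-- The number of reveals up to time `T ∈ [0, ∞]`. -/
def countBy (T : ℝ≥0∞) : ℕ :=
  Nat.findGreatest (fun k => C.revealTime k ω ≤ T ∧ C.revealTime k ω ≠ ⊤) (numLinks p ty)

lemma countBy_le (T : ℝ≥0∞) : C.countBy ω T ≤ numLinks p ty := Nat.findGreatest_le _

lemma countBy_spec (T : ℝ≥0∞) :
    C.revealTime (C.countBy ω T) ω ≤ T ∧ C.revealTime (C.countBy ω T) ω ≠ ⊤ := by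
  classical
  exact Nat.findGreatest_spec (P := fun k => C.revealTime k ω ≤ T ∧ C.revealTime k ω ≠ ⊤)
    (Nat.zero_le _) (by simp [revealTime])

lemma le_countBy_iff {T : ℝ≥0∞} {k : ℕ} (hk : k ≤ numLinks p ty) :
    k ≤ C.countBy ω T ↔ C.revealTime k ω ≤ T ∧ C.revealTime k ω ≠ ⊤ := by
  classical
  constructor
  · intro h
    exact ⟨(revealTime_mono h).trans (countBy_spec T).1, revealTime_ne_top h (countBy_spec T).2⟩
  · intro h
    exact Nat.le_findGreatest hk h

lemma countBy_mono : Monotone (C.countBy ω) := fun S T h => by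
  rw [le_countBy_iff (countBy_le S)]
  exact ⟨(countBy_spec S).1.trans h, (countBy_spec S).2⟩

lemma countBy_revealTime (hr : C.Regular ω) {k : ℕ} (hk : k ≤ numLinks p ty)
    (hT : C.revealTime k ω ≠ ⊤) : C.countBy ω (C.revealTime k ω) = k := by
  apply le_antisymm
  · by_contra! h
    exact absurd (countBy_spec (C.revealTime k ω)).1 (not_le.2 (revealTime_lt hr h hT))
  · rw [le_countBy_iff hk]
    exact ⟨le_rfl, hT⟩

lemma countBy_eq {k : ℕ} (hk : k ≤ numLinks p ty) {T : ℝ≥0∞}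
    (h1 : C.revealTime k ω ≤ T) (h2 : T < C.revealTime (k + 1) ω) : C.countBy ω T = k := by
  apply le_antisymm
  · by_contra! h
    have := (revealTime_mono (Nat.succ_le_of_lt h)).trans (countBy_spec (C := C) (ω := ω) T).1
    exact absurd this (not_le.2 h2)
  · rw [le_countBy_iff hk]
    exact ⟨h1, ne_top_of_le_ne_top h2.ne_top h1⟩

lemma countBy_zero (hr : C.Regular ω) : C.countBy ω 0 = 0 := by
  apply countBy_eq (Nat.zero_le _) le_rfl
  simpa [revealTime] using revealTime_lt_succ hr (k := 0) (by simp [revealTime])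

lemma lt_countBy_coe (t : ℝ≥0) (k : Fin (numLinks p ty)) :
    C.revealTime ((k : ℕ) + 1) ω ≤ t ↔ (k : ℕ) + 1 ≤ C.countBy ω t := by
  rw [le_countBy_iff k.2]
  exact ⟨fun h => ⟨h, ne_top_of_le_ne_top ENNReal.coe_ne_top h⟩, fun h => h.1⟩

lemma revealCount_eq (t : ℝ≥0) : C.revealCount t ω = C.countBy ω t := by
  have : {k : Fin (numLinks p ty) | C.revealTime ((k : ℕ) + 1) ω ≤ t} =
      ((Finset.univ.filter fun k : Fin (numLinks p ty) => (k : ℕ) < C.countBy ω t : Finset _) :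
        Set (Fin (numLinks p ty))) := by
    ext k
    simp only [Set.mem_ofPred_eq, lt_countBy_coe, Finset.coe_filter, Finset.mem_univ, true_and]
    omega
  rw [revealCount, this, Set.ncard_coe_finset, Fin.card_filter_val_lt,
    min_eq_right (countBy_le _)]

/-- The complete sequence of hits is a bijection, so each incoming half-edge occurs exactly once and
the sum over reveals can be reindexed by the half-edges of `i`. -/
lemma capital_eq (i : Fin n) (t : ℝ≥0) :
    C.capital i t ω = p.γ (ty i) * (1 - C.shock i ω) + p.α (ty i) t - p.δ (ty i) -
      ∑ j : Fin (p.inDeg (ty i)) with C.rank ω ⟨i, j⟩ ≤ C.countBy ω t, C.loss ⟨i, j⟩ ω := by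
  classical
  rw [capital]
  congr 1
  have h1 : ∀ k : Fin (numLinks p ty),
      (if C.revealTime ((k : ℕ) + 1) ω ≤ t ∧ (C.hit k ω).1 = i then C.loss (C.hit k ω) ω else 0) =
      (fun h : InHalf p ty => if C.rank ω h ≤ C.countBy ω t ∧ h.1 = i then C.loss h ω else 0)
        (C.hits ω k) := by
    intro k
    simp only [rank_hits, lt_countBy_coe]
    rfl
  rw [Finset.sum_congr rfl fun k _ => h1 k, Equiv.sum_comp (C.hits ω)
    (fun h : InHalf p ty => if C.rank ω h ≤ C.countBy ω t ∧ h.1 = i then C.loss h ω else 0),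
    Fintype.sum_sigma, Finset.sum_eq_single i]
  · simp [Finset.sum_filter]
  · intro b _ hb
    simp [hb]
  · simp

variable (C ω) in
/-- The agents that are ruined after `k` reveals. -/
def ruinedAfter (k : ℕ) : Set (Fin n) :=
  {i | ¬ Solvent p (ty i) (C.shock i ω) 0 (fun j => C.loss ⟨i, j⟩ ω) (fun j => C.rank ω ⟨i, j⟩)
    (fun k => p.α (ty i) (C.revealTime k ω).toReal) k}

lemma ruinedAfter_mono : Monotone (C.ruinedAfter ω) := by
  intro k l h i hi hs
  exact hi ⟨hs.1, fun j hj => hs.2 j (hj.trans h)⟩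

/-- Premiums are non-decreasing, so between hits the capital cannot fall. It suffices to test it at
time `0` and immediately after each hit, which makes ruin a function of the number of reveals. -/
lemma ruined_eq (hr : C.Regular ω) (T : ℝ≥0∞) : C.ruined T ω = C.ruinedAfter ω (C.countBy ω T) := by
  ext i
  simp only [ruined, ruinedAfter, Set.mem_ofPred_eq]
  constructor
  · rintro ⟨s, hs, hc⟩ ⟨hs0, hs1⟩
    rw [capital_eq] at hc
    have hmono := p.α_mono (ty i)
    by_cases hne : ∃ j, C.rank ω ⟨i, j⟩ ≤ C.countBy ω s
    · obtain ⟨j, hj, hmax⟩ := Finset.exists_max_image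
        (Finset.univ.filter fun j : Fin (p.inDeg (ty i)) => C.rank ω ⟨i, j⟩ ≤ C.countBy ω s)
        (fun j => C.rank ω ⟨i, j⟩) (by obtain ⟨j, hj⟩ := hne; exact ⟨j, by simpa using hj⟩)
      simp only [Finset.mem_filter, Finset.mem_univ, true_and] at hj hmax
      have h1 := hs1 j (hj.trans (countBy_mono hs))
      have h2 : (Finset.univ.filter fun j' : Fin (p.inDeg (ty i)) =>
          C.rank ω ⟨i, j'⟩ ≤ C.rank ω ⟨i, j⟩) =
          Finset.univ.filter fun j' : Fin (p.inDeg (ty i)) => C.rank ω ⟨i, j'⟩ ≤ C.countBy ω s := by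
        ext j'
        simp only [Finset.mem_filter, Finset.mem_univ, true_and]
        exact ⟨fun h => h.trans hj, fun h => hmax j' h⟩
      rw [h2] at h1
      have h3 := (le_countBy_iff (C.rank_le ω ⟨i, j⟩)).1 hj
      have h4 : p.α (ty i) (C.revealTime (C.rank ω ⟨i, j⟩) ω).toReal ≤ p.α (ty i) s := by
        apply hmono (by simp) (by simp)
        simpa using ENNReal.toReal_mono ENNReal.coe_ne_top h3.1
      linarith
    · push Not at hne
      rw [Finset.sum_eq_zero (by
        intro j hj
        simp only [Finset.mem_filter, Finset.mem_univ, true_and] at hj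
        exact absurd hj (not_le.2 (hne j)))] at hc
      have h4 : p.α (ty i) 0 ≤ p.α (ty i) s := hmono (by simp) (by simp) s.2
      linarith
  · intro h
    rw [Solvent, not_and_or] at h
    rcases h with h | h
    · refine ⟨0, by simp, ?_⟩
      rw [capital_eq, Finset.sum_eq_zero]
      · simpa using h
      · intro j hj
        have h0 := countBy_zero hr
        simp only [Finset.mem_filter, Finset.mem_univ, true_and, ENNReal.coe_zero, h0] at hj
        exact absurd hj (not_le.2 (C.rank_pos ω _))
    · push Not at h
      obtain ⟨j, hj, h⟩ := h
      have h3 := (le_countBy_iff (C.rank_le ω ⟨i, j⟩)).1 hj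
      refine ⟨(C.revealTime (C.rank ω ⟨i, j⟩) ω).toNNReal, ?_, ?_⟩
      · rw [ENNReal.coe_toNNReal h3.2]; exact h3.1
      · rw [capital_eq, ENNReal.coe_toNNReal h3.2, countBy_revealTime hr (C.rank_le ω _) h3.2]
        exact h

variable (C ω) in
/-- The number of reveals until the end of the cascade. -/
def finalCount : ℕ := C.countBy ω (C.stopTime ω)

lemma finalCount_le : C.finalCount ω ≤ numLinks p ty := countBy_le _

lemma finalRuined_eq (hr : C.Regular ω) :
    C.finalRuined ω = (C.ruinedAfter ω (C.finalCount ω)).ncard := by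
  rw [finalRuined, ruined_eq hr]; rfl

lemma finalRuinedOf_eq (hr : C.Regular ω) (x : X) :
    C.finalRuinedOf x ω = {i | i ∈ C.ruinedAfter ω (C.finalCount ω) ∧ ty i = x}.ncard := by
  rw [finalRuinedOf, ruined_eq hr]; rfl

lemma card_filter_order (A : Set (Fin n)) [DecidablePred (· ∈ A)] :
    (Finset.univ.filter fun k : Fin (numLinks p ty) => (C.order ω k).1 ∈ A).card =
      ∑ i with i ∈ A, p.outDeg (ty i) := by
  classical
  rw [Finset.card_filter, Equiv.sum_comp (C.order ω) (fun h : OutHalf p ty =>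
    if h.1 ∈ A then 1 else 0), Fintype.sum_sigma, Finset.sum_filter]
  refine Finset.sum_congr rfl fun i _ => ?_
  split_ifs <;> simp [*]

lemma numRuinous_ne_zero {t : ℝ≥0} (ht : (t : ℝ≥0∞) < C.stopTime ω) : C.numRuinous t ω ≠ 0 := by
  intro h
  exact absurd ht (not_lt.2 (iInf₂_le t h))

-- Before the end of the cascade each reveal takes a half-edge of an agent that is already ruined,
-- and ruined agents stay ruined. Thus the first `k` outgoing half-edges all belong to agents ruined
-- after `k` reveals.
open Classical in
lemma le_sum_outDeg (hr : C.Regular ω) {k : ℕ} (hk : k ≤ C.finalCount ω) :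
    k ≤ ∑ i with i ∈ C.ruinedAfter ω k, p.outDeg (ty i) := by
  rw [← card_filter_order (C := C) (ω := ω)]
  have hkm := hk.trans finalCount_le
  calc k = (Finset.univ.filter fun j : Fin (numLinks p ty) => (j : ℕ) < k).card := by
        rw [Fin.card_filter_val_lt, min_eq_right hkm]
    _ ≤ _ := by
        apply Finset.card_le_card
        intro j hj
        simp only [Finset.mem_filter, Finset.mem_univ, true_and] at hj ⊢
        have hjK : (j : ℕ) + 1 ≤ C.finalCount ω := (Nat.succ_le_of_lt hj).trans hk
        have h1 := (le_countBy_iff (by omega)).1 hjK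
        have h2 : C.revealTime j ω ≠ ⊤ := revealTime_ne_top (Nat.le_succ _) h1.2
        have h3 := (revealTime_lt_succ hr h2).trans_le h1.1
        -- The `(j + 1)`-th choice is made at the `j`-th reveal time. This lies strictly before the
        -- stopping time, so ruinous half-edges are still available.
        have h4 := hr.ruinous j (C.revealTime j ω).toNNReal (ENNReal.coe_toNNReal h2).symm
          (numRuinous_ne_zero (by rwa [ENNReal.coe_toNNReal h2]))
        rw [ruined_eq hr, ENNReal.coe_toNNReal h2, countBy_revealTime hr (by omega) h2] at h4
        exact ruinedAfter_mono hj.le h4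

-- When the cascade stops, all outgoing half-edges of ruined agents have been revealed. With
-- `le_sum_outDeg` this determines the final number of reveals.
open Classical in
lemma sum_outDeg_le (hr : C.Regular ω) (hs : C.stopTime ω ≠ ⊤) :
    ∑ i with i ∈ C.ruinedAfter ω (C.finalCount ω), p.outDeg (ty i) ≤ C.finalCount ω := by
  obtain ⟨t, ht0, htc⟩ : ∃ t : ℝ≥0, C.numRuinous t ω = 0 ∧ C.countBy ω t = C.finalCount ω := by
    -- The stopping time is an infimum, which need not be attained a priori. The state is constant
    -- until the next reveal `S` (`⊤` if all links are used), so a time in `[stopTime, S)` at which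
    -- `numRuinous` vanishes has the same count.
    have hex : ∃ S : ℝ≥0∞, C.stopTime ω < S ∧
        ∀ t : ℝ≥0, C.stopTime ω ≤ t → (t : ℝ≥0∞) < S → C.countBy ω t = C.finalCount ω := by
      rcases finalCount_le (C := C) (ω := ω) |>.eq_or_lt with hK | hK
      · refine ⟨⊤, hs.lt_top, fun t ht _ => le_antisymm ?_ (countBy_mono ht)⟩
        rw [hK]; exact countBy_le _
      · refine ⟨C.revealTime (C.finalCount ω + 1) ω, ?_, fun t ht hlt => ?_⟩
        · by_contra! h
          have := (le_countBy_iff (C := C) (ω := ω) (T := C.stopTime ω) (Nat.succ_le_of_lt hK)).2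
            ⟨h, ne_top_of_le_ne_top hs h⟩
          simp [finalCount] at this
        · exact countBy_eq finalCount_le ((countBy_spec _).1.trans ht) hlt
    obtain ⟨S, hS, hS2⟩ := hex
    have := hS
    rw [stopTime] at this
    simp only [iInf_lt_iff] at this
    obtain ⟨t, ht, htS⟩ := this
    exact ⟨t, ht, hS2 t (iInf₂_le t ht) htS⟩
  rw [← card_filter_order (C := C) (ω := ω)]
  calc _ ≤ (Finset.univ.filter fun j : Fin (numLinks p ty) => (j : ℕ) < C.finalCount ω).card := by
        apply Finset.card_le_card
        intro j hj
        simp only [Finset.mem_filter, Finset.mem_univ, true_and] at hj ⊢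
        by_contra! hlt
        rw [numRuinous, Set.ncard_eq_zero (Set.toFinite _)] at ht0
        apply (Set.eq_empty_iff_forall_notMem.1 ht0) j
        refine ⟨?_, ?_⟩
        · rw [← not_le, lt_countBy_coe, htc]; omega
        · rw [ruined_eq hr, htc]; exact hj
    _ = _ := by rw [Fin.card_filter_val_lt, min_eq_right finalCount_le]

end Reveal

end RuinNetwork

namespace RuinNetwork

/-- The accumulated intensity `∫₀ᵗ R`. -/
def mass (R : ℝ → ℝ) (t : ℝ) : ℝ := ∫ s in (0 : ℝ)..t, R s

/-! ### The accumulated intensity and the time change by the clocks. -/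

section Mass

variable {R : ℝ → ℝ}

lemma mass_zero : mass R 0 = 0 := by simp [mass]

lemma intervalIntegrable_of_cont (hc : ContinuousOn R (Set.Ici 0)) {s t : ℝ} (hs : 0 ≤ s)
    (ht : 0 ≤ t) : IntervalIntegrable R volume s t :=
  (hc.mono fun _ hx => (le_min hs ht).trans hx.1).intervalIntegrable

lemma mass_sub (hc : ContinuousOn R (Set.Ici 0)) {s t : ℝ} (hs : 0 ≤ s) (ht : 0 ≤ t) :
    mass R t - mass R s = ∫ u in s..t, R u :=
  intervalIntegral.integral_interval_sub_left (intervalIntegrable_of_cont hc le_rfl ht)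
    (intervalIntegrable_of_cont hc le_rfl hs)

/-- For one interval between reveals, with constant rate `r`. The bound is assumed only on `[s, t)`,
since the intensity jumps at the next reveal; the missing endpoint is a null set. -/
lemma abs_mass_sub_le (hc : ContinuousOn R (Set.Ici 0)) {s t r η : ℝ} (hs : 0 ≤ s) (hst : s ≤ t)
    (h : ∀ u, s ≤ u → u < t → |r - R u| ≤ η) :
    |r * (t - s) - (mass R t - mass R s)| ≤ η * (t - s) := by
  have ht := hs.trans hst
  rw [mass_sub hc hs ht]
  have h1 : r * (t - s) - ∫ u in s..t, R u = ∫ u in s..t, (r - R u) := by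
    rw [intervalIntegral.integral_sub (by simp) (intervalIntegrable_of_cont hc hs ht)]
    simp [mul_comm]
  rw [h1]
  have := intervalIntegral.norm_integral_le_of_norm_le_const_ae (a := s) (b := t) (C := η)
    (f := fun u => r - R u) (by
      filter_upwards [Measure.ae_ne volume t] with u hu hmem
      rw [Set.uIoc_of_le hst] at hmem
      exact h u hmem.1.le (lt_of_le_of_ne hmem.2 hu))
  rwa [abs_of_nonneg (sub_nonneg.2 hst)] at this

lemma mass_strictMonoOn (hc : ContinuousOn R (Set.Ici 0)) (hp : ∀ t, 0 ≤ t → 0 < R t) :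
    StrictMonoOn (mass R) (Set.Ici 0) := by
  intro s hs t ht hst
  rw [← sub_pos, mass_sub hc hs ht]
  refine intervalIntegral.intervalIntegral_pos_of_pos_on (intervalIntegrable_of_cont hc hs ht)
    (fun x hx => hp x (le_trans hs hx.1.le)) hst

lemma mass_monoOn (hc : ContinuousOn R (Set.Ici 0)) (hp : ∀ t, 0 ≤ t → 0 < R t) :
    MonotoneOn (mass R) (Set.Ici 0) := (mass_strictMonoOn hc hp).monotoneOn

lemma mass_nonneg (hc : ContinuousOn R (Set.Ici 0)) (hp : ∀ t, 0 ≤ t → 0 < R t) {t : ℝ}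
    (ht : 0 ≤ t) : 0 ≤ mass R t := by
  rw [← mass_zero (R := R)]
  exact mass_monoOn hc hp (by simp) ht ht

lemma mass_continuousOn (hc : ContinuousOn R (Set.Ici 0)) :
    ContinuousOn (mass R) (Set.Ici 0) := by
  intro t ht
  have h := intervalIntegral.continuousOn_primitive_interval' (b₁ := 0) (b₂ := t + 1) (a := 0)
    (intervalIntegrable_of_cont hc le_rfl (by simp only [Set.mem_Ici] at ht; linarith))
    (by simp)
  have ht' : (0 : ℝ) ≤ t := ht
  have h2 := h t (by rw [Set.uIcc_of_le (by linarith)]; exact ⟨ht, by linarith⟩)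
  refine h2.mono_of_mem_nhdsWithin ?_
  rw [Set.uIcc_of_le (by linarith)]
  exact mem_nhdsWithin.2 ⟨Set.Iio (t + 1), isOpen_Iio, by simp, fun x hx => ⟨hx.2, hx.1.le⟩⟩

end Mass

namespace Reveal

variable {X : Type*} {p : Params X} {n : ℕ} {ty : Fin n → X} {Ω : Type*} {C : Reveal p ty Ω}
  {ω : Ω} {R : ℝ → ℝ}

variable (C ω) in
/-- The sum of the first `k` clocks. -/
def clockSum (k : ℕ) : ℝ := ∑ j ∈ Finset.range k, C.clock j ω

lemma revealTime_succ_toReal (hr : C.Regular ω) {k : ℕ} (h : C.revealTime (k + 1) ω ≠ ⊤) :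
    0 < C.rate k ω ∧ (C.revealTime (k + 1) ω).toReal =
      (C.revealTime k ω).toReal + C.clock k ω / C.rate k ω := by
  have h0 : C.rate k ω ≠ 0 := by
    intro h0
    simp [revealTime, h0] at h
  have hpos := (hr.rate_nonneg k).lt_of_ne' h0
  refine ⟨hpos, ?_⟩
  rw [revealTime, if_neg h0, ENNReal.toReal_add (revealTime_ne_top (Nat.le_succ _) h)
    ENNReal.ofReal_ne_top, ENNReal.toReal_ofReal (div_nonneg (hr.clock_pos k).le hpos.le)]

lemma intensity_eq {k : ℕ} (hk : k ≤ numLinks p ty) {t : ℝ≥0}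
    (h1 : C.revealTime k ω ≤ t) (h2 : (t : ℝ≥0∞) < C.revealTime (k + 1) ω) :
    C.intensity t ω = C.rate k ω := by
  rw [intensity, revealCount_eq, countBy_eq hk h1 h2]

/-- Up to a small error, the number of reveals measured by the clocks is the accumulated
intensity. -/
lemma abs_clockSum_sub_mass_le (hr : C.Regular ω) (hc : ContinuousOn R (Set.Ici 0)) {η : ℝ}
    (hu : ∀ t : ℝ≥0, (t : ℝ≥0∞) < C.stopTime ω → |C.intensity t ω / n - R t| ≤ η)
    {k : ℕ} (hk : k ≤ C.finalCount ω) :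
    |C.clockSum ω k / n - mass R (C.revealTime k ω).toReal| ≤
      η * (C.revealTime k ω).toReal := by
  induction k with
  | zero => simp [clockSum, revealTime, mass_zero]
  | succ k ih =>
    have ih := ih (by omega)
    have hT := (le_countBy_iff (hk.trans finalCount_le)).1 hk
    obtain ⟨hpos, hE⟩ := revealTime_succ_toReal hr hT.2
    have hTk := revealTime_ne_top (Nat.le_succ k) hT.2
    have hle : (C.revealTime k ω).toReal ≤ (C.revealTime (k + 1) ω).toReal :=
      ENNReal.toReal_mono hT.2 (revealTime_mono (Nat.le_succ k))
    have key := abs_mass_sub_le (r := C.rate k ω / n) (η := η) hc ENNReal.toReal_nonneg hle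
      (by
        intro u h1 h2
        have hu0 : 0 ≤ u := le_trans ENNReal.toReal_nonneg h1
        lift u to ℝ≥0 using hu0
        have h1' : C.revealTime k ω ≤ u := by
          rw [← ENNReal.ofReal_toReal hTk, ENNReal.coe_nnreal_eq]
          exact ENNReal.ofReal_le_ofReal h1
        have h2' : (u : ℝ≥0∞) < C.revealTime (k + 1) ω := by
          rw [← ENNReal.ofReal_toReal hT.2, ENNReal.coe_nnreal_eq]
          exact (ENNReal.ofReal_lt_ofReal_iff (u.2.trans_lt h2)).2 h2
        have := hu u (h2'.trans_le hT.1)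
        rwa [intensity_eq ((Nat.le_succ k).trans (hk.trans finalCount_le)) h1' h2'] at this)
    -- Rate times waiting time is the clock, so the increments of intensity telescope into
    -- `clockSum`.
    have hcl : C.rate k ω / n * ((C.revealTime (k + 1) ω).toReal - (C.revealTime k ω).toReal) =
        C.clock k ω / n := by
      rw [hE]; field_simp; ring
    rw [hcl] at key
    rw [clockSum, Finset.sum_range_succ, add_div]
    rw [abs_le] at *
    rw [clockSum] at ih
    constructor <;> linarith

/-- The waiting interval in progress at time `t` has used at most its whole clock; this is the
reason for the extra clock in `countBy + 1`. -/
lemma mass_le_clockSum (hr : C.Regular ω) (hc : ContinuousOn R (Set.Ici 0)) {η : ℝ}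
    (hu : ∀ t : ℝ≥0, (t : ℝ≥0∞) < C.stopTime ω → |C.intensity t ω / n - R t| ≤ η)
    {t : ℝ≥0} (ht : (t : ℝ≥0∞) < C.stopTime ω) :
    mass R t ≤ C.clockSum ω (C.countBy ω t + 1) / n + η * t := by
  set k := C.countBy ω t with hkdef
  have hspec := countBy_spec (C := C) (ω := ω) t
  rw [← hkdef] at hspec
  have hk : k ≤ C.finalCount ω := countBy_mono ht.le
  have h1 := abs_clockSum_sub_mass_le hr hc hu hk
  -- If every link had been revealed, no unrevealed ruinous half-edge would remain and the cascade
  -- would have stopped.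
  have htop : numLinks p ty ≠ k := by
    intro h
    apply numRuinous_ne_zero ht
    rw [numRuinous, Set.ncard_eq_zero (Set.toFinite _), Set.eq_empty_iff_forall_notMem]
    rintro j ⟨hj, -⟩
    rw [← not_le, lt_countBy_coe, ← hkdef] at hj
    omega
  have hkm : k < numLinks p ty := lt_of_le_of_ne (countBy_le _) htop.symm
  have hlt : (t : ℝ≥0∞) < C.revealTime (k + 1) ω := by
    by_contra! h
    have := (le_countBy_iff (C := C) (ω := ω) (T := t) (Nat.succ_le_of_lt hkm)).2
      ⟨h, ne_top_of_le_ne_top ENNReal.coe_ne_top h⟩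
    omega
  have hle : (C.revealTime k ω).toReal ≤ t := by
    simpa using ENNReal.toReal_mono ENNReal.coe_ne_top hspec.1
  have key := abs_mass_sub_le (r := C.rate k ω / n) (η := η) hc ENNReal.toReal_nonneg hle
    (by
      intro u h1 h2
      have hu0 : 0 ≤ u := le_trans ENNReal.toReal_nonneg h1
      lift u to ℝ≥0 using hu0
      have h1' : C.revealTime k ω ≤ u := by
        rw [← ENNReal.ofReal_toReal hspec.2, ENNReal.coe_nnreal_eq]
        exact ENNReal.ofReal_le_ofReal h1
      have h2' : (u : ℝ≥0∞) < t := by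
        exact_mod_cast h2
      have := hu u (h2'.trans ht)
      rwa [intensity_eq hkm.le h1' (h2'.trans hlt)] at this)
  have hcl : C.rate k ω / n * (t - (C.revealTime k ω).toReal) ≤ C.clock k ω / n := by
    rw [div_mul_eq_mul_div]
    apply div_le_div_of_nonneg_right _ (Nat.cast_nonneg n)
    -- An infinite next reveal time means rate zero, so this interval contributes nothing.
    by_cases htop1 : C.revealTime (k + 1) ω = ⊤
    · have h0 : C.rate k ω = 0 := by
        by_contra h0
        rw [revealTime, if_neg h0] at htop1
        simp [hspec.2] at htop1
      rw [h0, zero_mul]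
      exact (hr.clock_pos k).le
    · obtain ⟨hpos, hE⟩ := revealTime_succ_toReal hr htop1
      have h3 : (t : ℝ) ≤ (C.revealTime (k + 1) ω).toReal := by
        simpa using ENNReal.toReal_mono htop1 hlt.le
      rw [hE] at h3
      calc C.rate k ω * (t - (C.revealTime k ω).toReal)
          ≤ C.rate k ω * (C.clock k ω / C.rate k ω) := by
            apply mul_le_mul_of_nonneg_left _ hpos.le; linarith
        _ = C.clock k ω := by field_simp
  rw [clockSum, Finset.sum_range_succ, add_div]
  rw [clockSum] at h1
  rw [abs_le] at *
  linarith

/-- The `L¹` version of the time change. -/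
lemma ofReal_clockSum_sub_mass_le (hr : C.Regular ω) (hc : ContinuousOn R (Set.Ici 0))
    {k : ℕ} (hk : k ≤ C.finalCount ω) :
    ENNReal.ofReal (C.clockSum ω k / n - mass R (C.revealTime k ω).toReal) ≤
      ∫⁻ t in Set.Ico 0 (C.revealTime k ω).toReal,
        ENNReal.ofReal |C.intensity t.toNNReal ω / n - R t| := by
  induction k with
  | zero => simp [clockSum, revealTime, mass_zero]
  | succ k ih =>
    have ih := ih (by omega)
    have hT := (le_countBy_iff (hk.trans finalCount_le)).1 hk
    obtain ⟨hpos, hE⟩ := revealTime_succ_toReal hr hT.2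
    have hTk := revealTime_ne_top (Nat.le_succ k) hT.2
    have hle : (C.revealTime k ω).toReal ≤ (C.revealTime (k + 1) ω).toReal :=
      ENNReal.toReal_mono hT.2 (revealTime_mono (Nat.le_succ k))
    -- The new half-open interval `[a, b)` contributes its clock minus its mass, the integral of
    -- `rate / n - R`. On this interval the intensity is exactly `rate k`.
    set a := (C.revealTime k ω).toReal with ha
    set b := (C.revealTime (k + 1) ω).toReal with hb
    have ha0 : 0 ≤ a := ENNReal.toReal_nonneg
    rw [← Set.Ico_union_Ico_eq_Ico ha0 hle, lintegral_union measurableSet_Ico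
      (Set.Ico_disjoint_Ico_same)]
    have hcl : C.clock k ω / n - (mass R b - mass R a) = ∫ u in a..b, (C.rate k ω / n - R u) := by
      rw [intervalIntegral.integral_sub (by simp)
        (intervalIntegrable_of_cont hc ha0 (ha0.trans hle)),
        mass_sub hc ha0 (ha0.trans hle)]
      simp only [intervalIntegral.integral_const, smul_eq_mul]
      rw [hE]; field_simp; ring
    have hstep : ENNReal.ofReal (C.clock k ω / n - (mass R b - mass R a)) ≤
        ∫⁻ t in Set.Ico a b, ENNReal.ofReal |C.intensity t.toNNReal ω / n - R t| := by
      rw [hcl, intervalIntegral.integral_of_le hle, ← setIntegral_congr_set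
        (Ico_ae_eq_Ioc (μ := volume))]
      calc ENNReal.ofReal (∫ u in Set.Ico a b, (C.rate k ω / n - R u))
          ≤ ENNReal.ofReal ‖∫ u in Set.Ico a b, (C.rate k ω / n - R u)‖ :=
            ENNReal.ofReal_le_ofReal (Real.le_norm_self _)
        _ ≤ ∫⁻ u in Set.Ico a b, ‖C.rate k ω / n - R u‖ₑ := by
            rw [ofReal_norm]
            exact enorm_integral_le_lintegral_enorm _
        _ = _ := by
            refine setLIntegral_congr_fun measurableSet_Ico fun u hu => ?_
            have hu0 : 0 ≤ u := ha0.trans hu.1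
            have h1' : C.revealTime k ω ≤ (u.toNNReal : ℝ≥0∞) := by
              rw [← ENNReal.ofReal_toReal hTk]
              exact ENNReal.ofReal_le_ofReal hu.1
            have h2' : (u.toNNReal : ℝ≥0∞) < C.revealTime (k + 1) ω := by
              rw [← ENNReal.ofReal_toReal hT.2]
              exact (ENNReal.ofReal_lt_ofReal_iff (hu0.trans_lt hu.2)).2 hu.2
            rw [intensity_eq ((Nat.le_succ k).trans (hk.trans finalCount_le)) h1' h2',
              ← Real.norm_eq_abs, ofReal_norm]
    refine le_trans ?_ (add_le_add ih hstep)
    refine le_trans (ENNReal.ofReal_le_ofReal (le_of_eq ?_)) ENNReal.ofReal_add_le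
    rw [clockSum, Finset.sum_range_succ, ← clockSum]
    ring

end Reveal

end RuinNetwork

namespace RuinNetwork

/-- The σ-algebra generated by all sources of randomness except for the configuration. -/
@[reducible] def Reveal.offConfig {X : Type*} {p : Params X} {n : ℕ} {ty : Fin n → X} {Ω : Type*}
    (C : Reveal p ty Ω) : MeasurableSpace Ω :=
  ⨆ s ∈ {s : Source p ty | s ≠ .config}, C.sourceAlg s

lemma Reveal.sourceAlg_le_offConfig {X : Type*} {p : Params X} {n : ℕ} {ty : Fin n → X}
    {Ω : Type*} {C : Reveal p ty Ω} {s : Source p ty} (hs : s ≠ .config) :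
    C.sourceAlg s ≤ C.offConfig :=
  le_iSup₂ (f := fun (s : Source p ty) (_ : s ∈ {s : Source p ty | s ≠ .config}) =>
    C.sourceAlg s) s hs

/-! ### Uniformity of the order of hits under adaptive choices. -/

namespace IsLossReveal

variable {X : Type*} {p : Params X} {n : ℕ} {ty : Fin n → X} {Ω : Type*} [mΩ : MeasurableSpace Ω]
  {P : Measure Ω} {C : Reveal p ty Ω}

lemma offConfig_le (hC : IsLossReveal P C) : C.offConfig ≤ mΩ :=
  iSup₂_le fun s _ => hC.measurable_source s

/-- Once the sequence of hits is fixed to be `σ`, the past reveals nothing further about the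
configuration. Hit half-edges are constants, revealed losses are the losses at known half-edges, and
earlier choices are handled by strong induction. The `comap`/`map` target consists of the sets whose
trace on `{hits = σ}` is the trace of an `offConfig` set. -/
lemma history_le (hC : IsLossReveal P C) (σ : Fin (numLinks p ty) ≃ InHalf p ty)
    (k : ℕ) :
    C.history k ≤ (C.offConfig.comap (Subtype.val : {ω | C.hits ω = σ} → Ω)).map Subtype.val := by
  have hZ : C.offConfig ≤
      (C.offConfig.comap (Subtype.val : {ω | C.hits ω = σ} → Ω)).map Subtype.val := by
    rw [← MeasurableSpace.comap_le_iff_le_map]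
  have hle : ∀ {s : Source p ty}, s ≠ .config → C.sourceAlg s ≤ _ :=
    fun hs => (Reveal.sourceAlg_le_offConfig hs).trans hZ
  induction k using Nat.strong_induction_on with
  | _ k ih =>
    refine sup_le (sup_le (hle (s := .aux) (by simp)) (iSup_le fun i => hle (s := .shock i)
      (by simp))) (iSup₂_le fun j hj => sup_le (sup_le (sup_le ?_ ?_) ?_) ?_)
    · exact ((hC.order_adapted j).comap_le).trans (ih j hj)
    · rintro _ ⟨A, -, rfl⟩
      refine ⟨{_ω | σ j ∈ A}, MeasurableSet.const _, ?_⟩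
      ext ⟨ω, hω⟩
      have : C.hit j ω = σ j := by rw [← hω]; rfl
      simp [this]
    · rintro _ ⟨A, hA, rfl⟩
      refine ⟨C.loss (σ j) ⁻¹' A, Reveal.sourceAlg_le_offConfig (s := .loss (σ j)) (by simp) _
        ⟨A, hA, rfl⟩, ?_⟩
      ext ⟨ω, hω⟩
      have : C.hit j ω = σ j := by rw [← hω]; rfl
      simp [this]
    · exact hle (s := .clock j) (by simp)

open Classical in
/-- The sequence of hit half-edges is uniformly distributed and independent of the shocks, the
losses and the clocks. -/
lemma measure_hits_inter_le [IsProbabilityMeasure P] (hC : IsLossReveal P C)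
    (σ : Fin (numLinks p ty) ≃ InHalf p ty) {B : Set Ω} (hB : MeasurableSet[C.offConfig] B) :
    P ({ω | C.hits ω = σ} ∩ B) ≤
      (Nat.card (Fin (numLinks p ty) ≃ InHalf p ty) : ℝ≥0∞)⁻¹ * P B := by
  by_cases hne : Nonempty Ω
  swap
  · rw [not_nonempty_iff] at hne
    rw [Set.eq_empty_of_isEmpty ({ω | C.hits ω = σ} ∩ B)]
    simp
  obtain ⟨ω₀⟩ := hne
  let Ψ := Fin (numLinks p ty) ≃ OutHalf p ty
  let : MeasurableSpace Ψ := ⊤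
  have : DiscreteMeasurableSpace Ψ := ⟨fun _ => trivial⟩
  let : TopologicalSpace Ψ := ⊥
  have : DiscreteTopology Ψ := ⟨rfl⟩
  have : Nonempty Ψ := ⟨C.order ω₀⟩
  have hmeas : Measurable[C.offConfig.comap (Subtype.val : {ω | C.hits ω = σ} → Ω)]
      (fun ω : {ω | C.hits ω = σ} => (C.order ω.1 : Ψ)) := by
    let := C.offConfig.comap (Subtype.val : {ω | C.hits ω = σ} → Ω)
    refine measurable_to_countable' fun ψ => ?_
    have : (fun ω : {ω | C.hits ω = σ} => (C.order ω.1 : Ψ)) ⁻¹' {ψ} =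
        ⋂ k, (fun ω : {ω | C.hits ω = σ} => C.order ω.1 k) ⁻¹' {ψ k} := by
      ext ω
      simp only [Set.mem_preimage, Set.mem_singleton_iff, Set.mem_iInter]
      exact ⟨fun h k => by rw [h], fun h => Equiv.ext h⟩
    rw [this]
    refine MeasurableSet.iInter fun k => ?_
    exact hC.history_le σ k _ (hC.order_adapted k (t := {ψ k}) trivial)
  -- On the event `hits = σ` the adaptive order agrees with `g`, which is `offConfig`-measurable on
  -- all of `Ω` and hence independent of the configuration.
  obtain ⟨g, hg, hgeq⟩ := @Measurable.exists_eq_measurable_comp _ _ _ C.offConfig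
    Subtype.val (fun ω : {ω | C.hits ω = σ} => (C.order ω.1 : Ψ)) _ _ _ hmeas
  have hcard : Nat.card (OutHalf p ty ≃ InHalf p ty) =
      Nat.card (Fin (numLinks p ty) ≃ InHalf p ty) := by
    exact Nat.card_congr ((C.order ω₀).symm.equivCongr (Equiv.refl _))
  have hind : Indep (C.sourceAlg .config) C.offConfig P := by
    have := indep_iSup_of_disjoint (m := C.sourceAlg) hC.measurable_source hC.indep
      (S := {.config}) (T := {s | s ≠ .config}) (by simp)
    simpa only [Set.mem_singleton_iff, iSup_iSup_eq_left] using this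
  have hgm : ∀ ψ : Ψ, MeasurableSet[C.offConfig] (g ⁻¹' {ψ}) := fun ψ => hg trivial
  -- If `g = ψ` and `hits = σ`, the configuration must be `ψ.symm.trans σ`. It takes this value with
  -- the uniform probability, independently of `g` and `B`. Summing over `ψ` removes `g`. Only the
  -- upper bound is needed.
  calc P ({ω | C.hits ω = σ} ∩ B)
      ≤ P (⋃ ψ : Ψ, {ω | C.config ω = ψ.symm.trans σ} ∩ (g ⁻¹' {ψ} ∩ B)) := by
        apply measure_mono
        rintro ω ⟨hω, hωB⟩
        have h1 : C.order ω = g ω := congrFun hgeq ⟨ω, hω⟩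
        refine Set.mem_iUnion.2 ⟨g ω, ?_, rfl, hωB⟩
        have hω' : (C.order ω).trans (C.config ω) = σ := hω
        simp only [Set.mem_ofPred_eq]
        rw [← hω', ← h1, ← Equiv.trans_assoc, Equiv.symm_trans_self, Equiv.refl_trans]
    _ ≤ ∑ ψ : Ψ, P ({ω | C.config ω = ψ.symm.trans σ} ∩ (g ⁻¹' {ψ} ∩ B)) :=
        measure_iUnion_fintype_le _ _
    _ = ∑ ψ : Ψ, (Nat.card (Fin (numLinks p ty) ≃ InHalf p ty) : ℝ≥0∞)⁻¹ *
          P.restrict B (g ⁻¹' {ψ}) := by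
        refine Finset.sum_congr rfl fun ψ _ => ?_
        rw [(Indep_iff _ _ _).1 hind {ω | C.config ω = ψ.symm.trans σ} (g ⁻¹' {ψ} ∩ B)
          ⟨{ψ.symm.trans σ}, trivial, rfl⟩ ((hgm ψ).inter hB), hC.config_law, hcard,
          Measure.restrict_apply (hC.offConfig_le _ (hgm ψ))]
    _ = _ := by
        rw [← Finset.mul_sum, sum_measure_preimage_singleton _
          (fun ψ _ => hC.offConfig_le _ (hgm ψ))]
        simp

end IsLossReveal

end RuinNetwork

namespace RuinNetwork

/-! ### Product measures and Chebyshev's inequality for counts. -/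

section Pi

variable {I J : Type*} [Fintype I] [Fintype J] {E : Type*} [MeasurableSpace E]

lemma pi_map_comp_injective (μ : I → Measure E) [∀ i, IsProbabilityMeasure (μ i)] {f : J → I}
    (hf : Function.Injective f) :
    MeasurePreserving (fun (w : I → E) j => w (f j)) (Measure.pi μ)
      (Measure.pi fun j => μ (f j)) := by
  refine ⟨by fun_prop, ?_⟩
  have h := (iIndepFun_pi (μ := μ) (X := fun _ => id) fun i => aemeasurable_id).precomp hf
  rw [h.map_fun_eq_pi_map fun j => (measurable_pi_apply _).aemeasurable]
  congr 1
  ext1 j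
  exact (measurePreserving_eval μ (f j)).map_eq

/-- By Fubini the diagonal is null for the square of an atomless law, and there are finitely many
pairs of coordinates. This excludes ties between hitting times. -/
lemma ae_injective_pi (κ : Measure E) [IsProbabilityMeasure κ] [NullSingletonClass κ]
    [MeasurableEq E] :
    ∀ᵐ s ∂(Measure.pi fun _ : I => κ), Function.Injective s := by
  have h : ∀ i j : I, i ≠ j → ∀ᵐ s ∂(Measure.pi fun _ : I => κ), s i ≠ s j := by
    intro i j hij
    have hmp := pi_map_comp_injective (fun _ : I => κ) (f := ![i, j]) (by
      intro a b; fin_cases a <;> fin_cases b <;> simp [hij, hij.symm])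
    have hmp2 := (measurePreserving_finTwoArrow κ).comp hmp
    have hdiag : (κ.prod κ) {z : E × E | z.1 = z.2} = 0 := by
      rw [Measure.measure_prod_null (measurableSet_eq_fun measurable_fst measurable_snd)]
      refine Filter.Eventually.of_forall fun x => ?_
      have : Prod.mk x ⁻¹' {z : E × E | z.1 = z.2} = {x} := by
        ext y; simp [eq_comm]
      simp [this]
    have := hmp2.measure_preimage
      (measurableSet_eq_fun measurable_fst measurable_snd).nullMeasurableSet
    rw [hdiag] at this
    rw [ae_iff]
    convert this using 2
    ext s
    simp
  have h2 := ae_all_iff.2 fun i => ae_all_iff.2 fun j => ae_all_iff.2 fun hij => h i j hij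
  filter_upwards [h2] with s hs i j hij
  by_contra hne
  exact hs i j hne hij

end Pi

section Chebyshev

variable {Ω ι : Type*} [MeasurableSpace Ω] {P : Measure Ω} [IsProbabilityMeasure P]

-- Chebyshev's inequality for a sum of indicators. Pairwise independence is enough, and each
-- variance is bounded crudely by one.
open Classical in
lemma measure_card_deviation_le (s : Finset ι) (E : ι → Set Ω) (hE : ∀ i, MeasurableSet (E i))
    (q : ℝ) (hq : ∀ i ∈ s, P.real (E i) = q)
    (hind : ∀ i ∈ s, ∀ j ∈ s, i ≠ j → P (E i ∩ E j) = P (E i) * P (E j))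
    {c : ℝ} (hc : 0 < c) :
    P {ω | c ≤ |((s.filter fun i => ω ∈ E i).card : ℝ) - s.card * q|} ≤
      ENNReal.ofReal (s.card / c ^ 2) := by
  set Y : ι → Ω → ℝ := fun i => (E i).indicator 1 with hY
  have hYm : ∀ i, Measurable (Y i) := fun i => measurable_one.indicator (hE i)
  have hYb : ∀ i ω, Y i ω ∈ Set.Icc (0 : ℝ) 1 := by
    intro i ω
    simp only [hY, Set.indicator]
    split_ifs <;> simp
  have hYL : ∀ i, MemLp (Y i) 2 P := fun i =>
    MemLp.of_bound (hYm i).aestronglyMeasurable 1 (ae_of_all _ fun ω => by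
      rw [Real.norm_eq_abs, abs_le]
      exact ⟨by linarith [(hYb i ω).1], (hYb i ω).2⟩)
  have hsum : ∀ ω, (∑ i ∈ s, Y i) ω = ((s.filter fun i => ω ∈ E i).card : ℝ) := by
    intro ω
    simp [hY, Set.indicator_apply, Finset.sum_apply]
  have hmean : P[∑ i ∈ s, Y i] = s.card * q := by
    simp only [Finset.sum_apply]
    rw [integral_finsetSum _ fun i _ => (hYL i).integrable (by norm_num)]
    rw [Finset.sum_congr rfl fun i hi => (integral_indicator_one (hE i)).trans (hq i hi)]
    simp
  have hvar : variance (∑ i ∈ s, Y i) P ≤ s.card := by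
    rw [IndepFun.variance_sum (fun i _ => hYL i)]
    · calc ∑ i ∈ s, variance (Y i) P ≤ ∑ i ∈ s, (1 : ℝ) := by
            refine Finset.sum_le_sum fun i _ => ?_
            refine (variance_le_sq_of_bounded (ae_of_all _ (hYb i)) (hYm i).aemeasurable).trans ?_
            norm_num
        _ = s.card := by simp
    · intro i hi j hj hij
      have : IndepSet (E i) (E j) P :=
        (indepSet_iff_measure_inter_eq_mul (hE i) (hE j) P).2 (hind i hi j hj hij)
      rw [IndepSet_iff_Indep] at this
      rw [IndepFun_iff_Indep]
      have hle : ∀ k, MeasurableSpace.comap (Y k) inferInstance ≤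
          MeasurableSpace.generateFrom {E k} := fun k =>
        (Measurable.indicator (@measurable_const _ _ _ (MeasurableSpace.generateFrom {E k}) 1)
          (MeasurableSpace.measurableSet_generateFrom rfl)).comap_le
      exact indep_of_indep_of_le this (hle i) (hle j)
  have := meas_ge_le_variance_div_sq (memLp_finsetSum' s fun i _ => hYL i) hc
  rw [hmean] at this
  simp only [hsum] at this
  refine this.trans (ENNReal.ofReal_le_ofReal ?_)
  gcongr

end Chebyshev

/-! ### The canonical space, on which half-edges are hit at independent times -/

section Canonical

variable {X : Type*} (p : Params X) (κ : Measure ℝ)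

instance (x : X) : IsProbabilityMeasure (p.shockLaw x) := p.shockLaw_prob x

instance (x : X) : IsProbabilityMeasure (p.lossLaw x) := p.lossLaw_prob x

/-- The law of the shock, the losses and the times of the losses of an agent of type `x`. -/
def agentLaw (x : X) (d : ℕ) : Measure (ℝ × (Fin d → ℝ) × (Fin d → ℝ)) :=
  (p.shockLaw x).prod ((Measure.pi fun _ => p.lossLaw x).prod (Measure.pi fun _ => κ))

instance (x : X) (d : ℕ) [IsProbabilityMeasure κ] : IsProbabilityMeasure (agentLaw p κ x d) := by
  unfold agentLaw; infer_instance

variable {n : ℕ} (ty : Fin n → X)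

/-- The laws of the shocks and losses. -/
def dataLaw : Fin n ⊕ InHalf p ty → Measure ℝ :=
  Sum.elim (fun i => p.shockLaw (ty i)) (fun h => p.lossLaw (ty h.1))

instance (k : Fin n ⊕ InHalf p ty) : IsProbabilityMeasure (dataLaw p ty k) := by
  rcases k with i | h
  · exact p.shockLaw_prob _
  · exact p.lossLaw_prob _

/-- The laws of the shocks, losses and times of losses. -/
def canonLaw : (Fin n ⊕ InHalf p ty) ⊕ InHalf p ty → Measure ℝ :=
  Sum.elim (dataLaw p ty) (fun _ => κ)

instance [IsProbabilityMeasure κ] (k : (Fin n ⊕ InHalf p ty) ⊕ InHalf p ty) :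
    IsProbabilityMeasure (canonLaw p κ ty k) := by
  rcases k with k | h
  · exact inferInstanceAs (IsProbabilityMeasure (dataLaw p ty k))
  · exact inferInstanceAs (IsProbabilityMeasure κ)

/-- Independent shocks, losses and times of losses. -/
def canon : Measure ((Fin n ⊕ InHalf p ty) ⊕ InHalf p ty → ℝ) := Measure.pi (canonLaw p κ ty)

instance [IsProbabilityMeasure κ] : IsProbabilityMeasure (canon p κ ty) := by
  unfold canon; infer_instance

variable {p ty}

/-- The data of an agent. -/
def agentData (i : Fin n) (w : (Fin n ⊕ InHalf p ty) ⊕ InHalf p ty → ℝ) :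
    ℝ × (Fin (p.inDeg (ty i)) → ℝ) × (Fin (p.inDeg (ty i)) → ℝ) :=
  (w (.inl (.inl i)), fun j => w (.inl (.inr ⟨i, j⟩)), fun j => w (.inr ⟨i, j⟩))

variable [IsProbabilityMeasure κ]

lemma measurePreserving_agentData (i : Fin n) :
    MeasurePreserving (agentData (p := p) (ty := ty) i) (canon p κ ty)
      (agentLaw p κ (ty i) (p.inDeg (ty i))) := by
  -- The coordinates of agent `i`: its shock, its losses and its hitting times. The remaining steps
  -- rebracket the product measure.
  let f : (Unit ⊕ Fin (p.inDeg (ty i))) ⊕ Fin (p.inDeg (ty i)) →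
      (Fin n ⊕ InHalf p ty) ⊕ InHalf p ty :=
    Sum.map (Sum.map (fun _ => i) (fun j => ⟨i, j⟩)) (fun j => ⟨i, j⟩)
  have hf : Function.Injective f := by
    refine Function.Injective.sumMap (Function.Injective.sumMap ?_ ?_) ?_
    · exact fun _ _ _ => rfl
    · intro a b h; simpa using h
    · intro a b h; simpa using h
  have h1 := pi_map_comp_injective (canonLaw p κ ty) hf
  have h2 := measurePreserving_sumPiEquivProdPi (X := fun _ => ℝ)
    (fun k => canonLaw p κ ty (f k))
  have h3 := measurePreserving_sumPiEquivProdPi (X := fun _ => ℝ)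
    (fun k => canonLaw p κ ty (f (.inl k)))
  have h4 := measurePreserving_funUnique (p.shockLaw (ty i)) Unit
  have h5 : MeasurePreserving _ _ _ := (h4.prod (MeasurePreserving.id
    (Measure.pi fun _ : Fin (p.inDeg (ty i)) => p.lossLaw (ty i)))).comp h3
  have h6 := (h5.prod (MeasurePreserving.id (Measure.pi fun _ : Fin (p.inDeg (ty i)) => κ))).comp
    (h2.comp h1)
  exact (measurePreserving_prodAssoc _ _ _).comp h6

/-- Every coordinate has a single owner, and the data of distinct agents use disjoint blocks of
independent coordinates. -/
lemma indepFun_agentData {i i' : Fin n} (h : i ≠ i') :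
    IndepFun (agentData (p := p) (ty := ty) i) (agentData i') (canon p κ ty) := by
  let owner : (Fin n ⊕ InHalf p ty) ⊕ InHalf p ty → Fin n :=
    Sum.elim (Sum.elim id fun h => h.1) fun h => h.1
  have hind : iIndep (fun k => MeasurableSpace.comap
      (fun w : (Fin n ⊕ InHalf p ty) ⊕ InHalf p ty → ℝ => w k) inferInstance) (canon p κ ty) :=
    (iIndepFun_pi (μ := canonLaw p κ ty) (X := fun _ => id) fun i => aemeasurable_id).iIndep
  have hdis : Disjoint {k | owner k = i} {k | owner k = i'} := by
    rw [Set.disjoint_left]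
    intro k hk hk'
    exact h (hk.symm.trans hk')
  have := indep_iSup_of_disjoint (fun k => (measurable_pi_apply k).comap_le) hind hdis
  rw [IndepFun_iff_Indep]
  have hle : ∀ i₀, MeasurableSpace.comap (agentData (p := p) (ty := ty) i₀) inferInstance ≤
      ⨆ k ∈ {k | owner k = i₀}, MeasurableSpace.comap
        (fun w : (Fin n ⊕ InHalf p ty) ⊕ InHalf p ty → ℝ => w k) inferInstance := by
    intro i₀
    rw [← measurable_iff_comap_le]
    have hk : ∀ k, owner k = i₀ → Measurable[⨆ k ∈ {k | owner k = i₀}, MeasurableSpace.comap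
        (fun w : (Fin n ⊕ InHalf p ty) ⊕ InHalf p ty → ℝ => w k) inferInstance]
        (fun w : (Fin n ⊕ InHalf p ty) ⊕ InHalf p ty → ℝ => w k) := by
      intro k hk
      rw [measurable_iff_comap_le]
      exact le_iSup₂ (f := fun k (_ : k ∈ {k | owner k = i₀}) => MeasurableSpace.comap
        (fun w : (Fin n ⊕ InHalf p ty) ⊕ InHalf p ty → ℝ => w k) inferInstance) k hk
    refine Measurable.prodMk (hk _ rfl) (Measurable.prodMk ?_ ?_)
    · exact @measurable_pi_lambda _ _ _ (_) _ _ fun j => hk _ rfl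
    · exact @measurable_pi_lambda _ _ _ (_) _ _ fun j => hk _ rfl
  exact indep_of_indep_of_le this (hle i) (hle i')

open Classical in
/-- The law of large numbers for the agents of type `x` on the canonical space. -/
lemma canon_count_agents (x : X) (B : ∀ i : Fin n,
      Set (ℝ × (Fin (p.inDeg (ty i)) → ℝ) × (Fin (p.inDeg (ty i)) → ℝ)))
    (hB : ∀ i, MeasurableSet (B i)) (q : ℝ)
    (hq : ∀ i, ty i = x → (agentLaw p κ (ty i) (p.inDeg (ty i))).real (B i) = q)
    {c : ℝ} (hc : 0 < c) :
    canon p κ ty {w | c ≤ |((Finset.univ.filter fun i => ty i = x ∧ agentData i w ∈ B i).card : ℝ) -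
      (Finset.univ.filter fun i => ty i = x).card * q|} ≤ ENNReal.ofReal (n / c ^ 2) := by
  have h := measure_card_deviation_le (P := canon p κ ty) (Finset.univ.filter fun i => ty i = x)
    (fun i => agentData i ⁻¹' B i)
    (fun i => (measurePreserving_agentData κ i).measurable (hB i)) q (by
      intro i hi
      rw [← hq i (by simpa using hi), measureReal_def, measureReal_def,
        (measurePreserving_agentData κ i).measure_preimage (hB i).nullMeasurableSet])
    (fun i _ j _ hij => (indepFun_agentData κ hij).measure_inter_preimage_eq_mul _ _
      (hB i) (hB j)) hc
  simp only [Finset.filter_filter, Set.mem_preimage] at h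
  refine h.trans (ENNReal.ofReal_le_ofReal ?_)
  gcongr
  exact (Finset.card_le_univ _).trans (by simp)

open Classical in
/-- The law of large numbers for the times of losses on the canonical space. -/
lemma canon_count_times (t : ℝ) {c : ℝ} (hc : 0 < c) :
    canon p κ ty {w | c ≤ |((Finset.univ.filter fun h : InHalf p ty => w (.inr h) ≤ t).card : ℝ) -
      Fintype.card (InHalf p ty) * κ.real (Set.Iic t)|} ≤
      ENNReal.ofReal (Fintype.card (InHalf p ty) / c ^ 2) := by
  have hmp : ∀ h : InHalf p ty, MeasurePreserving
      (fun w : (Fin n ⊕ InHalf p ty) ⊕ InHalf p ty → ℝ => w (.inr h)) (canon p κ ty) κ :=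
    fun h => measurePreserving_eval (canonLaw p κ ty) (.inr h)
  have hind := iIndepFun_pi (μ := canonLaw p κ ty) (X := fun _ => id) fun i => aemeasurable_id
  have h := measure_card_deviation_le (P := canon p κ ty) (Finset.univ : Finset (InHalf p ty))
    (fun h => (fun w => w (.inr h)) ⁻¹' Set.Iic t)
    (fun h => (hmp h).measurable measurableSet_Iic) (κ.real (Set.Iic t)) (by
      intro h _
      rw [measureReal_def, measureReal_def,
        (hmp h).measure_preimage measurableSet_Iic.nullMeasurableSet])
    (fun h _ h' _ hne => (hind.indepFun (i := .inr h) (j := .inr h') (by simpa using hne)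
      ).measure_inter_preimage_eq_mul _ _ measurableSet_Iic measurableSet_Iic) hc
  simpa using h

section Order

variable {H : Type*} {m : ℕ}

lemma exists_strictMono_comp (e : Fin m ≃ H) {s : H → ℝ} (hs : Function.Injective s) :
    ∃ σ : Fin m ≃ H, StrictMono (s ∘ σ) := by
  refine ⟨(Tuple.sort (s ∘ e)).trans e, ?_⟩
  refine Monotone.strictMono_of_injective (Tuple.monotone_sort (s ∘ e)) ?_
  exact hs.comp (Equiv.injective _)

variable [Fintype H]

-- Permuting i.i.d. coordinates shows that all orderings are equally likely, and almost surely one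
-- of them occurs because there are no ties. So each has probability at least the inverse of their
-- number.
open Classical in
lemma inv_card_le_measure_strictMono [NullSingletonClass κ] (σ : Fin m ≃ H) :
    (Nat.card (Fin m ≃ H) : ℝ≥0∞)⁻¹ ≤
      Measure.pi (fun _ : H => κ) {s | StrictMono (s ∘ σ)} := by
  have hmeas : ∀ τ : Fin m ≃ H, MeasurableSet {s : H → ℝ | StrictMono (s ∘ τ)} := by
    intro τ
    have : {s : H → ℝ | StrictMono (s ∘ τ)} =
        ⋂ a, ⋂ b, ⋂ (_ : a < b), {s : H → ℝ | s (τ a) < s (τ b)} := by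
      ext s; simp [StrictMono]
    rw [this]
    exact MeasurableSet.iInter fun a => MeasurableSet.iInter fun b => MeasurableSet.iInter fun _ =>
      measurableSet_lt (measurable_pi_apply _) (measurable_pi_apply _)
  have heq : ∀ τ : Fin m ≃ H, Measure.pi (fun _ : H => κ) {s | StrictMono (s ∘ τ)} =
      Measure.pi (fun _ : H => κ) {s | StrictMono (s ∘ σ)} := by
    intro τ
    have hmp := pi_map_comp_injective (fun _ : H => κ) (σ.symm.trans τ).injective
    have := hmp.measure_preimage (hmeas σ).nullMeasurableSet
    rw [← this]
    congr 1
    ext s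
    simp only [Set.mem_ofPred_eq, Set.mem_preimage]
    have : (fun j => s ((σ.symm.trans τ) j)) ∘ σ = s ∘ τ := by
      ext k; simp
    rw [this]
  have hone : 1 ≤ ∑ τ : Fin m ≃ H, Measure.pi (fun _ : H => κ) {s | StrictMono (s ∘ τ)} := by
    rw [← measure_univ (μ := Measure.pi (fun _ : H => κ))]
    refine le_trans ?_ (measure_iUnion_fintype_le _ _)
    refine measure_mono_ae ?_
    filter_upwards [ae_injective_pi (I := H) κ] with s hs _
    obtain ⟨τ, hτ⟩ := exists_strictMono_comp σ hs
    exact Set.mem_iUnion.2 ⟨τ, hτ⟩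
  rw [Finset.sum_congr rfl fun τ _ => heq τ] at hone
  simp only [Finset.sum_const, Finset.card_univ, nsmul_eq_mul,
    ← Nat.card_eq_fintype_card] at hone
  rw [ENNReal.inv_le_iff_le_mul]
  · exact hone
  · intro h; exact absurd h (measure_ne_top _ _)
  · simp

end Order

open Classical in
/-- Events that depend on the order in which the half-edges are hit are at most as likely as the
same events on the canonical space. -/
lemma IsLossReveal.measure_le_canon [NullSingletonClass κ] {Ω : Type*} [MeasurableSpace Ω]
    {P : Measure Ω} [IsProbabilityMeasure P] {C : Reveal p ty Ω} (hC : IsLossReveal P C)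
    (E : (Fin (numLinks p ty) ≃ InHalf p ty) → Set (Fin n ⊕ InHalf p ty → ℝ))
    (hE : ∀ σ, MeasurableSet (E σ)) :
    P {ω | (Sum.elim (fun i => C.shock i ω) (fun h => C.loss h ω)) ∈ E (C.hits ω)} ≤
      canon p κ ty {w | ∃ σ : Fin (numLinks p ty) ≃ InHalf p ty,
        StrictMono ((fun h => w (.inr h)) ∘ σ) ∧ (fun k => w (.inl k)) ∈ E σ} := by
  set D : Ω → (Fin n ⊕ InHalf p ty → ℝ) :=
    fun ω => Sum.elim (fun i => C.shock i ω) (fun h => C.loss h ω) with hD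
  let src : Fin n ⊕ InHalf p ty → Source p ty := Sum.elim .shock .loss
  have hsrc : Function.Injective src := by
    rintro (i | h) (i' | h') hh <;> simp_all [src]
  have hcomap : ∀ k, MeasurableSpace.comap (fun ω => D ω k) inferInstance =
      C.sourceAlg (src k) := by
    rintro (i | h) <;> rfl
  have hmeas : ∀ k, Measurable fun ω => D ω k := fun k => by
    rw [measurable_iff_comap_le, hcomap]; exact hC.measurable_source _
  have hind : iIndepFun (fun k ω => D ω k) P := by
    rw [iIndepFun_iff_iIndep]
    have := hC.indep.precomp hsrc
    convert this using 1
    ext1 k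
    exact hcomap k
  have hlaw : MeasurePreserving D P (Measure.pi (dataLaw p ty)) := by
    refine ⟨measurable_pi_lambda _ hmeas, ?_⟩
    rw [hind.map_fun_eq_pi_map fun k => (hmeas k).aemeasurable]
    congr 1
    ext1 k
    rcases k with i | h
    · exact hC.shock_law i
    · exact hC.loss_law h
  have hoff : Measurable[C.offConfig] D := by
    refine @measurable_pi_lambda _ _ _ (_) _ _ fun k => ?_
    rw [measurable_iff_comap_le, hcomap]
    exact Reveal.sourceAlg_le_offConfig (by rcases k with i | h <;> simp [src])
  have hsplit := measurePreserving_sumPiEquivProdPi (X := fun _ => ℝ) (canonLaw p κ ty)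
  have hsm : ∀ σ : Fin (numLinks p ty) ≃ InHalf p ty,
      MeasurableSet {s : InHalf p ty → ℝ | StrictMono (s ∘ σ)} := by
    intro τ
    have : {s : InHalf p ty → ℝ | StrictMono (s ∘ τ)} =
        ⋂ a, ⋂ b, ⋂ (_ : a < b), {s : InHalf p ty → ℝ | s (τ a) < s (τ b)} := by
      ext s; simp [StrictMono]
    rw [this]
    exact MeasurableSet.iInter fun a => MeasurableSet.iInter fun b => MeasurableSet.iInter fun _ =>
      measurableSet_lt (measurable_pi_apply _) (measurable_pi_apply _)
  have hmF : ∀ σ : Fin (numLinks p ty) ≃ InHalf p ty,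
      MeasurableSet ((E σ) ×ˢ {s : InHalf p ty → ℝ | StrictMono (s ∘ σ)}) :=
    fun σ => (hE σ).prod (hsm σ)
  calc P {ω | D ω ∈ E (C.hits ω)}
      ≤ P (⋃ σ, {ω | C.hits ω = σ} ∩ D ⁻¹' (E σ)) := by
        apply measure_mono
        intro ω hω
        exact Set.mem_iUnion.2 ⟨C.hits ω, rfl, hω⟩
    _ ≤ ∑ σ, P ({ω | C.hits ω = σ} ∩ D ⁻¹' (E σ)) := measure_iUnion_fintype_le _ _
    _ ≤ ∑ σ, canon p κ ty (MeasurableEquiv.sumPiEquivProdPi (fun _ => ℝ) ⁻¹'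
          ((E σ) ×ˢ {s : InHalf p ty → ℝ | StrictMono (s ∘ σ)})) := by
        refine Finset.sum_le_sum fun σ _ => ?_
        refine (hC.measure_hits_inter_le σ (hoff (hE σ))).trans ?_
        rw [hlaw.measure_preimage (hE σ).nullMeasurableSet]
        have h2 := hsplit.measure_preimage (hmF σ).nullMeasurableSet
        rw [Measure.prod_prod] at h2
        refine le_trans ?_ (le_of_eq h2.symm)
        rw [mul_comm]
        exact mul_le_mul_right (inv_card_le_measure_strictMono κ σ)
          (Measure.pi (dataLaw p ty) (E σ))
    -- The increasing enumeration of the times is unique, so different `σ` give disjoint events and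
    -- the sum of probabilities is the probability of the union.
    _ = canon p κ ty (⋃ σ, MeasurableEquiv.sumPiEquivProdPi (fun _ => ℝ) ⁻¹'
          ((E σ) ×ˢ {s : InHalf p ty → ℝ | StrictMono (s ∘ σ)})) := by
        rw [measure_iUnion, tsum_fintype]
        · intro σ τ hne
          refine Disjoint.preimage _ ?_
          rw [Set.disjoint_left]
          rintro ⟨u, s⟩ ⟨-, h1⟩ ⟨-, h2⟩
          apply hne
          have h1 : StrictMono (s ∘ σ) := h1
          have h2 : StrictMono (s ∘ τ) := h2
          have hr : Set.range (s ∘ σ) = Set.range (s ∘ τ) := by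
            rw [Set.range_comp, Set.range_comp, σ.surjective.range_eq, τ.surjective.range_eq]
          have heq := (StrictMono.range_inj h1 h2).1 hr
          have hs : Function.Injective s := by
            have := h1.injective.comp σ.symm.injective
            convert this using 1
            ext h; simp
          ext k : 1
          exact hs (congrFun heq k)
        · exact fun σ => (MeasurableEquiv.measurable _) (hmF σ)
    _ ≤ _ := by
        apply measure_mono
        intro w hw
        obtain ⟨σ, h1, h2⟩ := Set.mem_iUnion.1 hw
        exact ⟨σ, h2, h1⟩

end Canonical

end RuinNetwork

namespace RuinNetwork

/-! ### The limiting law of the time at which a half-edge is hit -/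

section Arrival

variable {R : ℝ → ℝ} {lam : ℝ}

lemma cumul_coe (t : ℝ≥0) : cumul R t = mass R t := by
  have : {s : ℝ | 0 ≤ s ∧ ENNReal.ofReal s ≤ (t : ℝ≥0∞)} = Set.Icc 0 (t : ℝ) := by
    ext s
    simp only [Set.mem_ofPred_eq, Set.mem_Icc, ENNReal.ofReal_le_coe]
  rw [cumul, this, mass, intervalIntegral.integral_of_le t.coe_nonneg, integral_Icc_eq_integral_Ioc]

lemma cumul_top : cumul R ⊤ = ∫ s in Set.Ici (0 : ℝ), R s := by
  simp [cumul, Set.Ici]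

variable (hc : ContinuousOn R (Set.Ici 0)) (hp : ∀ t, 0 ≤ t → 0 < R t)

include hc hp in
lemma phi_eq {t : ℝ≥0} (ht : mass R t < lam) : phi lam R t = mass R t / lam := by
  have : (t : ℝ≥0∞) ≤ exhaustTime lam R := by
    refine le_iInf₂ fun s hs => ?_
    rw [cumul_coe] at hs
    rw [ENNReal.coe_le_coe]
    by_contra! h
    have := mass_monoOn hc hp s.coe_nonneg t.coe_nonneg (by exact_mod_cast h.le : (s : ℝ) ≤ t)
    linarith
  rw [phi, min_eq_left this, cumul_coe]

variable (R lam) in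
/-- The density of the time at which a half-edge is hit. -/
def hitLaw : Measure ℝ :=
  (ENNReal.ofReal lam)⁻¹ •
    (volume.restrict (Set.Ici 0)).withDensity (fun s => ENNReal.ofReal (R s))

lemma hitLaw_restrict_eq (t : ℝ≥0) : (hitLaw R lam).restrict (Set.Iic (t : ℝ)) =
    (ENNReal.ofReal lam)⁻¹ •
    (volume.restrict (Set.Icc 0 (t : ℝ))).withDensity (fun s => ENNReal.ofReal (R s)) := by
  rw [hitLaw, Measure.restrict_smul, restrict_withDensity measurableSet_Iic,
    Measure.restrict_restrict measurableSet_Iic, Set.inter_comm, Set.Ici_inter_Iic]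

include hc hp in
lemma withDensity_univ_eq (t : ℝ≥0) :
    (volume.restrict (Set.Icc 0 (t : ℝ))).withDensity (fun s => ENNReal.ofReal (R s)) Set.univ =
      ENNReal.ofReal (mass R t) := by
  rw [withDensity_apply _ MeasurableSet.univ, Measure.restrict_univ,
    ← ofReal_integral_eq_lintegral_ofReal, mass, intervalIntegral.integral_of_le t.coe_nonneg,
    integral_Icc_eq_integral_Ioc]
  · exact (hc.mono Set.Icc_subset_Ici_self).integrableOn_Icc
  · filter_upwards [ae_restrict_mem measurableSet_Icc] with s hs
    exact (hp s hs.1).le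

include hc hp in
lemma hitLaw_Iic (hl : 0 < lam) (t : ℝ≥0) :
    hitLaw R lam (Set.Iic (t : ℝ)) = ENNReal.ofReal (mass R t / lam) := by
  rw [← Measure.restrict_apply_univ, hitLaw_restrict_eq, Measure.smul_apply,
    withDensity_univ_eq hc hp, smul_eq_mul, ENNReal.ofReal_div_of_pos hl, mul_comm,
    ENNReal.div_eq_inv_mul, mul_comm]

-- The arrivals up to `t` have total mass `mass R t / lam`, and `arrivalLaw` is their normalisation,
-- so the restriction is the product of the two.
include hc hp in
lemma hitLaw_restrict (hl : 0 < lam) (t : ℝ≥0) :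
    (hitLaw R lam).restrict (Set.Iic (t : ℝ)) =
      ENNReal.ofReal (mass R t / lam) • arrivalLaw R t := by
  rw [hitLaw_restrict_eq, arrivalLaw, smul_smul, cumul_coe]
  -- In this degenerate case, which includes `t = 0`, the normalising factor is infinite but
  -- multiplies the zero measure, so both sides vanish.
  by_cases h0 : mass R t = 0
  · have : (volume.restrict (Set.Icc 0 (t : ℝ))).withDensity (fun s => ENNReal.ofReal (R s)) = 0 :=
      by rw [← Measure.measure_univ_eq_zero, withDensity_univ_eq hc hp, h0, ENNReal.ofReal_zero]
    rw [this, smul_zero, smul_zero]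
  · have hpos : 0 < mass R t := (mass_nonneg hc hp t.coe_nonneg).lt_of_ne' h0
    congr 1
    rw [ENNReal.ofReal_div_of_pos hl, ENNReal.div_eq_inv_mul, mul_assoc, ENNReal.mul_inv_cancel,
      mul_one]
    · simpa using hpos
    · simp

include hc hp in
lemma isFiniteMeasure_arrivalLaw (t : ℝ≥0) : IsFiniteMeasure (arrivalLaw R t) := by
  refine ⟨?_⟩
  rw [arrivalLaw, Measure.smul_apply, withDensity_univ_eq hc hp, cumul_coe, smul_eq_mul]
  exact lt_of_le_of_lt (ENNReal.inv_mul_le_one _) (by simp)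

lemma hitLaw_ac : hitLaw R lam ≪ volume :=
  ((withDensity_absolutelyContinuous _ _).trans
    (Measure.restrict_le_self).absolutelyContinuous).smul_left _

lemma hitLaw_Iio : hitLaw R lam (Set.Iio 0) = 0 := by
  rw [hitLaw, Measure.smul_apply, withDensity_apply _ measurableSet_Iio,
    Measure.restrict_restrict measurableSet_Iio]
  have : Set.Iio (0 : ℝ) ∩ Set.Ici 0 = ∅ := by
    ext s; simp
  simp [this]

variable (R lam) in
/-- The law of the time at which a half-edge is hit, the times after `t₁` being replaced. -/
def truncLaw (t₁ : ℝ≥0) : Measure ℝ :=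
  (hitLaw R lam).restrict (Set.Iic (t₁ : ℝ)) +
    ENNReal.ofReal (1 - mass R t₁ / lam) • volume.restrict (Set.Ioc (t₁ : ℝ) (t₁ + 1))

lemma truncLaw_ac (t₁ : ℝ≥0) : truncLaw R lam t₁ ≪ volume := by
  refine Measure.AbsolutelyContinuous.add_left ?_ ?_
  · exact Measure.restrict_le_self.absolutelyContinuous.trans hitLaw_ac
  · exact (Measure.restrict_le_self.absolutelyContinuous).smul_left _

instance (t₁ : ℝ≥0) : NullSingletonClass (truncLaw R lam t₁) :=
  ⟨fun x => truncLaw_ac t₁ (measure_singleton x)⟩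

-- `hitLaw` has total mass `normL1 R / lam` for integrable `R`, which need not be one. The mass
-- missing up to `t₁` is spread over `(t₁, t₁ + 1]`; its exact position is irrelevant for events up
-- to `t₁`.
include hc hp in
lemma isProbabilityMeasure_truncLaw (hl : 0 < lam) {t₁ : ℝ≥0} (h : mass R t₁ < lam) :
    IsProbabilityMeasure (truncLaw R lam t₁) := by
  refine ⟨?_⟩
  rw [truncLaw, Measure.add_apply, Measure.restrict_apply_univ, hitLaw_Iic hc hp hl,
    Measure.smul_apply, Measure.restrict_apply_univ, Real.volume_Ioc, smul_eq_mul,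
    add_sub_cancel_left, ENNReal.ofReal_one, mul_one, ← ENNReal.ofReal_add]
  · simp
  · exact div_nonneg (mass_nonneg hc hp t₁.coe_nonneg) hl.le
  · rw [sub_nonneg, div_le_one hl]; exact h.le

lemma truncLaw_restrict {t t₁ : ℝ≥0} (h : t ≤ t₁) :
    (truncLaw R lam t₁).restrict (Set.Iic (t : ℝ)) = (hitLaw R lam).restrict (Set.Iic (t : ℝ)) := by
  have h' : (t : ℝ) ≤ t₁ := h
  rw [truncLaw, Measure.restrict_add, Measure.restrict_smul,
    Measure.restrict_restrict measurableSet_Iic, Measure.restrict_restrict measurableSet_Iic,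
    Set.Iic_inter_Iic, min_eq_left h']
  have : Set.Iic (t : ℝ) ∩ Set.Ioc (t₁ : ℝ) (t₁ + 1) = ∅ := by
    ext s; simp only [Set.mem_inter_iff, Set.mem_Iic, Set.mem_Ioc, Set.mem_empty_iff_false,
      iff_false]; rintro ⟨h1, h2, -⟩; linarith
  simp [this]

include hc hp in
lemma truncLaw_Iic (hl : 0 < lam) {t t₁ : ℝ≥0} (h : t ≤ t₁) :
    truncLaw R lam t₁ (Set.Iic (t : ℝ)) = ENNReal.ofReal (mass R t / lam) := by
  rw [← Measure.restrict_apply_univ, truncLaw_restrict h, Measure.restrict_apply_univ,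
    hitLaw_Iic hc hp hl]

include hc hp in
lemma truncLaw_Ioc (hl : 0 < lam) {s t t₁ : ℝ≥0} (hst : s ≤ t) (h : t ≤ t₁) :
    truncLaw R lam t₁ (Set.Ioc (s : ℝ) t) = ENNReal.ofReal ((mass R t - mass R s) / lam) := by
  have hst' : (s : ℝ) ≤ t := hst
  rw [← Set.Iic_sdiff_Iic, measure_sdiff (Set.Iic_subset_Iic.2 hst')
    measurableSet_Iic.nullMeasurableSet,
    truncLaw_Iic hc hp hl h, truncLaw_Iic hc hp hl (hst.trans h), sub_div,
    ENNReal.ofReal_sub]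
  · exact div_nonneg (mass_nonneg hc hp s.coe_nonneg) hl.le
  · rw [truncLaw_Iic hc hp hl (hst.trans h)]; simp

lemma truncLaw_Iic_zero (t₁ : ℝ≥0) : truncLaw R lam t₁ (Set.Iic 0) = 0 := by
  rw [← Measure.restrict_apply_univ]
  have := truncLaw_restrict (R := R) (lam := lam) (zero_le (a := t₁))
  rw [NNReal.coe_zero] at this
  rw [this, Measure.restrict_apply_univ, ← Set.Iio_union_right]
  refine measure_union_null hitLaw_Iio (hitLaw_ac (measure_singleton _))

end Arrival

end RuinNetwork

namespace RuinNetwork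

/-! ### Solvency as an event: monotonicity, stability and measurability. -/

section Solvent

variable {X : Type*} (p : Params X) (x : X)

/-- The accumulated premium, extended to negative times by a constant. -/
def prem (s : ℝ) : ℝ := p.α x (max s 0)

lemma continuous_prem : Continuous (prem p x) := by
  have h := (p.α_cont x).comp_continuous (f := fun s : ℝ => max s 0) (by fun_prop)
    fun s => le_max_right s 0
  exact h

lemma prem_of_nonneg {s : ℝ} (h : 0 ≤ s) : prem p x s = p.α x s := by
  rw [prem, max_eq_left h]

lemma monotone_prem : Monotone (prem p x) := fun s t h =>
  p.α_mono x (le_max_right s 0) (le_max_right t 0) (max_le_max_right 0 h)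

variable {p x}

lemma Solvent.mono {ι τ : Type*} [Fintype ι] [LinearOrder τ] {e η η' : ℝ} {l : ι → ℝ}
    {y : ι → τ} {b : τ → ℝ} {y₀ y₁ : τ} (h : Solvent p x e η l y b y₁) (hη : η' ≤ η)
    (hy : y₀ ≤ y₁) : Solvent p x e η' l y b y₀ :=
  ⟨hη.trans_lt h.1, fun j hj => hη.trans_lt (h.2 j (hj.trans hy))⟩

/-- Solvency is preserved if the hitting times are replaced in an order preserving way, and the
premiums change by little. -/
lemma Solvent.transfer {ι τ τ' : Type*} [Fintype ι] [LinearOrder τ] [LinearOrder τ'] {e η η' : ℝ}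
    {l : ι → ℝ} {y : ι → τ} {y' : ι → τ'} {b : τ → ℝ} {b' : τ' → ℝ} {y₀ : τ} {y₀' : τ'}
    (h : Solvent p x e η l y b y₀) (hη : η' ≤ η)
    (hord : ∀ i j, y' i ≤ y' j ↔ y i ≤ y j)
    (hcut : ∀ j, y' j ≤ y₀' → y j ≤ y₀)
    (hb : ∀ j, y' j ≤ y₀' → b (y j) - b' (y' j) ≤ η - η') :
    Solvent p x e η' l y' b' y₀' := by
  refine ⟨hη.trans_lt h.1, fun j hj => ?_⟩
  have h1 := h.2 j (hcut j hj)
  have h2 := hb j hj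
  simp only [hord]
  linarith

variable (p x) in
lemma measurableSet_solvent {ι : Type*} [Fintype ι] (η t : ℝ) :
    MeasurableSet {z : ℝ × (ι → ℝ) × (ι → ℝ) |
      Solvent p x z.1 η z.2.1 z.2.2 (prem p x) t} := by
  have hprem := (continuous_prem p x).measurable
  unfold Solvent
  have h0 : MeasurableSet {z : ℝ × (ι → ℝ) × (ι → ℝ) |
      η < p.γ x * (1 - z.1) + p.α x 0 - p.δ x} := measurableSet_lt (by fun_prop) (by fun_prop)
  refine h0.inter ?_
  change MeasurableSet {z : ℝ × (ι → ℝ) × (ι → ℝ) | ∀ j, z.2.2 j ≤ t →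
    η < p.γ x * (1 - z.1) + prem p x (z.2.2 j) - p.δ x - ∑ i with z.2.2 i ≤ z.2.2 j, z.2.1 i}
  rw [Set.ofPred_forall]
  refine MeasurableSet.iInter fun j => ?_
  have h1 : MeasurableSet {z : ℝ × (ι → ℝ) × (ι → ℝ) | z.2.2 j ≤ t} :=
    measurableSet_le (by fun_prop) (by fun_prop)
  have h2 : MeasurableSet {z : ℝ × (ι → ℝ) × (ι → ℝ) |
      η < p.γ x * (1 - z.1) + prem p x (z.2.2 j) - p.δ x -
        ∑ i with z.2.2 i ≤ z.2.2 j, z.2.1 i} := by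
    refine measurableSet_lt (by fun_prop) (Measurable.sub (by fun_prop) ?_)
    simp only [Finset.sum_filter]
    refine Finset.measurable_fun_sum _ fun i _ => ?_
    exact Measurable.ite (measurableSet_le (by fun_prop) (by fun_prop)) (by fun_prop) (by fun_prop)
  exact h1.imp h2

end Solvent

/-! ### The capital almost surely avoids zero. -/

section Boundary

/-- Given the other terms, the term with index `j` would have to hit one prescribed value, which has
probability zero for an atomless law. -/
lemma pi_sum_eq_null {I : Type*} [Fintype I] [DecidableEq I] (ν : Measure ℝ)
    [IsProbabilityMeasure ν] [NullSingletonClass ν] {S : Finset I} {j : I} (hj : j ∈ S) (a : ℝ) :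
    Measure.pi (fun _ : I => ν) {l | ∑ i ∈ S, l i = a} = 0 := by
  have hind := iIndepFun_pi (μ := fun _ : I => ν) (X := fun _ => (id : ℝ → ℝ))
    fun i => aemeasurable_id
  have h2 := hind.indepFun_finsetSum_of_notMem (fun i => measurable_pi_apply i)
    (Finset.notMem_erase j S)
  have hfm : ∀ i, Measurable fun ω : I → ℝ => id (ω i) := fun i => measurable_pi_apply i
  have hm : Measurable (∑ i ∈ S.erase j, fun ω : I → ℝ => id (ω i)) := by
    have : (∑ i ∈ S.erase j, fun ω : I → ℝ => id (ω i)) = fun ω => ∑ i ∈ S.erase j, ω i := by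
      ext ω; simp
    rw [this]; fun_prop
  rw [indepFun_iff_map_prod_eq_prod_map_map hm.aemeasurable
    (hfm j).aemeasurable] at h2
  have hnull : ((Measure.pi (fun _ : I => ν)).map (∑ i ∈ S.erase j, fun ω : I → ℝ => id (ω i))).prod
      ((Measure.pi (fun _ : I => ν)).map (fun ω : I → ℝ => id (ω j))) {z | z.1 + z.2 = a} = 0 := by
    have he : (Measure.pi (fun _ : I => ν)).map (fun ω : I → ℝ => id (ω j)) = ν :=
      (measurePreserving_eval (fun _ : I => ν) j).map_eq
    rw [he, Measure.measure_prod_null (measurableSet_eq_fun (by fun_prop) (by fun_prop))]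
    refine Filter.Eventually.of_forall fun u => ?_
    have : Prod.mk u ⁻¹' {z : ℝ × ℝ | z.1 + z.2 = a} = {a - u} := by
      ext v; simp only [Set.mem_preimage, Set.mem_ofPred_eq, Set.mem_singleton_iff]
      constructor <;> intro h <;> linarith
    simp [this]
  rw [← h2, Measure.map_apply (hm.prodMk (hfm j))
    (measurableSet_eq_fun (by fun_prop) (by fun_prop))] at hnull
  convert hnull using 2
  ext l
  simp only [Set.mem_ofPred_eq, Set.mem_preimage, Finset.sum_apply, id]
  rw [add_comm, Finset.add_sum_erase S (fun i => l i) hj]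

variable {X : Type*} (p : Params X) (x : X)

instance (x : X) : NullSingletonClass (p.shockLaw x) :=
  ⟨fun a => p.shockLaw_ac x (measure_singleton a)⟩

instance (x : X) : NullSingletonClass (p.lossLaw x) :=
  ⟨fun a => p.lossLaw_ac x (measure_singleton a)⟩

/-- As `γ x > 0`, the equation has exactly one solution `e`, and the shock law has no atoms. -/
lemma shock_boundary_null (a : ℝ) : p.shockLaw x {e | p.γ x * (1 - e) + a = 0} = 0 := by
  have : {e | p.γ x * (1 - e) + a = 0} = {1 + a / p.γ x} := by
    have := (p.γ_pos x).ne'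
    ext e
    simp only [Set.mem_ofPred_eq, Set.mem_singleton_iff]
    constructor
    · intro h; field_simp; linarith
    · rintro rfl; field_simp; ring
  rw [this]
  exact measure_singleton _

/-- Almost surely the capital is never exactly zero when a loss occurs. -/
lemma ae_capital_ne_zero {d : ℕ} (K : Measure (Fin d → ℝ)) [SFinite K] :
    ∀ᵐ z ∂((p.shockLaw x).prod ((Measure.pi fun _ : Fin d => p.lossLaw x).prod K)),
      p.γ x * (1 - z.1) + p.α x 0 - p.δ x ≠ 0 ∧
      ∀ (S : Finset (Fin d)) (j k : Fin d), k ∈ S →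
        p.γ x * (1 - z.1) + prem p x (z.2.2 j) - p.δ x - ∑ i ∈ S, z.2.1 i ≠ 0 := by
  have hprem := (continuous_prem p x).measurable
  refine Filter.Eventually.and ?_ ?_
  · have h := shock_boundary_null p x (p.α x 0 - p.δ x)
    have h2 : ∀ᵐ e ∂(p.shockLaw x), p.γ x * (1 - e) + p.α x 0 - p.δ x ≠ 0 := by
      rw [ae_iff]
      convert h using 3
      simp only [ne_eq, not_not, add_sub_assoc]
    exact Measure.quasiMeasurePreserving_fst.ae h2
  · rw [ae_all_iff]; intro S
    rw [ae_all_iff]; intro j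
    rw [ae_all_iff]; intro k
    rw [ae_all_iff]; intro hk
    have hm : MeasurableSet {z : ℝ × (Fin d → ℝ) × (Fin d → ℝ) |
        p.γ x * (1 - z.1) + prem p x (z.2.2 j) - p.δ x - ∑ i ∈ S, z.2.1 i = 0} :=
      measurableSet_eq_fun (by fun_prop) (by fun_prop)
    rw [ae_iff]
    simp only [ne_eq, not_not]
    rw [Measure.measure_prod_null hm]
    refine Filter.Eventually.of_forall fun e => ?_
    have hme := hm.preimage (f := Prod.mk e) (by fun_prop)
    change ((Measure.pi fun _ : Fin d => p.lossLaw x).prod K) (Prod.mk e ⁻¹' _) = 0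
    -- With the shock and all times fixed, the event forces a nonempty sum of losses to equal a
    -- constant.
    rw [Measure.prod_apply_symm hme]
    rw [lintegral_eq_zero_iff (measurable_measure_prodMk_right hme)]
    refine Filter.Eventually.of_forall fun y => ?_
    have h := pi_sum_eq_null (p.lossLaw x) hk (p.γ x * (1 - e) + prem p x (y j) - p.δ x)
    refine Eq.trans (congrArg _ ?_) h
    ext l
    simp only [Set.mem_preimage, Set.mem_ofPred_eq]
    constructor <;> intro h <;> linarith

end Boundary

/-! ### Threshold times versus the sign of the capital. -/

section Threshold

variable {X : Type*} (p : Params X) (x : X)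

/-- By continuity of the premium, strictly negative initial capital stays negative for a while and
makes the threshold positive. Exactly zero capital is excluded by `h`. -/
lemma threshold_zero_iff {e : ℝ} (h : p.γ x * (1 - e) + p.α x 0 - p.δ x ≠ 0) :
    threshold p x e 0 = 0 ↔ 0 < p.γ x * (1 - e) + p.α x 0 - p.δ x := by
  constructor
  · intro h0
    by_contra! hneg
    have hneg := lt_of_le_of_ne hneg h
    have hcont : ContinuousAt (fun s => p.γ x * (1 - e) + prem p x s - p.δ x) 0 := by
      have := continuous_prem p x
      fun_prop
    have hev : ∀ᶠ s in 𝓝 (0 : ℝ), p.γ x * (1 - e) + prem p x s - p.δ x < 0 := by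
      apply hcont.eventually_lt_const
      change p.γ x * (1 - e) + prem p x 0 - p.δ x < 0
      rwa [prem_of_nonneg p x le_rfl]
    obtain ⟨r, hr, hball⟩ := Metric.eventually_nhds_iff.1 hev
    have : ENNReal.ofReal r ≤ threshold p x e 0 := by
      refine le_iInf₂ fun t ht => ?_
      by_contra! hlt
      have h1 : (t : ℝ) < r := by
        rw [ENNReal.lt_ofReal_iff_toReal_lt ENNReal.coe_ne_top] at hlt
        exact hlt
      have h2 := hball (y := (t : ℝ)) (by rw [Real.dist_0_eq_abs, abs_of_nonneg t.coe_nonneg]; exact h1)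
      rw [prem_of_nonneg p x t.coe_nonneg] at h2
      linarith
    rw [h0] at this
    exact absurd this (by simpa using hr)
  · intro h0
    refine le_antisymm ?_ zero_le
    refine (iInf₂_le (0 : ℝ≥0) ?_).trans (by simp)
    simpa using h0.le

/-- Monotone premiums carry solvency from a time before `u` to `u`; continuity carries strict
solvency at `u` back to slightly earlier times. The boundary case excluded by `h` is the only one in
which the strict inequalities could disagree. -/
lemma threshold_lt_iff {e a u : ℝ} (hu : 0 < u)
    (h : p.γ x * (1 - e) + prem p x u - p.δ x - a ≠ 0) :
    threshold p x e a < ENNReal.ofReal u ↔ 0 < p.γ x * (1 - e) + prem p x u - p.δ x - a := by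
  constructor
  · intro hlt
    rw [threshold] at hlt
    simp only [iInf_lt_iff] at hlt
    obtain ⟨t, ht, htu⟩ := hlt
    have h1 : (t : ℝ) < u := by
      rw [ENNReal.lt_ofReal_iff_toReal_lt ENNReal.coe_ne_top] at htu
      exact htu
    have h2 := monotone_prem p x h1.le
    rw [prem_of_nonneg p x t.coe_nonneg] at h2
    exact lt_of_le_of_ne (by linarith) h.symm
  · intro hpos
    have hcont : ContinuousAt (fun s => p.γ x * (1 - e) + prem p x s - p.δ x - a) u := by
      have := continuous_prem p x
      fun_prop
    have hev : ∀ᶠ s in 𝓝[<] u, 0 < p.γ x * (1 - e) + prem p x s - p.δ x - a :=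
      (hcont.eventually_const_lt hpos).filter_mono nhdsWithin_le_nhds
    have hev2 : ∀ᶠ s in 𝓝[<] u, s ∈ Set.Ioo 0 u := Ioo_mem_nhdsLT hu
    obtain ⟨s, hs1, hs2⟩ := (hev.and hev2).exists
    lift s to ℝ≥0 using hs2.1.le
    refine lt_of_le_of_lt (iInf₂_le s ?_) ?_
    · rw [prem_of_nonneg p x s.coe_nonneg] at hs1
      linarith
    · rw [ENNReal.lt_ofReal_iff_toReal_lt ENNReal.coe_ne_top]
      exact hs2.2

end Threshold

/-! ### Renumbering the losses in the order of their occurrence. -/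

section Sorting

variable {X : Type*} (p : Params X) (x : X) (κ : Measure ℝ) [IsProbabilityMeasure κ]
  [NullSingletonClass κ]

/-- The event of solvency, with the losses numbered in the order of their occurrence. -/
def sortedSolvent (d : ℕ) : Set (ℝ × (Fin d → ℝ) × (Fin d → ℝ)) :=
  {z | 0 < p.γ x * (1 - z.1) + p.α x 0 - p.δ x ∧ ∃ σ : Equiv.Perm (Fin d), Monotone (z.2.2 ∘ σ) ∧
    ∀ k, 0 < p.γ x * (1 - z.1) + prem p x (z.2.2 (σ k)) - p.δ x - ∑ i with i ≤ k, z.2.1 i}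

lemma measurableSet_sortedSolvent (d : ℕ) : MeasurableSet (sortedSolvent p x d) := by
  have hprem := (continuous_prem p x).measurable
  have h0 : MeasurableSet {z : ℝ × (Fin d → ℝ) × (Fin d → ℝ) |
      0 < p.γ x * (1 - z.1) + p.α x 0 - p.δ x} := measurableSet_lt (by fun_prop) (by fun_prop)
  refine h0.inter ?_
  change MeasurableSet {z : ℝ × (Fin d → ℝ) × (Fin d → ℝ) | ∃ σ : Equiv.Perm (Fin d),
    Monotone (z.2.2 ∘ σ) ∧
    ∀ k, 0 < p.γ x * (1 - z.1) + prem p x (z.2.2 (σ k)) - p.δ x - ∑ i with i ≤ k, z.2.1 i}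
  rw [Set.ofPred_exists]
  refine MeasurableSet.iUnion fun σ => MeasurableSet.inter ?_ ?_
  · have : {z : ℝ × (Fin d → ℝ) × (Fin d → ℝ) | Monotone (z.2.2 ∘ σ)} =
        ⋂ a, ⋂ b, ⋂ (_ : a ≤ b), {z | z.2.2 (σ a) ≤ z.2.2 (σ b)} := by
      ext z; simp [Monotone]
    change MeasurableSet {z : ℝ × (Fin d → ℝ) × (Fin d → ℝ) | Monotone (z.2.2 ∘ σ)}
    rw [this]
    exact MeasurableSet.iInter fun a => MeasurableSet.iInter fun b => MeasurableSet.iInter fun _ =>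
      measurableSet_le (by fun_prop) (by fun_prop)
  · change MeasurableSet {z : ℝ × (Fin d → ℝ) × (Fin d → ℝ) | ∀ k,
      0 < p.γ x * (1 - z.1) + prem p x (z.2.2 (σ k)) - p.δ x - ∑ i with i ≤ k, z.2.1 i}
    rw [Set.ofPred_forall]
    exact MeasurableSet.iInter fun k => measurableSet_lt (by fun_prop) (by fun_prop)

/-- Numbering the losses in the order of their occurrence does not change the probability of
solvency. -/
lemma measure_sortedSolvent (d : ℕ) (t : ℝ) :
    agentLaw p (κ.restrict (Set.Iic t)) x d (sortedSolvent p x d) =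
      agentLaw p (κ.restrict (Set.Iic t)) x d
        {z | Solvent p x z.1 0 z.2.1 z.2.2 (prem p x) t} := by
  rw [agentLaw, Measure.prod_apply (measurableSet_sortedSolvent p x d),
    Measure.prod_apply (measurableSet_solvent p x 0 t)]
  refine lintegral_congr fun e => ?_
  rw [Measure.prod_apply_symm ((measurableSet_sortedSolvent p x d).preimage (by fun_prop)),
    Measure.prod_apply_symm ((measurableSet_solvent p x 0 t).preimage (by fun_prop)),
    ← Measure.restrict_pi_pi]
  refine lintegral_congr_ae ?_
  filter_upwards [ae_restrict_of_ae (ae_injective_pi (I := Fin d) κ),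
    ae_restrict_mem (MeasurableSet.univ_pi fun _ : Fin d => measurableSet_Iic (a := t))]
    with y hinj hyt
  -- Given the shock and the times, `σ` sorts the times and is deterministic. Permuting the i.i.d.
  -- losses by `σ` preserves their law and turns the sums by rank into sums by time.
  obtain ⟨σ, hσ⟩ := exists_strictMono_comp (Equiv.refl (Fin d)) hinj
  have hyt : ∀ j, y j ≤ t := fun j => hyt j trivial
  have hmp := pi_map_comp_injective (fun _ : Fin d => p.lossLaw x) σ.injective
  have hmeas := ((measurableSet_sortedSolvent p x d).preimage
    (f := Prod.mk e) (by fun_prop)).preimage (f := fun l : Fin d → ℝ => (l, y)) (by fun_prop)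
  rw [← hmp.measure_preimage hmeas.nullMeasurableSet]
  congr 1
  ext l
  simp only [sortedSolvent, Solvent, Set.mem_preimage, Set.mem_ofPred_eq]
  refine and_congr Iff.rfl ?_
  have hsum : ∀ k, ∑ i with i ≤ k, l (σ i) = ∑ i with y i ≤ y (σ k), l i := by
    intro k
    rw [Finset.sum_filter, Finset.sum_filter, 
      ← Equiv.sum_comp σ (fun i => if y i ≤ y (σ k) then l i else 0)]
    refine Finset.sum_congr rfl fun i _ => ?_
    have : y (σ i) ≤ y (σ k) ↔ i ≤ k := hσ.le_iff_le
    simp only [this]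
  constructor
  -- Any other sorting permutation `τ` produces the same sorted sequence of times.
  · rintro ⟨τ, hτ, h⟩ j -
    have hτσ : y ∘ τ = y ∘ σ := by
      have h1 : StrictMono (y ∘ τ) := hτ.strictMono_of_injective (hinj.comp τ.injective)
      have hr : Set.range (y ∘ τ) = Set.range (y ∘ σ) := by
        rw [Set.range_comp, Set.range_comp, σ.surjective.range_eq, τ.surjective.range_eq]
      exact (StrictMono.range_inj h1 hσ).1 hr
    have h2 := h (σ.symm j)
    rw [hsum] at h2
    have h3 : y (τ (σ.symm j)) = y j := by
      have := congrFun hτσ (σ.symm j)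
      simpa using this
    rwa [h3, Equiv.apply_symm_apply] at h2
  · intro h
    refine ⟨σ, hσ.monotone, fun k => ?_⟩
    rw [hsum]
    exact h (σ k) (hyt _)

omit [NullSingletonClass κ] in
lemma ae_pi_pos (h0 : κ (Set.Iic 0) = 0) (d : ℕ) :
    ∀ᵐ y ∂(Measure.pi fun _ : Fin d => κ), ∀ j, 0 < y j := by
  rw [ae_all_iff]
  intro j
  have : ∀ᵐ s ∂κ, 0 < s := by
    rw [ae_iff]
    simpa [Set.Iic] using h0
  exact (measurePreserving_eval (fun _ : Fin d => κ) j).quasiMeasurePreserving.ae this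

/-- The survival event, up to null sets. -/
lemma measure_survivalEvent (h0 : κ (Set.Iic 0) = 0) (d : ℕ) (t : ℝ) :
    agentLaw p (κ.restrict (Set.Iic t)) x d (survivalEvent p x d) =
      agentLaw p (κ.restrict (Set.Iic t)) x d
        {z | Solvent p x z.1 0 z.2.1 z.2.2 (prem p x) t} := by
  rw [← measure_sortedSolvent]
  refine measure_congr ?_
  have hpos : ∀ᵐ z ∂(agentLaw p (κ.restrict (Set.Iic t)) x d), ∀ j, 0 < z.2.2 j := by
    have h1 : ∀ᵐ y ∂(Measure.pi fun _ : Fin d => κ.restrict (Set.Iic t)), ∀ j, 0 < y j := by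
      rw [← Measure.restrict_pi_pi]
      exact ae_restrict_of_ae (ae_pi_pos κ h0 d)
    exact Measure.quasiMeasurePreserving_snd.ae (Measure.quasiMeasurePreserving_snd.ae h1)
  have hne := ae_capital_ne_zero p x (d := d) (Measure.pi fun _ => κ.restrict (Set.Iic t))
  filter_upwards [hpos, hne] with z hz hz2
  apply propext
  change z ∈ survivalEvent p x d ↔ z ∈ sortedSolvent p x d
  simp only [survivalEvent, sortedSolvent, Set.mem_ofPred_eq]
  refine and_congr (threshold_zero_iff p x hz2.1) ?_
  have hth : ∀ (j k : Fin d),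
      threshold p x z.1 (∑ i ∈ Finset.univ.filter (fun i => i ≤ k), z.2.1 i) <
        ENNReal.ofReal (z.2.2 j) ↔
      0 < p.γ x * (1 - z.1) + prem p x (z.2.2 j) - p.δ x - ∑ i with i ≤ k, z.2.1 i :=
    fun j k => threshold_lt_iff p x (hz j) (hz2.2 _ j k (by simp))
  simp only [hth]
  constructor
  · intro h
    exact ⟨Tuple.sort z.2.2, Tuple.monotone_sort _, h⟩
  · rintro ⟨σ, hσ, h⟩ k
    have := congrFun (Tuple.unique_monotone (Tuple.monotone_sort z.2.2) hσ) k
    simp only [Function.comp_apply] at this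
    rw [this]
    exact h k

end Sorting

end RuinNetwork

namespace RuinNetwork

/-! ### Decomposition according to which half-edges are hit by time `t`. -/

section Mixing

variable {X : Type*} (p : Params X) (x : X)

lemma solvent_comp_equiv {ι ι' τ : Type*} [Fintype ι] [Fintype ι'] [LinearOrder τ] (g : ι' ≃ ι)
    (e η : ℝ) (l : ι → ℝ) (y : ι → τ) (b : τ → ℝ) (y₀ : τ) :
    Solvent p x e η (fun i => l (g i)) (fun i => y (g i)) b y₀ ↔ Solvent p x e η l y b y₀ := by
  refine and_congr Iff.rfl ?_
  rw [← g.forall_congr_right]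
  refine forall_congr' fun j => imp_congr Iff.rfl ?_
  rw [Finset.sum_filter, Finset.sum_filter,
    ← Equiv.sum_comp g (fun i => if y i ≤ y (g j) then l i else 0)]

/-- Solvency up to time `t`, the losses being given together with their times. -/
def pairSolvent (t e : ℝ) (ι : Type*) [Fintype ι] : Set (ι → ℝ × ℝ) :=
  {w | Solvent p x e 0 (fun i => (w i).1) (fun i => (w i).2) (prem p x) t}

lemma measurableSet_pairSolvent' (t : ℝ) (ι : Type*) [Fintype ι] :
    MeasurableSet {z : ℝ × (ι → ℝ × ℝ) | z.2 ∈ pairSolvent p x t z.1 ι} :=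
  (measurableSet_solvent p x (ι := ι) 0 t).preimage
    (f := fun z : ℝ × (ι → ℝ × ℝ) => (z.1, fun i => (z.2 i).1, fun i => (z.2 i).2)) (by fun_prop)

lemma measurableSet_pairSolvent (t e : ℝ) (ι : Type*) [Fintype ι] :
    MeasurableSet (pairSolvent p x t e ι) :=
  (measurableSet_pairSolvent' p x t ι).preimage (f := Prod.mk e) (by fun_prop)

/-- Pairing each loss with its time gives one product measure with identical factors, in which the
coordinates hit by time `t` can be split off. -/
lemma agentLaw_solvent (K : Measure ℝ) [IsFiniteMeasure K] (t : ℝ) (d : ℕ) :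
    agentLaw p K x d {z | Solvent p x z.1 0 z.2.1 z.2.2 (prem p x) t} =
      ∫⁻ e, Measure.pi (fun _ : Fin d => (p.lossLaw x).prod K) (pairSolvent p x t e (Fin d))
        ∂(p.shockLaw x) := by
  rw [agentLaw, Measure.prod_apply (measurableSet_solvent p x 0 t)]
  refine lintegral_congr fun e => ?_
  have hmp := measurePreserving_arrowProdEquivProdArrow ℝ ℝ (Fin d) (fun _ => p.lossLaw x)
    (fun _ => K)
  rw [← hmp.measure_preimage
    ((measurableSet_solvent p x 0 t).preimage (by fun_prop)).nullMeasurableSet]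
  rfl

lemma pi_pairSolvent_eq_fin (ν : Measure (ℝ × ℝ)) [SigmaFinite ν] (t e : ℝ) {ι : Type*} [Fintype ι]
    {θ : ℕ} (hθ : Fintype.card ι = θ) :
    Measure.pi (fun _ : ι => ν) (pairSolvent p x t e ι) =
      Measure.pi (fun _ : Fin θ => ν) (pairSolvent p x t e (Fin θ)) := by
  let g : Fin θ ≃ ι := (Fintype.equivFinOfCardEq hθ).symm
  have hmp := measurePreserving_piCongrLeft (fun _ : ι => ν) g
  rw [← hmp.measure_preimage (measurableSet_pairSolvent p x t e ι).nullMeasurableSet]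
  congr 1
  ext w
  simp only [pairSolvent, Set.mem_preimage, Set.mem_ofPred_eq]
  rw [← solvent_comp_equiv p x g]
  have : ∀ i, (MeasurableEquiv.piCongrLeft (fun _ => ℝ × ℝ) g) w (g i) = w i := by
    intro i
    rw [MeasurableEquiv.coe_piCongrLeft]
    exact Equiv.piCongrLeft_apply_apply (P := fun _ => ℝ × ℝ) g w i
  simp only [this]

/-- The sum runs over the set `J` of coordinates hit up to `t`. Coordinates outside `J` do not
affect solvency up to `t` and contribute only the probability of being hit later. -/
lemma pi_pairSolvent_split (ν : Measure (ℝ × ℝ)) [IsProbabilityMeasure ν] (t e : ℝ) (d : ℕ) :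
    Measure.pi (fun _ : Fin d => ν) (pairSolvent p x t e (Fin d)) =
      ∑ J : Finset (Fin d),
        Measure.pi (fun _ : J => ν.restrict (Set.univ ×ˢ Set.Iic t)) (pairSolvent p x t e J) *
          ν (Set.univ ×ˢ Set.Ioi t) ^ (d - J.card) := by
  classical
  set B : Set (ℝ × ℝ) := Set.univ ×ˢ Set.Iic t with hB
  have hBm : MeasurableSet B := MeasurableSet.univ.prod measurableSet_Iic
  have hBc : Set.univ ×ˢ Set.Ioi t = Bᶜ := by
    ext z; simp [hB]
  have hBmem : ∀ z : ℝ × ℝ, z ∈ B ↔ z.2 ≤ t := fun z => by simp [hB]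
  set T : Finset (Fin d) → Set (Fin d → ℝ × ℝ) := fun J =>
    MeasurableEquiv.piEquivPiSubtypeProd (fun _ => ℝ × ℝ) (· ∈ J) ⁻¹'
      ((pairSolvent p x t e J ∩ Set.univ.pi fun _ => B) ×ˢ Set.univ.pi fun _ => Bᶜ) with hT
  have hmemT : ∀ J w, w ∈ T J → ∀ j, j ∈ J ↔ (w j).2 ≤ t := by
    intro J w hw j
    obtain ⟨⟨-, h1⟩, h2⟩ := hw
    constructor
    · intro hj
      exact (hBmem _).1 (h1 ⟨j, hj⟩ trivial)
    · intro hj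
      by_contra hn
      exact h2 ⟨j, hn⟩ trivial ((hBmem _).2 hj)
  have hunion : pairSolvent p x t e (Fin d) = ⋃ J, T J := by
    -- A hit after `t` is neither tested nor included in the loss sum at any hit up to `t`.
    have hkey : ∀ (J : Finset (Fin d)) (w : Fin d → ℝ × ℝ), (∀ j, j ∈ J ↔ (w j).2 ≤ t) →
        (w ∈ pairSolvent p x t e (Fin d) ↔ (fun j : J => w j) ∈ pairSolvent p x t e J) := by
      intro J w hJ
      refine and_congr Iff.rfl ?_
      have hsum : ∀ j, (w j).2 ≤ t → ∑ i with (w i).2 ≤ (w j).2, (w i).1 =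
          ∑ i : {i // i ∈ J} with (w i.1).2 ≤ (w j).2, (w i.1).1 := by
        intro j hj
        rw [Finset.sum_filter, Finset.sum_filter,
          Finset.sum_coe_sort J (fun i => if (w i).2 ≤ (w j).2 then (w i).1 else 0)]
        symm
        apply Finset.sum_subset (Finset.subset_univ _)
        intro i _ hi
        rw [if_neg]
        intro h
        exact hi ((hJ i).2 (h.trans hj))
      constructor
      · rintro h ⟨j, hj⟩ hjt
        have := h j hjt
        rwa [hsum j hjt] at this
      · intro h j hjt
        have := h ⟨j, (hJ j).2 hjt⟩ hjt
        rwa [hsum j hjt]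
    ext w
    simp only [Set.mem_iUnion]
    constructor
    · intro hw
      have hJ : ∀ j, j ∈ (Finset.univ.filter fun j => (w j).2 ≤ t) ↔ (w j).2 ≤ t := by simp
      refine ⟨Finset.univ.filter fun j => (w j).2 ≤ t, ⟨(hkey _ w hJ).1 hw, ?_⟩, ?_⟩
      · rintro ⟨j, hj⟩ -
        exact (hBmem _).2 ((hJ j).1 hj)
      · rintro ⟨j, hj⟩ - hmem
        exact hj ((hJ j).2 ((hBmem _).1 hmem))
    · rintro ⟨J, hJ⟩
      exact (hkey J w (hmemT J w hJ)).2 hJ.1.1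
  have hmp := fun J : Finset (Fin d) =>
    measurePreserving_piEquivPiSubtypeProd (fun _ : Fin d => ν) (· ∈ J)
  have hm : ∀ J : Finset (Fin d), MeasurableSet
      ((pairSolvent p x t e J ∩ Set.univ.pi fun _ => B) ×ˢ
        (Set.univ.pi fun _ : {j // j ∉ J} => Bᶜ)) := fun J =>
    ((measurableSet_pairSolvent p x t e J).inter (MeasurableSet.univ_pi fun _ => hBm)).prod
      (MeasurableSet.univ_pi fun _ => hBm.compl)
  rw [hunion, measure_iUnion, tsum_fintype]
  · refine Finset.sum_congr rfl fun J _ => ?_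
    have h1 := (hmp J).measure_preimage (hm J).nullMeasurableSet
    refine h1.trans ?_
    rw [Measure.prod_prod, Measure.pi_pi, hBc, ← Measure.restrict_pi_pi,
      Measure.restrict_apply (measurableSet_pairSolvent p x t e J)]
    congr 1
    · congr!
    rw [Finset.prod_const, Finset.card_univ]
    congr 1
    simp [Fintype.card_subtype_compl]
  · intro J J' hne
    rw [Function.onFun, Set.disjoint_left]
    intro w hw hw'
    apply hne
    ext j
    rw [hmemT J w hw, hmemT J' w hw']
  · intro J
    exact (hmp J).measurable (hm J)

/-- The number of losses up to time `t` is binomial, and their times are independent. -/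
lemma agentLaw_mix (κ : Measure ℝ) [IsProbabilityMeasure κ] (t : ℝ) (d : ℕ) :
    agentLaw p κ x d {z | Solvent p x z.1 0 z.2.1 z.2.2 (prem p x) t} =
      ∑ θ ∈ Finset.range (d + 1), d.choose θ •
        (agentLaw p (κ.restrict (Set.Iic t)) x θ
          {z | Solvent p x z.1 0 z.2.1 z.2.2 (prem p x) t} * κ (Set.Ioi t) ^ (d - θ)) := by
  have hr : ((p.lossLaw x).prod κ).restrict (Set.univ ×ˢ Set.Iic t) =
      (p.lossLaw x).prod (κ.restrict (Set.Iic t)) := by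
    rw [← Measure.prod_restrict, Measure.restrict_univ]
  have hc : ((p.lossLaw x).prod κ) (Set.univ ×ˢ Set.Ioi t) = κ (Set.Ioi t) := by
    rw [Measure.prod_prod, measure_univ, one_mul]
  rw [agentLaw_solvent]
  simp_rw [pi_pairSolvent_split, hr, hc]
  rw [lintegral_finsetSum]
  · have hterm : ∀ J : Finset (Fin d), ∫⁻ e, Measure.pi (fun _ : J => (p.lossLaw x).prod
        (κ.restrict (Set.Iic t))) (pairSolvent p x t e J) * κ (Set.Ioi t) ^ (d - J.card)
          ∂(p.shockLaw x) = agentLaw p (κ.restrict (Set.Iic t)) x J.card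
          {z | Solvent p x z.1 0 z.2.1 z.2.2 (prem p x) t} * κ (Set.Ioi t) ^ (d - J.card) := by
      intro J
      rw [lintegral_mul_const', agentLaw_solvent]
      · congr 1
        exact lintegral_congr fun e => pi_pairSolvent_eq_fin p x _ t e (by simp)
      · exact ENNReal.pow_ne_top (measure_ne_top _ _)
    rw [Finset.sum_congr rfl fun J _ => hterm J]
    -- Each term depends on `J` only through its cardinality, which yields the binomial
    -- coefficients.
    have := Finset.sum_powerset_apply_card (fun θ => agentLaw p (κ.restrict (Set.Iic t)) x θ
      {z | Solvent p x z.1 0 z.2.1 z.2.2 (prem p x) t} * κ (Set.Ioi t) ^ (d - θ))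
      (x := (Finset.univ : Finset (Fin d)))
    simpa using this
  · intro J _
    exact (measurable_measure_prodMk_left (measurableSet_pairSolvent' p x t J)).mul_const _

end Mixing

end RuinNetwork

namespace RuinNetwork

/-! ### The limiting survival probability as a function of time. -/

section SurviveProb

variable {X : Type*} (p : Params X) (lam : ℝ) (R : ℝ → ℝ) (x : X)

/-- The limiting probability that an agent of type `x` is solvent up to time `t`. -/
def surviveProb (t : ℝ≥0) : ℝ :=
  ∑ θ ∈ Finset.range (p.inDeg x + 1), binom (p.inDeg x) (phi lam R t) θ * survival p R x θ t

variable {lam R}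

instance (K : Measure ℝ) [IsFiniteMeasure K] (d : ℕ) : IsFiniteMeasure (agentLaw p K x d) := by
  unfold agentLaw; infer_instance

lemma agentLaw_smul {c : ℝ≥0∞} (hc : c ≠ ⊤) (K : Measure ℝ) [IsFiniteMeasure K] (d : ℕ) :
    agentLaw p (c • K) x d = c ^ d • agentLaw p K x d := by
  have := K.smul_finite hc
  have hpi : Measure.pi (fun _ : Fin d => c • K) = c ^ d • Measure.pi (fun _ : Fin d => K) := by
    refine Measure.pi_eq fun s _ => ?_
    simp only [Measure.smul_apply, smul_eq_mul, Measure.pi_pi, Finset.prod_mul_distrib,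
      Finset.prod_const, Finset.card_univ, Fintype.card_fin]
  rw [agentLaw, agentLaw, hpi, Measure.prod_smul_right, Measure.prod_smul_right]

lemma agentLaw_restrict (K : Measure ℝ) [IsFiniteMeasure K] (S : Set ℝ) (d : ℕ) :
    agentLaw p (K.restrict S) x d =
      (agentLaw p K x d).restrict (Set.univ ×ˢ Set.univ ×ˢ Set.univ.pi fun _ => S) := by
  rw [agentLaw, agentLaw, ← Measure.restrict_pi_pi, ← Measure.prod_restrict,
    ← Measure.prod_restrict, Measure.restrict_univ, Measure.restrict_univ]

variable (hc : ContinuousOn R (Set.Ici 0)) (hp : ∀ t, 0 ≤ t → 0 < R t) (hl : 0 < lam)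

include hc hp hl

/-- Passing to the unnormalised restriction of `hitLaw` absorbs the `θ` normalising constants. At `t
= 0` only `θ = 0` matters, through `0 ^ 0 = 1`. -/
lemma pow_mul_survival (θ : ℕ) (t : ℝ≥0) :
    (mass R t / lam) ^ θ * survival p R x θ t =
      (agentLaw p ((hitLaw R lam).restrict (Set.Iic (t : ℝ))) x θ).real
        (survivalEvent p x θ) := by
  have := isFiniteMeasure_arrivalLaw hc hp t
  have h0 := div_nonneg (mass_nonneg hc hp t.coe_nonneg) hl.le
  rw [hitLaw_restrict hc hp hl, agentLaw_smul p x ENNReal.ofReal_ne_top, measureReal_def,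
    Measure.smul_apply, smul_eq_mul, ENNReal.toReal_mul, ENNReal.toReal_pow,
    ENNReal.toReal_ofReal h0]
  rfl

/-- `agentLaw_mix` splits according to the number of hits up to `t`; `pow_mul_survival` identifies
the terms. The horizon `t₁` is free, so survival at different times can be compared on one space. -/
lemma surviveProb_eq {t t₁ : ℝ≥0} (ht : t ≤ t₁) (h₁ : mass R t₁ < lam) :
    (agentLaw p (truncLaw R lam t₁) x (p.inDeg x)).real
      {z | Solvent p x z.1 0 z.2.1 z.2.2 (prem p x) t} = surviveProb p lam R x t := by
  have := isProbabilityMeasure_truncLaw hc hp hl h₁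
  have htm : mass R t ≤ mass R t₁ := mass_monoOn hc hp t.coe_nonneg t₁.coe_nonneg ht
  have h0 := div_nonneg (mass_nonneg hc hp t.coe_nonneg) hl.le
  rw [measureReal_def, agentLaw_mix, ENNReal.toReal_sum, surviveProb]
  · refine Finset.sum_congr rfl fun θ _ => ?_
    rw [← measure_survivalEvent p x _ (truncLaw_Iic_zero t₁), truncLaw_restrict ht, nsmul_eq_mul,
      ENNReal.toReal_mul, ENNReal.toReal_mul, ← measureReal_def, ← pow_mul_survival p x hc hp hl,
      ENNReal.toReal_pow, phi_eq hc hp (htm.trans_lt h₁), binom, ENNReal.toReal_natCast]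
    have : (truncLaw R lam t₁ (Set.Ioi (t : ℝ))).toReal = 1 - mass R t / lam := by
      rw [← Set.compl_Iic, prob_compl_eq_one_sub measurableSet_Iic,
        truncLaw_Iic hc hp hl ht, ENNReal.toReal_sub_of_le, ENNReal.toReal_ofReal h0,
        ENNReal.toReal_one]
      · rw [ENNReal.ofReal_le_one, div_le_one hl]; linarith
      · simp
    rw [this]
    ring
  · intro θ _
    rw [nsmul_eq_mul]
    exact ENNReal.mul_ne_top (by simp) (ENNReal.mul_ne_top (measure_ne_top _ _)
      (ENNReal.pow_ne_top (measure_ne_top _ _)))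

lemma surviveProb_mem {t : ℝ≥0} (h : mass R t < lam) :
    surviveProb p lam R x t ∈ Set.Icc (0 : ℝ) 1 := by
  have := isProbabilityMeasure_truncLaw hc hp hl h
  rw [← surviveProb_eq p x hc hp hl le_rfl h]
  exact ⟨measureReal_nonneg, measureReal_le_one⟩

lemma surviveProb_anti {s t : ℝ≥0} (hst : s ≤ t) (h : mass R t < lam) :
    surviveProb p lam R x t ≤ surviveProb p lam R x s := by
  have := isProbabilityMeasure_truncLaw hc hp hl h
  rw [← surviveProb_eq p x hc hp hl le_rfl h, ← surviveProb_eq p x hc hp hl hst h]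
  exact measureReal_mono fun z hz => hz.mono le_rfl hst

/-- To be solvent up to `s` but not up to `t`, an agent must be hit in `(s, t]`. The estimate is a
union bound over its half-edges. -/
lemma surviveProb_sub_le {s t : ℝ≥0} (hst : s ≤ t) (h : mass R t < lam) :
    surviveProb p lam R x s - surviveProb p lam R x t ≤
      p.inDeg x * ((mass R t - mass R s) / lam) := by
  have := isProbabilityMeasure_truncLaw hc hp hl h
  rw [← surviveProb_eq p x hc hp hl le_rfl h, ← surviveProb_eq p x hc hp hl hst h]
  set P := agentLaw p (truncLaw R lam t) x (p.inDeg x)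
  have hj : ∀ j : Fin (p.inDeg x), P {z | z.2.2 j ∈ Set.Ioc (s : ℝ) t} =
      ENNReal.ofReal ((mass R t - mass R s) / lam) := by
    intro j
    rw [← truncLaw_Ioc hc hp hl hst le_rfl]
    have h1 := measurePreserving_eval (fun _ : Fin (p.inDeg x) => truncLaw R lam t) j
    have h2 : MeasurePreserving (fun z : ℝ × (Fin (p.inDeg x) → ℝ) × (Fin (p.inDeg x) → ℝ) =>
        z.2.2 j) P (truncLaw R lam t) :=
      h1.comp ((measurePreserving_snd (μ := Measure.pi fun _ => p.lossLaw x)).comp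
        (measurePreserving_snd (μ := p.shockLaw x)))
    exact h2.measure_preimage measurableSet_Ioc.nullMeasurableSet
  have hd := div_nonneg (sub_nonneg.2 (mass_monoOn hc hp s.coe_nonneg t.coe_nonneg hst)) hl.le
  have hle : P.real {z | Solvent p x z.1 0 z.2.1 z.2.2 (prem p x) s} ≤
      P.real ({z | Solvent p x z.1 0 z.2.1 z.2.2 (prem p x) t} ∪
        ⋃ j, {z | z.2.2 j ∈ Set.Ioc (s : ℝ) t}) := by
    refine measureReal_mono fun z hz => ?_
    by_cases h : ∃ j, z.2.2 j ∈ Set.Ioc (s : ℝ) t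
    · exact Or.inr (Set.mem_iUnion.2 h)
    · push Not at h
      refine Or.inl ⟨hz.1, fun j hj => hz.2 j ?_⟩
      by_contra! hlt
      exact h j ⟨hlt, hj⟩
  have hU : P.real (⋃ j, {z | z.2.2 j ∈ Set.Ioc (s : ℝ) t}) ≤
      ∑ j : Fin (p.inDeg x), P.real {z | z.2.2 j ∈ Set.Ioc (s : ℝ) t} :=
    measureReal_iUnion_fintype_le _
  have hS : ∑ j : Fin (p.inDeg x), P.real {z | z.2.2 j ∈ Set.Ioc (s : ℝ) t} =
      p.inDeg x * ((mass R t - mass R s) / lam) := by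
    simp only [measureReal_def, hj, ENNReal.toReal_ofReal hd]
    simp
  have := measureReal_union_le (μ := P) {z | Solvent p x z.1 0 z.2.1 z.2.2 (prem p x) t}
    (⋃ j, {z | z.2.2 j ∈ Set.Ioc (s : ℝ) t})
  linarith

/-- Solvency consists of finitely many strict inequalities, so it is the increasing union of
solvency with margin `1 / (k + 1)`. -/
lemma exists_margin_lower {t t₁ : ℝ≥0} (ht : t ≤ t₁) (h₁ : mass R t₁ < lam) {ε : ℝ} (hε : 0 < ε) :
    ∃ η > 0, surviveProb p lam R x t - ε <
      (agentLaw p (truncLaw R lam t₁) x (p.inDeg x)).real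
        {z | Solvent p x z.1 η z.2.1 z.2.2 (prem p x) t} := by
  have := isProbabilityMeasure_truncLaw hc hp hl h₁
  set P := agentLaw p (truncLaw R lam t₁) x (p.inDeg x)
  set S : ℕ → Set (ℝ × (Fin (p.inDeg x) → ℝ) × (Fin (p.inDeg x) → ℝ)) := fun k =>
    {z | Solvent p x z.1 (1 / ((k : ℝ) + 1)) z.2.1 z.2.2 (prem p x) t}
  have hmono : Monotone S := fun k l hkl z hz =>
    hz.mono (one_div_le_one_div_of_le (by positivity) (by exact_mod_cast Nat.succ_le_succ hkl))
      le_rfl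
  have hU : ⋃ k, S k = {z | Solvent p x z.1 0 z.2.1 z.2.2 (prem p x) t} := by
    ext z
    simp only [Set.mem_iUnion]
    constructor
    · rintro ⟨k, hk⟩
      exact hk.mono (by positivity) le_rfl
    · intro hz
      have hlim := tendsto_one_div_add_atTop_nhds_zero_nat (𝕜 := ℝ)
      have h1 := hlim.eventually_lt_const hz.1
      have h2 : ∀ᶠ k : ℕ in atTop, ∀ j, z.2.2 j ≤ t → 1 / ((k : ℝ) + 1) <
          p.γ x * (1 - z.1) + prem p x (z.2.2 j) - p.δ x -
            ∑ i with z.2.2 i ≤ z.2.2 j, z.2.1 i := by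
        rw [eventually_all]
        intro j
        by_cases hj : z.2.2 j ≤ t
        · filter_upwards [hlim.eventually_lt_const (hz.2 j hj)] with k hk _ using hk
        · exact Filter.Eventually.of_forall fun k h => absurd h hj
      obtain ⟨k, hk1, hk2⟩ := (h1.and h2).exists
      exact ⟨k, hk1, hk2⟩
  have htend := tendsto_measure_iUnion_atTop (μ := P) hmono
  rw [hU] at htend
  have htend2 := (ENNReal.tendsto_toReal (measure_ne_top _ _)).comp htend
  have hlt : surviveProb p lam R x t - ε <
      (P {z | Solvent p x z.1 0 z.2.1 z.2.2 (prem p x) t}).toReal := by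
    rw [← surviveProb_eq p x hc hp hl ht h₁, measureReal_def]; linarith
  obtain ⟨k, hk⟩ := (htend2.eventually_const_lt hlt).exists
  exact ⟨1 / ((k : ℝ) + 1), by positivity, hk⟩

/-- The decreasing intersection over negative margins consists of the weak inequalities. These
differ from the strict ones only where the capital is exactly zero, which is a null event. -/
lemma exists_margin_upper {t t₁ : ℝ≥0} (ht : t ≤ t₁) (h₁ : mass R t₁ < lam) {ε : ℝ} (hε : 0 < ε) :
    ∃ η > 0, (agentLaw p (truncLaw R lam t₁) x (p.inDeg x)).real
        {z | Solvent p x z.1 (-η) z.2.1 z.2.2 (prem p x) t} <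
      surviveProb p lam R x t + ε := by
  have := isProbabilityMeasure_truncLaw hc hp hl h₁
  set P := agentLaw p (truncLaw R lam t₁) x (p.inDeg x) with hP
  set S : ℕ → Set (ℝ × (Fin (p.inDeg x) → ℝ) × (Fin (p.inDeg x) → ℝ)) := fun k =>
    {z | Solvent p x z.1 (-(1 / ((k : ℝ) + 1))) z.2.1 z.2.2 (prem p x) t}
  have hmono : Antitone S := fun k l hkl z hz =>
    hz.mono (neg_le_neg (one_div_le_one_div_of_le (by positivity)
      (by exact_mod_cast Nat.succ_le_succ hkl))) le_rfl
  have hU : (⋂ k, S k : Set _) =ᵐ[P] {z | Solvent p x z.1 0 z.2.1 z.2.2 (prem p x) t} := by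
    have hne := ae_capital_ne_zero p x (d := p.inDeg x)
      (Measure.pi fun _ => truncLaw R lam t₁)
    filter_upwards [hne] with z hz
    apply propext
    change z ∈ ⋂ k, S k ↔ Solvent p x z.1 0 z.2.1 z.2.2 (prem p x) t
    simp only [Set.mem_iInter]
    constructor
    · intro h
      have hlim : Tendsto (fun k : ℕ => -(1 / ((k : ℝ) + 1))) atTop (𝓝 0) := by
        simpa using (tendsto_one_div_add_atTop_nhds_zero_nat (𝕜 := ℝ)).neg
      refine ⟨lt_of_le_of_ne (le_of_tendsto' hlim fun k => (h k).1.le) hz.1.symm,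
        fun j hj => lt_of_le_of_ne (le_of_tendsto' hlim fun k => ((h k).2 j hj).le) ?_⟩
      exact (hz.2 _ j j (by simp)).symm
    · intro h k
      exact h.mono (by simp only [Left.neg_nonpos_iff]; positivity) le_rfl
  have htend := tendsto_measure_iInter_atTop (μ := P)
    (fun k => (measurableSet_solvent p x _ _).nullMeasurableSet) hmono ⟨0, measure_ne_top _ _⟩
  rw [measure_congr hU] at htend
  have htend2 := (ENNReal.tendsto_toReal (measure_ne_top _ _)).comp htend
  have hlt : (P {z | Solvent p x z.1 0 z.2.1 z.2.2 (prem p x) t}).toReal <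
      surviveProb p lam R x t + ε := by
    rw [← surviveProb_eq p x hc hp hl ht h₁, measureReal_def]; linarith
  obtain ⟨k, hk⟩ := (htend2.eventually_lt_const hlt).exists
  exact ⟨1 / ((k : ℝ) + 1), by positivity, hk⟩

omit hc hl in
lemma tendsto_mass (hi : IntegrableOn R (Set.Ici 0)) :
    Tendsto (fun t : ℝ≥0 => mass R t) atTop (𝓝 (normL1 R)) := by
  have h1 : normL1 R = ∫ s in Set.Ioi (0 : ℝ), R s := by
    rw [normL1, integral_Ici_eq_integral_Ioi]
    exact setIntegral_congr_fun measurableSet_Ioi fun s hs => abs_of_pos (hp s (le_of_lt hs))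
  rw [h1]
  exact (intervalIntegral_tendsto_integral_Ioi 0 (hi.mono_set Set.Ioi_subset_Ici_self)
    tendsto_id).comp (NNReal.tendsto_coe_atTop.2 tendsto_id)

/-- The survival probabilities converge as `t → ∞`. -/
lemma exists_tendsto_survival (hi : IntegrableOn R (Set.Ici 0)) (θ : ℕ) :
    ∃ s, Tendsto (fun t : ℝ≥0 => survival p R x θ t) atTop (𝓝 s) := by
  have hfin : IsFiniteMeasure (hitLaw R lam) := by
    refine ⟨?_⟩
    rw [hitLaw, Measure.smul_apply, withDensity_apply _ MeasurableSet.univ, Measure.restrict_univ,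
      smul_eq_mul]
    refine ENNReal.mul_lt_top (by simpa using hl) ?_
    exact (hasFiniteIntegral_iff_ofReal (by
      filter_upwards [ae_restrict_mem measurableSet_Ici] with s hs using (hp s hs).le)).1 hi.2
  -- `V t` equals `(mass R t / lam) ^ θ` times the survival probability. It is monotone because the
  -- restriction grows, and bounded because `hitLaw` is finite. Dividing by the power, which has a
  -- positive limit, gives convergence.
  set V : ℝ≥0 → ℝ := fun t =>
    (agentLaw p ((hitLaw R lam).restrict (Set.Iic (t : ℝ))) x θ).real (survivalEvent p x θ)
  have hV : Monotone V := by
    intro s t hst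
    simp only [V, agentLaw_restrict, measureReal_def]
    refine ENNReal.toReal_mono (measure_ne_top _ _) ?_
    refine Measure.restrict_mono ?_ le_rfl _
    exact Set.prod_mono_right (Set.prod_mono_right (Set.pi_mono fun _ _ =>
      Set.Iic_subset_Iic.2 hst))
  have hVb : BddAbove (Set.range V) := by
    refine ⟨(agentLaw p (hitLaw R lam) x θ).real (survivalEvent p x θ), ?_⟩
    rintro _ ⟨t, rfl⟩
    simp only [V, agentLaw_restrict, measureReal_def]
    exact ENNReal.toReal_mono (measure_ne_top _ _) (Measure.restrict_apply_le _ _)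
  have h1 := tendsto_atTop_ciSup hV hVb
  have h2 := ((tendsto_mass hp hi).div_const lam).pow θ
  have hpos : 0 < normL1 R := by
    have h3 : mass R (1 : ℝ≥0) ≤ normL1 R := by
      refine ge_of_tendsto (tendsto_mass hp hi) ?_
      filter_upwards [eventually_ge_atTop (1 : ℝ≥0)] with t ht
      exact mass_monoOn hc hp (NNReal.coe_nonneg 1) t.coe_nonneg ht
    have h4 := mass_strictMonoOn hc hp (Set.self_mem_Ici) (NNReal.coe_nonneg 1)
      (by norm_num : (0 : ℝ) < (1 : ℝ≥0))
    rw [mass_zero] at h4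
    linarith
  refine ⟨_, (h1.div h2 (by positivity)).congr' ?_⟩
  filter_upwards [eventually_gt_atTop (0 : ℝ≥0)] with t ht
  have h4 := mass_strictMonoOn hc hp (Set.self_mem_Ici) t.coe_nonneg (by exact_mod_cast ht)
  rw [mass_zero] at h4
  have h5 : (mass R t / lam) ^ θ ≠ 0 := by positivity
  rw [Pi.div_apply, div_eq_iff h5, mul_comm, pow_mul_survival p x hc hp hl]

end SurviveProb

end RuinNetwork

namespace RuinNetwork

/-! ### Events of probability tending to one -/

section Whp

variable {Ω : ℕ → Type*} [∀ n, MeasurableSpace (Ω n)] (P : ∀ n, Measure (Ω n))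

/-- The filter of events whose probability tends to one. -/
def whp : Filter (Σ n, Ω n) where
  sets := {S | Tendsto (fun n => P n {ω | (⟨n, ω⟩ : Σ n, Ω n) ∉ S}) atTop (𝓝 0)}
  univ_sets := by simp
  sets_of_superset {S T} hS hST := by
    refine tendsto_of_tendsto_of_tendsto_of_le_of_le tendsto_const_nhds hS (fun _ => zero_le)
      fun n => measure_mono fun ω hω h => hω (hST h)
  inter_sets {S T} hS hT := by
    have h := Tendsto.add hS hT
    rw [add_zero] at h
    refine tendsto_of_tendsto_of_tendsto_of_le_of_le tendsto_const_nhds h (fun _ => zero_le)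
      fun n => le_trans (measure_mono fun ω hω => ?_) (measure_union_le _ _)
    simp only [Set.mem_inter_iff, Set.mem_ofPred_eq, not_and_or] at hω
    exact hω

variable {P}

lemma eventually_whp {A : (Σ n, Ω n) → Prop} :
    (∀ᶠ z in whp P, A z) ↔ Tendsto (fun n => P n {ω | ¬ A ⟨n, ω⟩}) atTop (𝓝 0) := Iff.rfl

lemma eventually_whp_of_le {A : (Σ n, Ω n) → Prop} {f : ℕ → ℝ≥0∞}
    (h : ∀ᶠ n in atTop, P n {ω | ¬ A ⟨n, ω⟩} ≤ f n) (hf : Tendsto f atTop (𝓝 0)) :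
    ∀ᶠ z in whp P, A z :=
  tendsto_of_tendsto_of_tendsto_of_le_of_le' tendsto_const_nhds hf
    (Filter.Eventually.of_forall fun _ => zero_le) h

lemma eventually_whp_of_ae {A : (Σ n, Ω n) → Prop} (h : ∀ n, ∀ᵐ ω ∂(P n), A ⟨n, ω⟩) :
    ∀ᶠ z in whp P, A z := by
  refine eventually_whp_of_le (f := fun _ => 0) (Filter.Eventually.of_forall fun n => ?_)
    tendsto_const_nhds
  exact (ae_iff.1 (h n)).le

lemma tendsto_fst_whp : Tendsto (Sigma.fst : (Σ n, Ω n) → ℕ) (whp P) atTop := by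
  intro S hS
  change ∀ᶠ z in whp P, z.1 ∈ S
  refine eventually_whp_of_le (f := fun _ => 0) ?_ tendsto_const_nhds
  filter_upwards [hS] with n hn
  simp [hn]

lemma convInProb_iff {Z : ∀ n, Ω n → ℝ} {c : ℝ} :
    ConvInProb P Z c ↔ ∀ η > 0, ∀ᶠ z in whp P, |Z z.1 z.2 - c| < η := by
  simp only [ConvInProb, eventually_whp, not_lt]

/-- Monotone random functions that converge in probability to a continuous function at each point
converge uniformly. -/
lemma whp_uniform_of_monotone {Y : ∀ n, Ω n → ℝ → ℝ} {A : ℝ → ℝ} {b : ℝ}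
    (hA : ContinuousOn A (Set.Icc 0 b))
    (hmono : ∀ᶠ z in whp P, MonotoneOn (Y z.1 z.2) (Set.Icc 0 b))
    (h : ∀ t ∈ Set.Icc 0 b, ∀ η > 0, ∀ᶠ z in whp P, |Y z.1 z.2 t - A t| < η)
    {η : ℝ} (hη : 0 < η) :
    ∀ᶠ z in whp P, ∀ t ∈ Set.Icc 0 b, |Y z.1 z.2 t - A t| < η := by
  have huc := isCompact_Icc.uniformContinuousOn_of_continuous hA
  rw [Metric.uniformContinuousOn_iff] at huc
  obtain ⟨δ, hδ, hAδ⟩ := huc (η / 2) (by positivity)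
  have hδ2 : 0 < δ / 2 := by positivity
  -- A grid of mesh `δ / 2` clipped at `b`. Each `t` lies between two consecutive grid points, and
  -- monotonicity traps `Y t` between their values. The `+ 2` in the range below makes the upper
  -- neighbour available.
  set g : ℕ → ℝ := fun i => min (i * (δ / 2)) b with hg
  rcases lt_or_ge b 0 with hb | hb
  · filter_upwards with z t ht
    exact absurd (ht.1.trans ht.2) (not_le.2 hb)
  have hgm : ∀ i, g i ∈ Set.Icc 0 b := fun i => ⟨le_min (by positivity) hb, min_le_right _ _⟩
  have hgrid : ∀ᶠ z in whp P, ∀ i ∈ Finset.range (⌊b / (δ / 2)⌋₊ + 2),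
      |Y z.1 z.2 (g i) - A (g i)| < η / 2 := by
    rw [Filter.eventually_all_finset]
    exact fun i _ => h (g i) (hgm i) _ (by positivity)
  filter_upwards [hgrid, hmono] with z hz hm t ht
  set i := ⌊t / (δ / 2)⌋₊ with hi
  have hi0 : (i : ℝ) * (δ / 2) ≤ t := by
    rw [← le_div_iff₀ hδ2]; exact Nat.floor_le (div_nonneg ht.1 hδ2.le)
  have hi1 : t < ((i + 1 : ℕ) : ℝ) * (δ / 2) := by
    rw [← div_lt_iff₀ hδ2]; push_cast; exact Nat.lt_floor_add_one _
  have hiN : i ≤ ⌊b / (δ / 2)⌋₊ := Nat.floor_le_floor (div_le_div_of_nonneg_right ht.2 hδ2.le)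
  have e0 : g i = i * (δ / 2) := min_eq_left (hi0.trans ht.2)
  have e1 : t ≤ g (i + 1) := le_min hi1.le ht.2
  have e2 : g (i + 1) ≤ ((i + 1 : ℕ) : ℝ) * (δ / 2) := min_le_left _ _
  have h0 := hz i (Finset.mem_range.2 (by omega))
  have h1 := hz (i + 1) (Finset.mem_range.2 (by omega))
  have m0 := hm (hgm i) ht (by rw [e0]; exact hi0)
  have m1 := hm ht (hgm (i + 1)) e1
  have a0 := hAδ (g i) (hgm i) t ht (by
    rw [Real.dist_eq, abs_lt, e0]; push_cast at hi1; constructor <;> linarith)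
  have a1 := hAδ (g (i + 1)) (hgm (i + 1)) t ht (by
    rw [Real.dist_eq, abs_lt]; push_cast at e2; constructor <;> linarith)
  rw [Real.dist_eq] at a0 a1
  rw [abs_lt] at *
  constructor <;> linarith

end Whp

/-! ### The law of large numbers for the clocks -/

section Exponential

/-- The moment is a Gamma integral. Orders one and two give mean `1` and second moment `2`, as
needed for Chebyshev's inequality. -/
lemma exp_moment_integrable (k : ℕ) : Integrable (fun x : ℝ => x ^ k) (expMeasure 1) ∧
    ∫ x, x ^ k ∂(expMeasure 1) = Real.Gamma (k + 1) := by
  have hdef : expMeasure 1 = volume.withDensity (fun x => ENNReal.ofReal (exponentialPDFReal 1 x)) :=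
    rfl
  have hm : Measurable fun x => ENNReal.ofReal (exponentialPDFReal 1 x) :=
    (measurable_exponentialPDFReal 1).ennreal_ofReal
  have hae : (fun x : ℝ => exponentialPDFReal 1 x * x ^ k) =ᵐ[volume]
      (Set.Ioi (0 : ℝ)).indicator (fun x : ℝ => Real.exp (-x) * x ^ ((k : ℝ) + 1 - 1)) := by
    filter_upwards [Measure.ae_ne volume (0 : ℝ)] with x hx
    by_cases h : 0 < x
    · rw [Set.indicator_of_mem (show x ∈ Set.Ioi (0 : ℝ) from h), add_sub_cancel_right,
        Real.rpow_natCast, exponentialPDFReal, gammaPDFReal, if_pos h.le]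
      simp
    · have hneg : x < 0 := lt_of_le_of_ne (not_lt.1 h) hx
      rw [Set.indicator_of_notMem (by simpa using h), exponentialPDFReal, gammaPDFReal,
        if_neg (not_le.2 hneg), zero_mul]
  have hconv := Real.GammaIntegral_convergent (s := (k : ℝ) + 1) (by positivity)
  have hsm : ∀ x : ℝ, (ENNReal.ofReal (exponentialPDFReal 1 x)).toReal • x ^ k =
      exponentialPDFReal 1 x * x ^ k := fun x => by
    rw [ENNReal.toReal_ofReal (exponentialPDFReal_nonneg one_pos x), smul_eq_mul]
  constructor
  · rw [hdef, integrable_withDensity_iff_integrable_smul' hm (by simp)]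
    simp_rw [hsm]
    rw [integrable_congr hae, integrable_indicator_iff measurableSet_Ioi]
    exact hconv
  · rw [hdef, integral_withDensity_eq_integral_toReal_smul hm (by simp)]
    simp_rw [hsm]
    rw [integral_congr_ae hae, integral_indicator measurableSet_Ioi, Real.Gamma_eq_integral
      (by positivity)]

variable {Ω : Type*} [MeasurableSpace Ω] {P : Measure Ω} [IsProbabilityMeasure P]

lemma clock_deviation_le {T : ℕ → Ω → ℝ} (hm : ∀ j, Measurable (T j))
    (hlaw : ∀ j, P.map (T j) = expMeasure 1) (hind : iIndepFun T P) (k : ℕ) {c : ℝ} (hc : 0 < c) :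
    P {ω | c ≤ |∑ j ∈ Finset.range k, T j ω - k|} ≤ ENNReal.ofReal (k * 2 / c ^ 2) := by
  have hint : ∀ j r : ℕ, Integrable (fun ω => T j ω ^ r) P ∧
      ∫ ω, T j ω ^ r ∂P = Real.Gamma (r + 1) := by
    intro j r
    have h := exp_moment_integrable r
    rw [← hlaw j] at h
    refine ⟨h.1.comp_measurable (hm j), ?_⟩
    rw [← h.2, integral_map (hm j).aemeasurable (by fun_prop)]
  have hL : ∀ j, MemLp (T j) 2 P := fun j =>
    (memLp_two_iff_integrable_sq (hm j).aestronglyMeasurable).2 (hint j 2).1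
  have hmean : ∀ j, ∫ ω, T j ω ∂P = 1 := by
    intro j
    have h := (hint j 1).2
    rw [Real.Gamma_nat_eq_factorial] at h
    simpa using h
  have hvar : ∀ j, variance (T j) P ≤ 2 := by
    intro j
    refine (variance_le_expectation_sq (hm j).aestronglyMeasurable).trans ?_
    have h := (hint j 2).2
    have hG : Real.Gamma ((2 : ℕ) + 1) = 2 := by
      rw [Real.Gamma_nat_eq_factorial]; norm_num
    rw [hG] at h
    simpa using h.le
  have hsv : variance (∑ j ∈ Finset.range k, T j) P ≤ k * 2 := by
    rw [IndepFun.variance_sum (fun j _ => hL j) fun i _ j _ hij => hind.indepFun hij]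
    calc ∑ j ∈ Finset.range k, variance (T j) P ≤ ∑ j ∈ Finset.range k, (2 : ℝ) :=
          Finset.sum_le_sum fun j _ => hvar j
      _ = k * 2 := by simp
  have hsm : ∫ ω, (∑ j ∈ Finset.range k, T j) ω ∂P = (k : ℝ) := by
    simp only [Finset.sum_apply]
    rw [integral_finsetSum _ fun j _ => (hL j).integrable (by norm_num)]
    simp [hmean]
  have := meas_ge_le_variance_div_sq (memLp_finsetSum' (Finset.range k) fun j _ => hL j) hc
  rw [hsm] at this
  simp only [Finset.sum_apply] at this
  refine this.trans (ENNReal.ofReal_le_ofReal ?_)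
  gcongr

end Exponential

section Clocks

variable {X : Type*} {p : Params X} {ty : ∀ n : ℕ, Fin n → X} {Ω : ℕ → Type*}
  [∀ n, MeasurableSpace (Ω n)] {P : ∀ n, Measure (Ω n)} [∀ n, IsProbabilityMeasure (P n)]
  {C : ∀ n, Reveal p (ty n) (Ω n)}

omit [∀ n, IsProbabilityMeasure (P n)] in
lemma IsLossReveal.measurable_clock {n : ℕ} (hC : IsLossReveal (P n) (C n)) (k : ℕ) :
    Measurable ((C n).clock k) := by
  rw [measurable_iff_comap_le]
  exact hC.measurable_source (.clock k)

omit [∀ n, IsProbabilityMeasure (P n)] in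
lemma IsLossReveal.ae_regular {n : ℕ} (hC : IsLossReveal (P n) (C n)) :
    ∀ᵐ ω ∂(P n), (C n).Regular ω := by
  have h1 : ∀ᵐ ω ∂(P n), ∀ k, 0 < (C n).clock k ω := by
    rw [ae_all_iff]
    intro k
    have h : ∀ᵐ u ∂(expMeasure 1), 0 < u := by
      have hdef : expMeasure 1 =
        volume.withDensity (fun x => ENNReal.ofReal (exponentialPDFReal 1 x)) := rfl
      rw [ae_iff, hdef, withDensity_apply _ (by simp only [not_lt]; exact measurableSet_Iic)]
      have h2 := lintegral_exponentialPDF_of_nonpos (x := 0) (r := 1) le_rfl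
      simp only [not_lt]
      refine Eq.trans ?_ h2
      change ∫⁻ a in Set.Iic 0, _ = _
      rw [setLIntegral_congr (Iio_ae_eq_Iic (μ := volume)).symm]
      rfl
    rw [← hC.clock_law k] at h
    exact ae_of_ae_map (hC.measurable_clock k).aemeasurable h
  filter_upwards [h1, hC.order_ruinous] with ω h2 h3
  exact ⟨h2, fun k => hC.rate_nonneg k ω, h3⟩

/-- Chebyshev gives `clockSum ⌊t n⌋ / n → t` for each fixed `t`. Positive clocks make the partial
sums monotone, so the convergence is uniform over all `k ≤ b n`. -/
lemma whp_clockSum (hC : ∀ n, IsLossReveal (P n) (C n)) (b : ℝ) {η : ℝ} (hη : 0 < η) :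
    ∀ᶠ z in whp P, ∀ k : ℕ, (k : ℝ) ≤ b * z.1 →
      |(C z.1).clockSum z.2 k / z.1 - k / z.1| < η := by
  have hind : ∀ n, iIndepFun (C n).clock (P n) := by
    intro n
    rw [iIndepFun_iff_iIndep]
    have := (hC n).indep.precomp (g := Source.clock) (fun a b h => by simpa using h)
    exact this
  have hpt : ∀ t ∈ Set.Icc 0 b, ∀ η > 0, ∀ᶠ z in whp P,
      |(C z.1).clockSum z.2 ⌊t * z.1⌋₊ / z.1 - t| < η := by
    intro t ht η hη
    -- Half of `η` absorbs the rounding of `t n`. Chebyshev with deviation `η n / 2` and variance at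
    -- most `2 t n` gives `8 t / (η² n)`.
    refine eventually_whp_of_le (f := fun n => ENNReal.ofReal (8 * t / η ^ 2 * (1 / n))) ?_ ?_
    · have hev : ∀ᶠ n : ℕ in atTop, 1 < η / 2 * (n : ℝ) := by
        have := (tendsto_natCast_atTop_atTop (R := ℝ)).const_mul_atTop (half_pos hη)
        exact this.eventually_gt_atTop 1
      filter_upwards [hev, eventually_gt_atTop 0] with n hn hn0
      have hn0' : (0 : ℝ) < n := by exact_mod_cast hn0
      have hfl := Nat.floor_le (mul_nonneg ht.1 hn0'.le)
      have hfl2 := Nat.lt_floor_add_one (t * n)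
      have hdev := clock_deviation_le (hC n).measurable_clock (hC n).clock_law (hind n)
        ⌊t * n⌋₊ (c := η / 2 * n) (by positivity)
      refine (measure_mono ?_).trans (hdev.trans (ENNReal.ofReal_le_ofReal ?_))
      · intro ω hω
        simp only [Set.mem_ofPred_eq, not_lt] at hω ⊢
        by_contra! hlt
        have : |(C n).clockSum ω ⌊t * n⌋₊ / n - t| < η := by
          rw [abs_lt] at hlt ⊢
          rw [Reveal.clockSum]
          constructor
          · rw [lt_sub_iff_add_lt, lt_div_iff₀ hn0']; nlinarith
          · rw [sub_lt_iff_lt_add, div_lt_iff₀ hn0']; nlinarith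
        linarith
      · rw [div_le_iff₀ (by positivity)]
        have : 8 * t / η ^ 2 * (1 / (n : ℝ)) * (η / 2 * n) ^ 2 = 2 * (t * n) := by
          field_simp; ring
        rw [this]; linarith
    · have h1 : Tendsto (fun n : ℕ => 8 * t / η ^ 2 * (1 / (n : ℝ))) atTop (𝓝 0) := by
        simpa using (tendsto_one_div_atTop_nhds_zero_nat (𝕜 := ℝ)).const_mul (8 * t / η ^ 2)
      simpa using ENNReal.tendsto_ofReal h1
  have hmono : ∀ᶠ z in whp P, MonotoneOn
      (fun t : ℝ => (C z.1).clockSum z.2 ⌊t * z.1⌋₊ / (z.1 : ℝ)) (Set.Icc 0 b) := by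
    filter_upwards [eventually_whp_of_ae (A := fun z => (C z.1).Regular z.2)
      fun n => (hC n).ae_regular] with z hz s _ t _ hst
    refine div_le_div_of_nonneg_right ?_ (Nat.cast_nonneg _)
    refine Finset.sum_le_sum_of_subset_of_nonneg ?_ fun j _ _ => (hz.clock_pos j).le
    exact Finset.range_mono (Nat.floor_le_floor (by gcongr))
  have := whp_uniform_of_monotone (P := P)
    (Y := fun n ω t => (C n).clockSum ω ⌊t * n⌋₊ / (n : ℝ)) continuousOn_id hmono hpt hη
  filter_upwards [this, tendsto_fst_whp.eventually (eventually_gt_atTop 0)] with z hz hn k hk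
  have hn0 : (0 : ℝ) < z.1 := by exact_mod_cast hn
  have h2 := hz (k / z.1) ⟨by positivity, by rwa [div_le_iff₀ hn0]⟩
  rw [div_mul_cancel₀ _ hn0.ne', Nat.floor_natCast] at h2
  exact h2

end Clocks

end RuinNetwork

namespace RuinNetwork

/-! ### The cascade with idealized reveal times -/

section MassInverse

variable {R : ℝ → ℝ} (hc : ContinuousOn R (Set.Ici 0)) (hp : ∀ t, 0 ≤ t → 0 < R t)

/-- A right inverse of the accumulated intensity on `[0, t]`. -/
def massInv (R : ℝ → ℝ) (t : ℝ) : ℝ → ℝ := Function.invFunOn (mass R) (Set.Icc 0 t)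

include hc in
lemma massInv_spec {t y : ℝ} (ht : 0 ≤ t) (hy : y ∈ Set.Icc 0 (mass R t)) :
    massInv R t y ∈ Set.Icc 0 t ∧ mass R (massInv R t y) = y := by
  have h : y ∈ mass R '' Set.Icc 0 t := by
    have := intermediate_value_Icc ht ((mass_continuousOn hc).mono Set.Icc_subset_Ici_self)
    rw [mass_zero] at this
    exact this hy
  exact ⟨Function.invFunOn_mem h, Function.invFunOn_eq h⟩

-- On `[0, t]` the positive continuous `R` has a positive minimum, so times with close accumulated
-- intensity are close. The premium is uniformly continuous there.
include hc hp in
lemma exists_prem_modulus {X : Type*} (p : Params X) (x : X) {t ζ : ℝ} (ht : 0 ≤ t) (hζ : 0 < ζ) :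
    ∃ ρ > 0, ∀ s ∈ Set.Icc 0 t, ∀ u ∈ Set.Icc 0 t, |mass R s - mass R u| ≤ ρ →
      |prem p x s - prem p x u| ≤ ζ := by
  have huc := isCompact_Icc.uniformContinuousOn_of_continuous
    ((continuous_prem p x).continuousOn (s := Set.Icc 0 t))
  rw [Metric.uniformContinuousOn_iff] at huc
  obtain ⟨δ, hδ, h⟩ := huc ζ hζ
  obtain ⟨v, hv, hmin⟩ := isCompact_Icc.exists_isMinOn (Set.nonempty_Icc.2 ht)
    (hc.mono Set.Icc_subset_Ici_self)
  have hr := hp v hv.1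
  have hlow : ∀ s ∈ Set.Icc 0 t, ∀ u ∈ Set.Icc 0 t, s ≤ u →
      R v * (u - s) ≤ mass R u - mass R s := by
    intro s hs u hu hsu
    rw [mass_sub hc hs.1 hu.1]
    have h2 := intervalIntegral.integral_mono_on hsu (f := fun _ => R v) (g := R)
      intervalIntegrable_const (intervalIntegrable_of_cont hc hs.1 hu.1)
      fun w hw => hmin (Set.mem_Icc.2 ⟨hs.1.trans hw.1, hw.2.trans hu.2⟩)
    rw [intervalIntegral.integral_const, smul_eq_mul, mul_comm] at h2
    exact h2
  refine ⟨R v * (δ / 2), by positivity, fun s hs u hu hsu => ?_⟩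
  refine (h s hs u hu ?_).le
  rw [Real.dist_eq]
  rw [abs_le] at hsu
  suffices |s - u| ≤ δ / 2 by linarith
  rw [abs_le]
  rcases le_total s u with hle | hle
  · have := hlow s hs u hu hle
    have h3 : R v * (u - s) ≤ R v * (δ / 2) := by linarith
    have := le_of_mul_le_mul_left h3 hr
    constructor <;> linarith
  · have := hlow u hu s hs hle
    have h3 : R v * (s - u) ≤ R v * (δ / 2) := by linarith
    have := le_of_mul_le_mul_left h3 hr
    constructor <;> linarith

end MassInverse

lemma card_inHalf {X : Type*} (p : Params X) {n : ℕ} (ty : Fin n → X) :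
    Fintype.card (InHalf p ty) = ∑ i, p.inDeg (ty i) := by simp

open Classical in
lemma typeFraction_eq {X : Type*} {n : ℕ} (ty : Fin n → X) (x : X) :
    typeFraction ty x = ((Finset.univ.filter fun i => ty i = x).card : ℝ) / n := by
  rw [typeFraction, ← Set.ncard_coe_finset]
  simp

/-- This links the two descriptions of a hit: its number in the order `σ` is the number of
half-edges with a time up to its own. The `+ 1` is due to positions being counted from zero. -/
lemma card_filter_le_of_strictMono {H : Type*} [Fintype H] {m : ℕ} (σ : Fin m ≃ H) {s : H → ℝ}
    (hs : StrictMono (s ∘ σ)) (h : H) :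
    (Finset.univ.filter fun h' => s h' ≤ s h).card = (σ.symm h : ℕ) + 1 := by
  classical
  have : (Finset.univ.filter fun h' => s h' ≤ s h) =
      (Finset.Iic (σ.symm h)).map σ.toEmbedding := by
    ext h'
    simp only [Finset.mem_filter, Finset.mem_univ, true_and, Finset.mem_map_equiv, Finset.mem_Iic]
    rw [← hs.le_iff_le]
    simp
  rw [this, Finset.card_map, Fin.card_Iic]

open Classical in
lemma card_filter_le_mono {H : Type*} [Fintype H] (s : H → ℝ) {a b : ℝ} (hab : a ≤ b) :
    ((Finset.univ.filter fun h => s h ≤ a).card : ℝ) ≤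
      (Finset.univ.filter fun h => s h ≤ b).card :=
  Nat.cast_le.2 (Finset.card_le_card fun h hh => by
    simp only [Finset.mem_filter, Finset.mem_univ, true_and] at hh ⊢
    exact hh.trans hab)

/-! ### Laws of large numbers on the canonical space. -/

section Canonical

variable {X : Type*} {p : Params X} {ty : ∀ n : ℕ, Fin n → X} {μ : X → ℝ} {lam : ℝ}
  (hnet : NetworkLimit p ty μ lam) {R : ℝ → ℝ} (hc : ContinuousOn R (Set.Ici 0))
  (hp : ∀ t, 0 ≤ t → 0 < R t) {t₁ : ℝ≥0} (h₁ : mass R t₁ < lam)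

include hnet in
lemma NetworkLimit.tendsto_card :
    Tendsto (fun n : ℕ => (Fintype.card (InHalf p (ty n)) : ℝ) / n) atTop (𝓝 lam) := by
  have := hnet.mean_tendsto
  simp only [card_inHalf, Nat.cast_sum]
  exact this

-- There are about `lam * n` half-edges, each hit by time `t` with probability `mass R t / lam`.
-- Chebyshev treats fixed `t`, and monotonicity of the count makes it uniform.
include hnet hc hp h₁ in
open Classical in
lemma whp_times {ρ : ℝ} (hρ : 0 < ρ) :
    ∀ᶠ z in whp (fun n => canon p (truncLaw R lam t₁) (ty n)), ∀ t ∈ Set.Icc (0 : ℝ) t₁,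
      |((Finset.univ.filter fun h => z.2 (.inr h) ≤ t).card : ℝ) / z.1 - mass R t| < ρ := by
  have hl := hnet.lam_pos
  have := isProbabilityMeasure_truncLaw hc hp hl h₁
  refine whp_uniform_of_monotone (P := fun n => canon p (truncLaw R lam t₁) (ty n))
    (Y := fun n w t => ((Finset.univ.filter fun h => w (.inr h) ≤ t).card : ℝ) / n)
    ((mass_continuousOn hc).mono Set.Icc_subset_Ici_self) ?_ ?_ hρ
  · refine Filter.Eventually.of_forall fun z s _ t _ hst => ?_
    exact div_le_div_of_nonneg_right (card_filter_le_mono _ hst) (Nat.cast_nonneg _)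
  · intro t ht η hη
    lift t to ℝ≥0 using ht.1
    have hq : (truncLaw R lam t₁).real (Set.Iic (t : ℝ)) = mass R t / lam := by
      rw [measureReal_def, truncLaw_Iic hc hp hl ht.2, ENNReal.toReal_ofReal]
      exact div_nonneg (mass_nonneg hc hp t.coe_nonneg) hl.le
    have hlim : Tendsto (fun n : ℕ => (Fintype.card (InHalf p (ty n)) : ℝ) / n * (mass R t / lam))
        atTop (𝓝 (mass R t)) := by
      have := hnet.tendsto_card.mul_const (mass R t / lam)
      rwa [mul_div_cancel₀ _ hl.ne'] at this
    refine eventually_whp_of_le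
      (f := fun n => ENNReal.ofReal ((Fintype.card (InHalf p (ty n)) : ℝ) / n * (4 / η ^ 2) *
        (1 / n))) ?_ ?_
    · filter_upwards [Metric.tendsto_nhds.1 hlim (η / 2) (half_pos hη), eventually_gt_atTop 0]
        with n hn hn0
      have hn0' : (0 : ℝ) < n := by exact_mod_cast hn0
      refine (measure_mono ?_).trans ((canon_count_times (truncLaw R lam t₁) (ty := ty n) (p := p)
        t (c := η / 2 * n) (by positivity)).trans (ENNReal.ofReal_le_ofReal (le_of_eq ?_)))
      · intro w hw
        simp only [Set.mem_ofPred_eq, not_lt] at hw ⊢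
        rw [hq]
        by_contra! hlt
        rw [Real.dist_eq] at hn
        rw [← not_lt] at hw
        apply hw
        rw [abs_lt] at *
        rw [div_mul_eq_mul_div] at hn
        have h1 : ∀ N : ℝ, N / n = (N - Fintype.card (InHalf p (ty n)) * (mass R t / lam)) / n +
            Fintype.card (InHalf p (ty n)) * (mass R t / lam) / n := fun N => by ring
        rw [h1]
        have h2 := (div_lt_iff₀ hn0').2 hlt.2
        have h3 := (lt_div_iff₀ hn0').2 (by linarith [hlt.1] :
          -(η / 2) * n < (((Finset.univ.filter fun h => w (.inr h) ≤ (t : ℝ)).card : ℝ) -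
            Fintype.card (InHalf p (ty n)) * (mass R t / lam)))
        constructor <;> linarith [hn.1, hn.2]
      · field_simp; ring
    · have := (hnet.tendsto_card.mul_const (4 / η ^ 2)).mul
        (tendsto_one_div_atTop_nhds_zero_nat (𝕜 := ℝ))
      rw [mul_zero] at this
      simpa using ENNReal.tendsto_ofReal this

-- The agents of type `x` have independent, identically distributed data, and their proportion tends
-- to `μ x`. The margin `η` may have either sign.
include hnet hc hp h₁ in
open Classical in
lemma whp_agents (x : X) (η t : ℝ) {ε : ℝ} (hε : 0 < ε) :
    ∀ᶠ z in whp (fun n => canon p (truncLaw R lam t₁) (ty n)),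
      |((Finset.univ.filter fun i => ty z.1 i = x ∧ agentData i z.2 ∈
        {d | Solvent p (ty z.1 i) d.1 η d.2.1 d.2.2 (prem p (ty z.1 i)) t}).card : ℝ) / z.1 -
        μ x * (agentLaw p (truncLaw R lam t₁) x (p.inDeg x)).real
          {d | Solvent p x d.1 η d.2.1 d.2.2 (prem p x) t}| < ε := by
  have hl := hnet.lam_pos
  have := isProbabilityMeasure_truncLaw hc hp hl h₁
  set q := (agentLaw p (truncLaw R lam t₁) x (p.inDeg x)).real
          {d | Solvent p x d.1 η d.2.1 d.2.2 (prem p x) t} with hq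
  have hlim := (hnet.fraction x).mul_const q
  refine eventually_whp_of_le (f := fun n => ENNReal.ofReal (4 / ε ^ 2 * (1 / n))) ?_ ?_
  · filter_upwards [Metric.tendsto_nhds.1 hlim (ε / 2) (half_pos hε), eventually_gt_atTop 0]
      with n hn hn0
    have hn0' : (0 : ℝ) < n := by exact_mod_cast hn0
    refine (measure_mono ?_).trans ((canon_count_agents (truncLaw R lam t₁) (ty := ty n) (p := p)
      x (fun i => {d | Solvent p (ty n i) d.1 η d.2.1 d.2.2 (prem p (ty n i)) t})
      (fun i => measurableSet_solvent p (ty n i) η t) q (by rintro i rfl; rfl)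
      (c := ε / 2 * n) (by positivity)).trans (ENNReal.ofReal_le_ofReal (le_of_eq ?_)))
    · intro w hw
      simp only [Set.mem_ofPred_eq, not_lt] at hw ⊢
      by_contra! hlt
      rw [Real.dist_eq, typeFraction_eq] at hn
      rw [← not_lt] at hw
      apply hw
      rw [abs_lt] at *
      rw [div_mul_eq_mul_div] at hn
      set M := ((Finset.univ.filter fun i => ty n i = x).card : ℝ)
      have h1 : ∀ N : ℝ, N / n = (N - M * q) / n + M * q / n := fun N => by ring
      rw [h1]
      have h2 := (div_lt_iff₀ hn0').2 hlt.2
      rw [← neg_mul] at hlt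
      have h3 := (lt_div_iff₀ hn0').2 hlt.1
      constructor <;> linarith [hn.1, hn.2]
    · field_simp; ring
  · have := (tendsto_one_div_atTop_nhds_zero_nat (𝕜 := ℝ)).const_mul (4 / ε ^ 2)
    rw [mul_zero] at this
    simpa using ENNReal.tendsto_ofReal this

include hnet hc hp h₁ in
lemma whp_canon_generic : ∀ᶠ z in whp (fun n => canon p (truncLaw R lam t₁) (ty n)),
    ∀ h, 0 < z.2 (.inr h) := by
  have hl := hnet.lam_pos
  have := isProbabilityMeasure_truncLaw hc hp hl h₁
  refine eventually_whp_of_ae fun n => ?_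
  change ∀ᵐ w ∂(canon p (truncLaw R lam t₁) (ty n)), ∀ h : InHalf p (ty n), 0 < w (.inr h)
  refine ae_all_iff.2 fun h => ?_
  have hs : ∀ᵐ s ∂(truncLaw R lam t₁), 0 < s := by
    rw [ae_iff]
    simpa [Set.Iic] using truncLaw_Iic_zero (R := R) (lam := lam) t₁
  exact (measurePreserving_eval (canonLaw p (truncLaw R lam t₁) (ty n))
    (.inr h)).quasiMeasurePreserving.ae hs

end Canonical

section Ideal

variable {X : Type*} {p : Params X} {n : ℕ} {ty : Fin n → X}

open Classical in
/-- The number of agents of type `x` that are solvent with margin `η` after the `k`-th reveal, if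
the half-edges are hit in the order `σ` and the premiums accumulated at the reveals are `b`. -/
def idealCount (x : X) (η : ℝ) (b : X → ℕ → ℝ) (k : ℕ) (σ : Fin (numLinks p ty) ≃ InHalf p ty)
    (D : Fin n ⊕ InHalf p ty → ℝ) : ℕ :=
  (Finset.univ.filter fun i => ty i = x ∧ Solvent p (ty i) (D (.inl i)) η
    (fun j => D (.inr ⟨i, j⟩)) (fun j => (σ.symm ⟨i, j⟩ : ℕ) + 1) (b (ty i)) k).card

lemma measurable_idealCount (x : X) (η : ℝ) (b : X → ℕ → ℝ) (k : ℕ)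
    (σ : Fin (numLinks p ty) ≃ InHalf p ty) : Measurable (idealCount x η b k σ) := by
  classical
  unfold idealCount
  simp only [Finset.card_filter]
  refine Finset.measurable_sum _ fun i _ => ?_
  refine Measurable.ite ?_ measurable_const measurable_const
  by_cases hx : ty i = x
  · simp only [hx, true_and]
    unfold Solvent
    have h0 : MeasurableSet {D : Fin n ⊕ InHalf p ty → ℝ |
        η < p.γ (ty i) * (1 - D (.inl i)) + p.α (ty i) 0 - p.δ (ty i)} :=
      measurableSet_lt (by fun_prop) (by fun_prop)
    simp only [hx] at h0
    refine MeasurableSet.inter h0 ?_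
    change MeasurableSet {D : Fin n ⊕ InHalf p ty → ℝ | ∀ j, _ → _}
    simp only [Set.ofPred_forall]
    refine MeasurableSet.iInter fun j => MeasurableSet.iInter fun _ => ?_
    exact measurableSet_lt (by fun_prop) (by fun_prop)
  · simp [hx]

end Ideal

/-! ### From independent times back to the reveal process. -/

section Transfer

variable {X : Type*} {p : Params X} {ty : ∀ n : ℕ, Fin n → X} {μ : X → ℝ} {lam : ℝ}
  (hnet : NetworkLimit p ty μ lam) {R : ℝ → ℝ} (hc : ContinuousOn R (Set.Ici 0))
  (hp : ∀ t, 0 ≤ t → 0 < R t) {t₁ : ℝ≥0} (h₁ : mass R t₁ < lam)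
  {Ω : ℕ → Type*} [∀ n, MeasurableSpace (Ω n)] {P : ∀ n, Measure (Ω n)}
  [∀ n, IsProbabilityMeasure (P n)] {C : ∀ n, Reveal p (ty n) (Ω n)}
  (hC : ∀ n, IsLossReveal (P n) (C n))

/-- The shocks and losses. -/
def Reveal.data {n : ℕ} {ty : Fin n → X} {Ω : Type*} (C : Reveal p ty Ω) (ω : Ω) :
    Fin n ⊕ InHalf p ty → ℝ := Sum.elim (fun i => C.shock i ω) (fun h => C.loss h ω)

/-- The premium accumulated when a number of reveals proportional to the limiting intensity has
taken place. -/
def idealPrem (p : Params X) (R : ℝ → ℝ) (t₁ : ℝ) (n : ℕ) (x : X) (k : ℕ) : ℝ :=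
  prem p x (massInv R t₁ (k / n))

-- The hypothesis concerns every `σ` that sorts the times, so that failure for the actual order of
-- hits is covered by the event in `measure_le_canon`.
include hC in
lemma whp_of_canon (κ : Measure ℝ) [IsProbabilityMeasure κ] [NullSingletonClass κ]
    (A : ∀ n, (Fin (numLinks p (ty n)) ≃ InHalf p (ty n)) → (Fin n ⊕ InHalf p (ty n) → ℝ) → Prop)
    (hA : ∀ n σ, MeasurableSet {D | A n σ D})
    (h : ∀ᶠ z in whp (fun n => canon p κ (ty n)), ∀ σ : Fin (numLinks p (ty z.1)) ≃ InHalf p (ty z.1),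
      StrictMono ((fun h => z.2 (.inr h)) ∘ σ) → A z.1 σ (fun k => z.2 (.inl k))) :
    ∀ᶠ z in whp P, A z.1 ((C z.1).hits z.2) ((C z.1).data z.2) := by
  refine eventually_whp_of_le (Filter.Eventually.of_forall fun n => ?_) (eventually_whp.1 h)
  have := (hC n).measure_le_canon κ (fun σ => {D | ¬ A n σ D}) fun σ => (hA n σ).compl
  refine this.trans (measure_mono ?_)
  rintro w ⟨σ, h1, h2⟩ hh
  exact h2 (hh σ h1)

-- Agents that are solvent with margin `η` up to a slightly later canonical time `t'` are counted.
-- With high probability the first `⌊n * mass R t⌋` hits occur before `t'`, and the premium at each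
-- differs from the idealised one by at most `η / 2`. Enlarging the time, introducing the margin and
-- the law of large numbers cost `ε / 3` each.
include hnet hc hp hC h₁ in
lemma exists_idealCount_lower (x : X) {t : ℝ≥0} (ht : t < t₁) {ε : ℝ} (hε : 0 < ε) :
    ∃ η > 0, ∀ᶠ z in whp P, μ x * surviveProb p lam R x t - ε <
      idealCount x η (idealPrem p R t₁ z.1) ⌊z.1 * mass R t⌋₊ ((C z.1).hits z.2)
        ((C z.1).data z.2) / (z.1 : ℝ) := by
  have hl := hnet.lam_pos
  have := isProbabilityMeasure_truncLaw hc hp hl h₁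
  have hμ := hnet.μ_nonneg x
  have hμ1 : μ x ≤ 1 := le_hasSum hnet.μ_sum x fun y _ => hnet.μ_nonneg y
  -- a slightly later time
  obtain ⟨t', htt', ht'₁, hG⟩ : ∃ t' : ℝ≥0, t < t' ∧ t' ≤ t₁ ∧
      surviveProb p lam R x t - ε / 3 < surviveProb p lam R x t' := by
    have hcont : ContinuousWithinAt (fun s : ℝ => p.inDeg x * ((mass R s - mass R t) / lam))
        (Set.Ici 0) t := by
      have := mass_continuousOn hc t t.coe_nonneg
      fun_prop
    have hlt : ∀ᶠ s in 𝓝[Set.Ici 0] (t : ℝ), p.inDeg x * ((mass R s - mass R t) / lam) < ε / 3 :=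
      hcont.eventually_lt_const (by simp; positivity)
    rw [Filter.Eventually, Metric.mem_nhdsWithin_iff] at hlt
    obtain ⟨δ, hδ, hlt⟩ := hlt
    have ht₁' : (t : ℝ) < t₁ := ht
    have hmin : (t : ℝ) < min (t + δ / 2) t₁ := lt_min (by linarith) ht₁'
    refine ⟨⟨min (t + δ / 2) t₁, t.coe_nonneg.trans hmin.le⟩, hmin,
      (min_le_right _ _ : min ((t : ℝ) + δ / 2) t₁ ≤ t₁), ?_⟩
    set t' : ℝ≥0 := ⟨min (t + δ / 2) t₁, t.coe_nonneg.trans hmin.le⟩ with ht'def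
    have ht' : (t' : ℝ) = min (t + δ / 2) t₁ := rfl
    have hm : mass R t' ≤ mass R t₁ :=
      mass_monoOn hc hp t'.coe_nonneg t₁.coe_nonneg (min_le_right _ _)
    have h2 := surviveProb_sub_le p x hc hp hl (s := t) (t := t') hmin.le (hm.trans_lt h₁)
    have h3 : p.inDeg x * ((mass R t' - mass R t) / lam) < ε / 3 := hlt ⟨by
      rw [Metric.mem_ball, Real.dist_eq, abs_lt, ht']
      have := min_le_left ((t : ℝ) + δ / 2) t₁
      constructor <;> linarith, t'.coe_nonneg⟩
    linarith
  obtain ⟨η, hη, hmargin⟩ := exists_margin_lower p x hc hp hl ht'₁ h₁ (by positivity : 0 < ε / 3)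
  set q := (agentLaw p (truncLaw R lam t₁) x (p.inDeg x)).real
    {z | Solvent p x z.1 η z.2.1 z.2.2 (prem p x) t'} with hqdef
  obtain ⟨ρ, hρ, hmod⟩ := exists_prem_modulus hc hp p x t₁.coe_nonneg (half_pos hη)
  have hmm : mass R t < mass R t' := mass_strictMonoOn hc hp t.coe_nonneg t'.coe_nonneg htt'
  have hmt₁ : mass R t < mass R t₁ := mass_strictMonoOn hc hp t.coe_nonneg t₁.coe_nonneg ht
  refine ⟨η / 2, half_pos hη, ?_⟩
  refine whp_of_canon (hC := hC) (truncLaw R lam t₁)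
    (fun n σ D => μ x * surviveProb p lam R x t - ε <
      idealCount x (η / 2) (idealPrem p R t₁ n) ⌊n * mass R t⌋₊ σ D / (n : ℝ)) (fun n σ => ?_) ?_
  · refine measurableSet_lt measurable_const ?_
    exact (measurable_from_top.comp (measurable_idealCount _ _ _ _ _)).div_const _
  -- The count of times must be accurate to `ρ` for the premium comparison, and to the gap `mass R
  -- t' - mass R t` so that these early hits come before `t'`.
  filter_upwards [whp_times hnet hc hp h₁ (lt_min hρ (sub_pos.2 hmm)),
    whp_agents hnet hc hp h₁ x η t' (by positivity : 0 < ε / 3),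
    whp_canon_generic hnet hc hp h₁,
    tendsto_fst_whp.eventually (eventually_gt_atTop 0)] with z htimes hagents hpos hn σ hσ
  classical
  have hn0 : (0 : ℝ) < z.1 := by exact_mod_cast hn
  have hrank : ∀ h, (((σ.symm h : ℕ) + 1 : ℕ) : ℝ) =
      ((Finset.univ.filter fun h' => z.2 (.inr h') ≤ z.2 (.inr h)).card : ℝ) := fun h => by
    rw [← card_filter_le_of_strictMono σ hσ h]
  have hle : ((Finset.univ.filter fun i => ty z.1 i = x ∧ agentData i z.2 ∈
      {d | Solvent p (ty z.1 i) d.1 η d.2.1 d.2.2 (prem p (ty z.1 i)) t'}).card : ℝ) ≤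
      idealCount x (η / 2) (idealPrem p R t₁ z.1) ⌊z.1 * mass R t⌋₊ σ
        (fun k => z.2 (.inl k)) := by
    unfold idealCount
    refine Nat.cast_le.2 (Finset.card_le_card fun i hi => ?_)
    simp only [Finset.mem_filter, Finset.mem_univ, true_and, Set.mem_ofPred_eq] at hi ⊢
    refine ⟨hi.1, hi.2.transfer (by linarith) ?_ ?_ ?_⟩
    · intro j j'
      have h2 := hσ.le_iff_le (a := σ.symm ⟨i, j⟩) (b := σ.symm ⟨i, j'⟩)
      simp only [Function.comp_apply, Equiv.apply_symm_apply] at h2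
      simp only [agentData]
      rw [h2]
      simp
    all_goals
      intro j hj
      have hj' : ((((σ.symm ⟨i, j⟩ : ℕ) + 1 : ℕ) : ℝ)) ≤ z.1 * mass R t :=
        (Nat.le_floor_iff (mul_nonneg hn0.le (mass_nonneg hc hp t.coe_nonneg))).1 hj
      have hcut : z.2 (.inr ⟨i, j⟩) ≤ t' := by
        by_contra! hgt
        have h3 := htimes t' ⟨t'.coe_nonneg, ht'₁⟩
        have h4 : ((Finset.univ.filter fun h' => z.2 (.inr h') ≤ (t' : ℝ)).card : ℝ) ≤
            z.1 * mass R t := by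
          refine le_trans ?_ hj'
          rw [hrank]
          exact card_filter_le_mono _ hgt.le
        rw [mul_comm, ← div_le_iff₀ hn0] at h4
        have h5 := (abs_lt.1 (h3.trans_le (min_le_right _ _))).1
        linarith
    · exact hcut
    · have hs : z.2 (.inr ⟨i, j⟩) ∈ Set.Icc (0 : ℝ) t₁ := ⟨(hpos _).le, hcut.trans ht'₁⟩
      have h3 := htimes _ hs
      rw [← hrank] at h3
      rw [mul_comm, ← div_le_iff₀ hn0] at hj'
      have h4 := massInv_spec hc t₁.coe_nonneg (y := (((σ.symm ⟨i, j⟩ : ℕ) + 1 : ℕ) : ℝ) / z.1)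
        ⟨by positivity, hj'.trans hmt₁.le⟩
      have h5 := hmod _ hs _ h4.1 (by
        rw [h4.2, abs_sub_comm]; exact (h3.trans_le (min_le_left _ _)).le)
      rw [← hi.1] at h5
      have := le_of_abs_le h5
      simp only [agentData, idealPrem]
      linarith
  simp only [Set.mem_ofPred_eq] at hle
  rw [← hqdef] at hagents
  have h2 := (abs_lt.1 hagents).1
  have h3 := div_le_div_of_nonneg_right hle hn0.le
  have hG' : surviveProb p lam R x t - 2 * (ε / 3) < q := by linarith
  have h4 : μ x * (surviveProb p lam R x t - 2 * (ε / 3)) ≤ μ x * q :=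
    mul_le_mul_of_nonneg_left hG'.le hμ
  have h5 : μ x * (2 * (ε / 3)) ≤ 2 * (ε / 3) := mul_le_of_le_one_left (by positivity) hμ1
  linarith

-- The mirror image of the lower bound, with negative margins and a slightly earlier time `t'`: hits
-- before `t'` are with high probability among the first `⌈n * mass R t⌉`.
include hnet hc hp hC h₁ in
lemma exists_idealCount_upper (x : X) {t : ℝ≥0} (ht : t < t₁) {ε : ℝ} (hε : 0 < ε) :
    ∃ η > 0, ∀ᶠ z in whp P,
      idealCount x (-η) (idealPrem p R t₁ z.1) ⌈z.1 * mass R t⌉₊ ((C z.1).hits z.2)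
        ((C z.1).data z.2) / (z.1 : ℝ) < μ x * surviveProb p lam R x t + ε := by
  have hl := hnet.lam_pos
  have := isProbabilityMeasure_truncLaw hc hp hl h₁
  have hμ := hnet.μ_nonneg x
  have hμ1 : μ x ≤ 1 := le_hasSum hnet.μ_sum x fun y _ => hnet.μ_nonneg y
  have hmlam : mass R t < lam :=
    (mass_monoOn hc hp t.coe_nonneg t₁.coe_nonneg ht.le).trans_lt h₁
  -- a slightly earlier time
  obtain ⟨t', htt', hbefore, hG⟩ : ∃ t' : ℝ≥0, t' ≤ t ∧ (t' < t ∨ t' = 0) ∧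
      surviveProb p lam R x t' < surviveProb p lam R x t + ε / 3 := by
    have hcont : ContinuousWithinAt (fun s : ℝ => p.inDeg x * ((mass R t - mass R s) / lam))
        (Set.Ici 0) t := by
      have := mass_continuousOn hc t t.coe_nonneg
      fun_prop
    have hlt : ∀ᶠ s in 𝓝[Set.Ici 0] (t : ℝ), p.inDeg x * ((mass R t - mass R s) / lam) < ε / 3 :=
      hcont.eventually_lt_const (by simp; positivity)
    rw [Filter.Eventually, Metric.mem_nhdsWithin_iff] at hlt
    obtain ⟨δ, hδ, hlt⟩ := hlt
    have ht0 := t.coe_nonneg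
    refine ⟨⟨max (t - δ / 2) 0, le_max_right _ _⟩, ?_, ?_, ?_⟩
    · exact (max_le (by linarith) ht0 : max ((t : ℝ) - δ / 2) 0 ≤ t)
    · rcases le_total ((t : ℝ) - δ / 2) 0 with h | h
      · right; ext; exact max_eq_right h
      · left; change max ((t : ℝ) - δ / 2) 0 < t; rw [max_eq_left h]; linarith
    set t' : ℝ≥0 := ⟨max (t - δ / 2) 0, le_max_right _ _⟩ with ht'def
    have ht' : (t' : ℝ) = max (t - δ / 2) 0 := rfl
    have hle : (t' : ℝ) ≤ t := max_le (by linarith) ht0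
    have h2 := surviveProb_sub_le p x hc hp hl (s := t') (t := t) hle hmlam
    have h3 : p.inDeg x * ((mass R t - mass R t') / lam) < ε / 3 := hlt ⟨by
      rw [Metric.mem_ball, Real.dist_eq, abs_lt]
      have := le_max_left ((t : ℝ) - δ / 2) 0
      constructor <;> linarith, t'.coe_nonneg⟩
    linarith
  have htt₁ : t' ≤ t₁ := htt'.trans ht.le
  obtain ⟨η, hη, hmargin⟩ := exists_margin_upper p x hc hp hl htt₁ h₁ (by positivity : 0 < ε / 3)
  set q := (agentLaw p (truncLaw R lam t₁) x (p.inDeg x)).real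
    {z | Solvent p x z.1 (-η) z.2.1 z.2.2 (prem p x) t'} with hqdef
  obtain ⟨ρ, hρ, hmod⟩ := exists_prem_modulus hc hp p x t₁.coe_nonneg (half_pos hη)
  have hmt₁ : mass R t < mass R t₁ := mass_strictMonoOn hc hp t.coe_nonneg t₁.coe_nonneg ht
  -- Either there is a strict gap of intensity between `t'` and `t`, or `t' = 0`, and then no hit
  -- has to be placed because all hitting times are positive.
  obtain ⟨ρ', hρ', hgap⟩ : ∃ ρ' > 0, t' = 0 ∨ mass R t' + ρ' ≤ mass R t := by
    rcases hbefore with h | h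
    · have hmm : mass R t' < mass R t := mass_strictMonoOn hc hp t'.coe_nonneg t.coe_nonneg h
      exact ⟨mass R t - mass R t', sub_pos.2 hmm, Or.inr (by linarith)⟩
    · exact ⟨1, one_pos, Or.inl h⟩
  refine ⟨η / 2, half_pos hη, ?_⟩
  refine whp_of_canon (hC := hC) (truncLaw R lam t₁)
    (fun n σ D => idealCount x (-(η / 2)) (idealPrem p R t₁ n) ⌈n * mass R t⌉₊ σ D / (n : ℝ) <
      μ x * surviveProb p lam R x t + ε) (fun n σ => ?_) ?_
  · refine measurableSet_lt ?_ measurable_const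
    exact (measurable_from_top.comp (measurable_idealCount _ _ _ _ _)).div_const _
  filter_upwards [whp_times hnet hc hp h₁ (lt_min hρ hρ'),
    whp_agents hnet hc hp h₁ x (-η) t' (by positivity : 0 < ε / 3),
    whp_canon_generic hnet hc hp h₁,
    tendsto_fst_whp.eventually (eventually_gt_atTop 0)] with z htimes hagents hpos hn σ hσ
  classical
  have hn0 : (0 : ℝ) < z.1 := by exact_mod_cast hn
  have hrank : ∀ h, (((σ.symm h : ℕ) + 1 : ℕ) : ℝ) =
      ((Finset.univ.filter fun h' => z.2 (.inr h') ≤ z.2 (.inr h)).card : ℝ) := fun h => by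
    rw [← card_filter_le_of_strictMono σ hσ h]
  have hle : (idealCount x (-(η / 2)) (idealPrem p R t₁ z.1) ⌈z.1 * mass R t⌉₊ σ
      (fun k => z.2 (.inl k)) : ℝ) ≤
      ((Finset.univ.filter fun i => ty z.1 i = x ∧ agentData i z.2 ∈
      {d | Solvent p (ty z.1 i) d.1 (-η) d.2.1 d.2.2 (prem p (ty z.1 i)) t'}).card : ℝ) := by
    unfold idealCount
    refine Nat.cast_le.2 (Finset.card_le_card fun i hi => ?_)
    simp only [Finset.mem_filter, Finset.mem_univ, true_and, Set.mem_ofPred_eq] at hi ⊢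
    refine ⟨hi.1, hi.2.transfer (by linarith) ?_ ?_ ?_⟩
    · intro j j'
      have h2 := hσ.le_iff_le (a := σ.symm ⟨i, j⟩) (b := σ.symm ⟨i, j'⟩)
      simp only [Function.comp_apply, Equiv.apply_symm_apply] at h2
      simp only [agentData]
      rw [h2]
      simp
    all_goals
      intro j hj
      have hj : z.2 (.inr ⟨i, j⟩) ≤ t' := hj
      have htm : (t' : ℝ) ≤ t₁ := htt₁
      have hs : z.2 (.inr ⟨i, j⟩) ∈ Set.Icc (0 : ℝ) t₁ := ⟨(hpos _).le, hj.trans htm⟩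
      have h3 := htimes _ hs
      rw [← hrank] at h3
      have hcut : (((σ.symm ⟨i, j⟩ : ℕ) + 1 : ℕ) : ℝ) / z.1 ≤ mass R t := by
        rcases hgap with h | h
        · rw [h] at hj
          exact absurd (hpos ⟨i, j⟩) (not_lt.2 (by exact_mod_cast hj))
        · have h5 := (abs_lt.1 (h3.trans_le (min_le_right _ _))).2
          have := mass_monoOn hc hp hs.1 t'.coe_nonneg hj
          linarith
    · rw [div_le_iff₀ hn0, mul_comm] at hcut
      exact_mod_cast hcut.trans (Nat.le_ceil _)
    · have h4 := massInv_spec hc t₁.coe_nonneg (y := (((σ.symm ⟨i, j⟩ : ℕ) + 1 : ℕ) : ℝ) / z.1)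
        ⟨by positivity, hcut.trans hmt₁.le⟩
      have h5 := hmod _ hs _ h4.1 (by
        rw [h4.2, abs_sub_comm]; exact (h3.trans_le (min_le_left _ _)).le)
      rw [← hi.1] at h5
      have := neg_le_of_abs_le h5
      simp only [agentData, idealPrem]
      linarith
  simp only [Set.mem_ofPred_eq] at hle
  rw [← hqdef] at hagents
  have h2 := (abs_lt.1 hagents).2
  have h3 := div_le_div_of_nonneg_right hle hn0.le
  have hG' : q < surviveProb p lam R x t + 2 * (ε / 3) := by linarith
  have h4 : μ x * q ≤ μ x * (surviveProb p lam R x t + 2 * (ε / 3)) :=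
    mul_le_mul_of_nonneg_left hG'.le hμ
  have h5 : μ x * (2 * (ε / 3)) ≤ 2 * (ε / 3) := mul_le_of_le_one_left (by positivity) hμ1
  linarith

end Transfer

end RuinNetwork

namespace RuinNetwork

/-! ### Comparison with the idealized cascade -/

lemma exists_gt_mass_lt {R : ℝ → ℝ} (hc : ContinuousOn R (Set.Ici 0)) {lam : ℝ} {t : ℝ≥0}
    (ht : mass R t < lam) : ∃ t₁ : ℝ≥0, t < t₁ ∧ mass R t₁ < lam := by
  have hev : ∀ᶠ s in 𝓝[Set.Ici 0] (t : ℝ), mass R s < lam :=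
    (mass_continuousOn hc t t.coe_nonneg).eventually_lt_const ht
  rw [Filter.Eventually, Metric.mem_nhdsWithin_iff] at hev
  obtain ⟨δ, hδ, h⟩ := hev
  obtain ⟨t₁, ht₁⟩ : ∃ t₁ : ℝ≥0, (t₁ : ℝ) = t + δ / 2 :=
    CanLift.prf (t + δ / 2 : ℝ) (by positivity : (0 : ℝ) ≤ t + δ / 2)
  refine ⟨t₁, ?_, h ⟨?_, t₁.coe_nonneg⟩⟩
  · rw [← NNReal.coe_lt_coe, ht₁]; linarith
  · rw [Metric.mem_ball, Real.dist_eq, ht₁, add_sub_cancel_left, abs_of_pos (by positivity)]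
    linarith

section Time

variable {X : Type*} {p : Params X} {ty : ∀ n : ℕ, Fin n → X} {R : ℝ → ℝ}
  {Ω : ℕ → Type*} [∀ n, MeasurableSpace (Ω n)] {P : ∀ n, Measure (Ω n)}
  [∀ n, IsProbabilityMeasure (P n)] {C : ∀ n, Reveal p (ty n) (Ω n)}
  (hC : ∀ n, IsLossReveal (P n) (C n)) (hR : IntensityLimit P C R)

omit [∀ n, IsProbabilityMeasure (P n)] in
include hC in
lemma whp_regular : ∀ᶠ z in whp P, (C z.1).Regular z.2 :=
  eventually_whp_of_ae (A := fun z => (C z.1).Regular z.2) fun n => (hC n).ae_regular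

omit [∀ n, IsProbabilityMeasure (P n)] in
include hR in
lemma whp_intensity {η : ℝ} (hη : 0 < η) : ∀ᶠ z in whp P, ∀ t : ℝ≥0,
    (t : ℝ≥0∞) < (C z.1).stopTime z.2 → |(C z.1).intensity t z.2 / z.1 - R t| ≤ η := by
  refine eventually_whp_of_le (Filter.Eventually.of_forall fun n => measure_mono ?_)
    (hR.uniform η hη)
  intro ω hω
  simp only [Set.mem_ofPred_eq, not_forall, not_le] at hω ⊢
  obtain ⟨t, h1, h2⟩ := hω
  exact ⟨t, h1, h2.le⟩

include hC hR in
/-- The `k`-th reveal takes place when the accumulated limiting intensity is close to `k / n`. -/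
lemma whp_revealTime {t t₁ : ℝ≥0} (ht : t < t₁) {ρ : ℝ} (hρ : 0 < ρ) :
    ∀ᶠ z in whp P, ∀ k ≤ (C z.1).finalCount z.2, (k : ℝ) / z.1 ≤ mass R t →
      ((C z.1).revealTime k z.2).toReal ≤ t₁ ∧
        |mass R ((C z.1).revealTime k z.2).toReal - k / z.1| ≤ ρ := by
  have hmm : mass R t < mass R t₁ :=
    mass_strictMonoOn hR.cont hR.pos t.coe_nonneg t₁.coe_nonneg ht
  have ht₁ := t₁.coe_nonneg
  -- The clocks contribute an error `η` and the time change at most `η * t₁`. Their sum must stay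
  -- below both `ρ` and the gap of intensity between `t` and `t₁`.
  obtain ⟨η, hη, hη1, hη2⟩ : ∃ η > 0, η * (1 + t₁) ≤ ρ ∧ η * (1 + t₁) < mass R t₁ - mass R t := by
    have h0 : 0 < min ρ (mass R t₁ - mass R t) := lt_min hρ (sub_pos.2 hmm)
    refine ⟨min ρ (mass R t₁ - mass R t) / 2 / (1 + t₁), by positivity, ?_, ?_⟩
    · rw [div_mul_cancel₀ _ (by positivity)]
      linarith [min_le_left ρ (mass R t₁ - mass R t)]
    · rw [div_mul_cancel₀ _ (by positivity)]
      linarith [min_le_right ρ (mass R t₁ - mass R t)]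
  filter_upwards [whp_regular hC, whp_intensity hR hη, whp_clockSum hC (mass R t) hη,
    tendsto_fst_whp.eventually (eventually_gt_atTop 0)] with z hr hu hcl hn k hk hkt
  have hn0 : (0 : ℝ) < z.1 := by exact_mod_cast hn
  have hkn := (div_le_iff₀ hn0).1 hkt
  have hT := (Reveal.le_countBy_iff (hk.trans Reveal.finalCount_le)).1 hk
  -- If the `k`-th reveal came after `t₁`, at most `k` clocks would have to account for `mass R t₁`
  -- up to `η * t₁`. But they sum to less than `n * (mass R t + η)`.
  have hle : ((C z.1).revealTime k z.2).toReal ≤ t₁ := by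
    by_contra! hgt
    have hgt' : (t₁ : ℝ≥0∞) < (C z.1).revealTime k z.2 := by
      rw [← ENNReal.ofReal_coe_nnreal]
      exact (ENNReal.ofReal_lt_iff_lt_toReal t₁.coe_nonneg hT.2).2 hgt
    have h1 := Reveal.mass_le_clockSum hr hR.cont hu (hgt'.trans_le hT.1)
    have h2 : (C z.1).countBy z.2 t₁ + 1 ≤ k := by
      by_contra! h
      have h3 := (Reveal.le_countBy_iff (hk.trans Reveal.finalCount_le)).1 (Nat.lt_succ_iff.1 h)
      exact absurd h3.1 (not_le.2 hgt')
    have h2' : (((C z.1).countBy z.2 t₁ + 1 : ℕ) : ℝ) ≤ k := by exact_mod_cast h2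
    have h3 := (abs_lt.1 (hcl _ (h2'.trans hkn))).2
    have h4 := div_le_div_of_nonneg_right h2' hn0.le
    linarith
  refine ⟨hle, ?_⟩
  have h1 := Reveal.abs_clockSum_sub_mass_le hr hR.cont hu hk
  have h2 := hcl k hkn
  have h3 : η * ((C z.1).revealTime k z.2).toReal ≤ η * t₁ := by gcongr
  rw [abs_le] at h1 ⊢
  rw [abs_lt] at h2
  constructor <;> linarith [h1.1, h1.2, h2.1, h2.2]

-- A cascade still running at `t` has consumed intensity about `mass R t`. By the law of large
-- numbers for the clocks this takes at least `n * (mass R t - ρ)` reveals.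
include hC hR in
lemma whp_finalCount_of_lt_stopTime (t : ℝ≥0) {ρ : ℝ} (hρ : 0 < ρ) :
    ∀ᶠ z in whp P, (t : ℝ≥0∞) < (C z.1).stopTime z.2 →
      mass R t - ρ ≤ (C z.1).finalCount z.2 / (z.1 : ℝ) := by
  have ht := t.coe_nonneg
  obtain ⟨η, hη, hη1⟩ : ∃ η > 0, η * (1 + t) ≤ ρ / 2 :=
    ⟨ρ / 2 / (1 + t), by positivity, by rw [div_mul_cancel₀ _ (by positivity)]⟩
  have hone := (tendsto_one_div_atTop_nhds_zero_nat (𝕜 := ℝ)).eventually_lt_const (half_pos hρ)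
  filter_upwards [whp_regular hC, whp_intensity hR hη, whp_clockSum hC (mass R t) hη,
    tendsto_fst_whp.eventually (eventually_gt_atTop 0), tendsto_fst_whp.eventually hone]
    with z hr hu hcl hn hn1 hlt
  have hn0 : (0 : ℝ) < z.1 := by exact_mod_cast hn
  have h1 := Reveal.mass_le_clockSum hr hR.cont hu hlt
  have h2 : ((C z.1).countBy z.2 t : ℝ) ≤ (C z.1).finalCount z.2 := by
    exact Nat.cast_le.2 (Reveal.countBy_mono (C := C z.1) (ω := z.2) hlt.le)
  have h3 := div_le_div_of_nonneg_right h2 hn0.le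
  have h4 : (((C z.1).countBy z.2 t + 1 : ℕ) : ℝ) / z.1 =
      (C z.1).countBy z.2 t / (z.1 : ℝ) + 1 / z.1 := by push_cast; ring
  -- In the second case the count already exceeds `n * mass R t - 1`, and the clock estimate,
  -- available only up to `n * mass R t`, is not needed.
  rcases le_or_gt ((((C z.1).countBy z.2 t + 1 : ℕ) : ℝ)) (mass R t * z.1) with hle | hgt
  · have h5 := (abs_lt.1 (hcl _ hle)).2
    linarith
  · have h5 := (lt_div_iff₀ hn0).2 hgt
    linarith

end Time

open Classical in
/-- The number of agents of type `x` that are solvent after the `k`-th reveal. -/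
def Reveal.solventCount {X : Type*} {p : Params X} {n : ℕ} {ty : Fin n → X} {Ω : Type*}
    (C : Reveal p ty Ω) (x : X) (k : ℕ) (ω : Ω) : ℕ :=
  (Finset.univ.filter fun i => ty i = x ∧ i ∉ C.ruinedAfter ω k).card

section Count

variable {X : Type*} {p : Params X} {ty : ∀ n : ℕ, Fin n → X} {μ : X → ℝ} {lam : ℝ}
  (hnet : NetworkLimit p ty μ lam) {R : ℝ → ℝ}
  {Ω : ℕ → Type*} [∀ n, MeasurableSpace (Ω n)] {P : ∀ n, Measure (Ω n)}
  [∀ n, IsProbabilityMeasure (P n)] {C : ∀ n, Reveal p (ty n) (Ω n)}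
  (hC : ∀ n, IsLossReveal (P n) (C n)) (hR : IntensityLimit P C R)

include hC hR in
/-- The premiums accumulated at the reveals are close to the idealized ones. -/
lemma whp_premium (x : X) {t t₁ : ℝ≥0} (ht : t < t₁) {η : ℝ} (hη : 0 < η) :
    ∀ᶠ z in whp P, ∀ k ≤ (C z.1).finalCount z.2, (k : ℝ) / z.1 ≤ mass R t →
      |p.α x ((C z.1).revealTime k z.2).toReal - idealPrem p R t₁ z.1 x k| ≤ η := by
  obtain ⟨ρ, hρ, hmod⟩ := exists_prem_modulus hR.cont hR.pos p x t₁.coe_nonneg hη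
  filter_upwards [whp_revealTime hC hR ht hρ] with z hz k hk hkt
  obtain ⟨h1, h2⟩ := hz k hk hkt
  have hmm := mass_monoOn hR.cont hR.pos t.coe_nonneg t₁.coe_nonneg ht.le
  have h3 := massInv_spec hR.cont t₁.coe_nonneg (y := (k : ℝ) / z.1)
    ⟨by positivity, hkt.trans hmm⟩
  have h4 := hmod _ ⟨ENNReal.toReal_nonneg, h1⟩ _ h3.1 (by rwa [h3.2])
  rwa [prem_of_nonneg p x ENNReal.toReal_nonneg] at h4

-- The positive margin of the idealised count absorbs the error in the premiums. The estimate at `⌊n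
-- * mass R t⌋` serves all smaller `k` at once, because solvency only decreases.
include hnet hC hR in
lemma whp_solventCount_lower (x : X) {t : ℝ≥0} (ht : mass R t < lam) {ε : ℝ} (hε : 0 < ε) :
    ∀ᶠ z in whp P, ∀ k ≤ (C z.1).finalCount z.2, (k : ℝ) / z.1 ≤ mass R t →
      μ x * surviveProb p lam R x t - ε < (C z.1).solventCount x k z.2 / (z.1 : ℝ) := by
  obtain ⟨t₁, htt₁, ht₁⟩ := exists_gt_mass_lt hR.cont ht
  obtain ⟨η, hη, hideal⟩ := exists_idealCount_lower hnet hR.cont hR.pos ht₁ hC x htt₁ hε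
  filter_upwards [hideal, whp_premium hC hR x htt₁ hη,
    tendsto_fst_whp.eventually (eventually_gt_atTop 0)] with z hz hprem hn k hk hkt
  have hn0 : (0 : ℝ) < z.1 := by exact_mod_cast hn
  refine hz.trans_le (div_le_div_of_nonneg_right ?_ hn0.le)
  classical
  refine Nat.cast_le.2 (Finset.card_le_card fun i hi => ?_)
  simp only [Finset.mem_filter, Finset.mem_univ, true_and] at hi ⊢
  refine ⟨hi.1, ?_⟩
  simp only [Reveal.ruinedAfter, Set.mem_ofPred_eq, not_not]
  refine hi.2.transfer hη.le (fun _ _ => Iff.rfl) ?_ ?_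
  · intro j hj
    refine hj.trans (Nat.le_floor ?_)
    rw [mul_comm]
    exact (div_le_iff₀ hn0).1 hkt
  · intro j hj
    have h1 : (((C z.1).rank z.2 ⟨i, j⟩ : ℕ) : ℝ) / z.1 ≤ mass R t :=
      (div_le_div_of_nonneg_right (Nat.cast_le.2 hj) hn0.le).trans hkt
    have h2 := hprem _ (hj.trans hk) h1
    rw [← hi.1] at h2
    have := neg_le_of_abs_le h2
    have hr : (((C z.1).hits z.2).symm ⟨i, j⟩ : ℕ) + 1 = (C z.1).rank z.2 ⟨i, j⟩ := rfl
    rw [hr]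
    linarith

-- Agents solvent after `k` reveals were solvent after `⌈n * mass R t⌉ ≤ k` reveals. Replacing the
-- actual premiums by the idealised ones then costs at most the negative margin.
include hnet hC hR in
lemma whp_solventCount_upper (x : X) {t : ℝ≥0} (ht : mass R t < lam) {ε : ℝ} (hε : 0 < ε) :
    ∀ᶠ z in whp P, ∀ k ≤ (C z.1).finalCount z.2, mass R t ≤ (k : ℝ) / z.1 →
      (C z.1).solventCount x k z.2 / (z.1 : ℝ) < μ x * surviveProb p lam R x t + ε := by
  obtain ⟨t₂, htt₂, ht₂⟩ := exists_gt_mass_lt hR.cont ht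
  obtain ⟨t₁, ht₂₁, ht₁⟩ := exists_gt_mass_lt hR.cont ht₂
  obtain ⟨η, hη, hideal⟩ := exists_idealCount_upper hnet hR.cont hR.pos ht₁ hC x
    (htt₂.trans ht₂₁) hε
  have hmm : mass R t < mass R t₂ :=
    mass_strictMonoOn hR.cont hR.pos t.coe_nonneg t₂.coe_nonneg htt₂
  have hone := (tendsto_one_div_atTop_nhds_zero_nat (𝕜 := ℝ)).eventually_lt_const (sub_pos.2 hmm)
  filter_upwards [hideal, whp_premium hC hR x ht₂₁ hη,
    tendsto_fst_whp.eventually (eventually_gt_atTop 0), tendsto_fst_whp.eventually hone]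
    with z hz hprem hn hn1 k hk hkt
  have hn0 : (0 : ℝ) < z.1 := by exact_mod_cast hn
  have hm0 := mass_nonneg hR.cont hR.pos t.coe_nonneg
  set k₀ := ⌈z.1 * mass R t⌉₊ with hk₀
  have hk₀k : k₀ ≤ k := by
    refine Nat.ceil_le.2 ?_
    rw [mul_comm]
    exact (le_div_iff₀ hn0).1 hkt
  -- Rounding up may push `k₀ / n` above `mass R t` by up to `1 / n`; the intermediate time `t₂`
  -- provides room for this.
  have hk₀t : (k₀ : ℝ) / z.1 ≤ mass R t₂ := by
    have h1 := (Nat.ceil_lt_add_one (mul_nonneg hn0.le hm0)).le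
    have h2 := div_le_div_of_nonneg_right h1 hn0.le
    rw [add_div, mul_div_cancel_left₀ _ hn0.ne'] at h2
    linarith
  refine lt_of_le_of_lt (div_le_div_of_nonneg_right ?_ hn0.le) hz
  classical
  refine Nat.cast_le.2 (Finset.card_le_card fun i hi => ?_)
  simp only [Finset.mem_filter, Finset.mem_univ, true_and] at hi ⊢
  refine ⟨hi.1, ?_⟩
  have h0 := hi.2
  simp only [Reveal.ruinedAfter, Set.mem_ofPred_eq, not_not] at h0
  refine (h0.mono le_rfl hk₀k).transfer (by linarith) (fun _ _ => Iff.rfl) (fun j hj => hj) ?_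
  intro j hj
  have hj' : (C z.1).rank z.2 ⟨i, j⟩ ≤ k₀ := hj
  have h1 : (((C z.1).rank z.2 ⟨i, j⟩ : ℕ) : ℝ) / z.1 ≤ mass R t₂ :=
    (div_le_div_of_nonneg_right (Nat.cast_le.2 hj') hn0.le).trans hk₀t
  have h2 := hprem _ ((hj'.trans hk₀k).trans hk) h1
  rw [← hi.1] at h2
  have := le_of_abs_le h2
  have hr : (((C z.1).hits z.2).symm ⟨i, j⟩ : ℕ) + 1 = (C z.1).rank z.2 ⟨i, j⟩ := rfl
  rw [hr]
  linarith

end Count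

end RuinNetwork

namespace RuinNetwork

/-! ### Sums over all types -/

/-- The empirical mean of a nonnegative function of the type converges to its limiting mean. -/
structure MeanLimit {X : Type*} (ty : ∀ n : ℕ, Fin n → X) (μ : X → ℝ) (w : X → ℝ) (Λ : ℝ) :
    Prop where
  nonneg : ∀ x, 0 ≤ w x
  hasSum : HasSum (fun x => μ x * w x) Λ
  tendsto : Tendsto (fun n => (∑ i, w (ty n i)) / n) atTop (𝓝 Λ)

open Classical in
lemma sum_by_type {X : Type*} {n : ℕ} (ty : Fin n → X) (w : X → ℝ) (A : Finset (Fin n))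
    (F : Finset X) :
    ∑ i ∈ A, w (ty i) = ∑ x ∈ F, w x * (A.filter fun i => ty i = x).card +
      ∑ i ∈ A with ty i ∉ F, w (ty i) := by
  rw [← Finset.sum_filter_add_sum_filter_not A (fun i => ty i ∈ F)]
  congr 1
  rw [← Finset.sum_fiberwise_of_maps_to (s := A.filter fun i => ty i ∈ F) (t := F) (g := ty)
    (fun i hi => (Finset.mem_filter.1 hi).2)]
  refine Finset.sum_congr rfl fun x hx => ?_
  rw [Finset.filter_filter]
  have : (A.filter fun i => ty i ∈ F ∧ ty i = x) = A.filter fun i => ty i = x := by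
    refine Finset.filter_congr fun i _ => ?_
    constructor
    · exact fun h => h.2
    · exact fun h => ⟨h ▸ hx, h⟩
  rw [this, Finset.sum_congr rfl (g := fun _ => w x) fun i hi => by rw [(Finset.mem_filter.1 hi).2],
    Finset.sum_const, nsmul_eq_mul, mul_comm]

section Tail

variable {X : Type*} {p : Params X} {ty : ∀ n : ℕ, Fin n → X} {μ : X → ℝ} {lam : ℝ}
  (hnet : NetworkLimit p ty μ lam) {w : X → ℝ} {Λ : ℝ} (hw : MeanLimit ty μ w Λ)

include hnet in
lemma NetworkLimit.meanLimit_outDeg : MeanLimit ty μ (fun x => (p.outDeg x : ℝ)) lam where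
  nonneg _ := Nat.cast_nonneg _
  hasSum := hnet.mean_out
  tendsto := by
    have h := hnet.mean_tendsto
    refine h.congr fun n => ?_
    have := hnet.balanced n
    rw [← Nat.cast_sum, ← Nat.cast_sum, this]

include hnet in
lemma NetworkLimit.meanLimit_one : MeanLimit ty μ (fun _ => 1) 1 where
  nonneg _ := zero_le_one
  hasSum := by simpa using hnet.μ_sum
  tendsto := by
    refine tendsto_const_nhds.congr' ?_
    filter_upwards [eventually_gt_atTop 0] with n hn
    have hn0 : (n : ℝ) ≠ 0 := by positivity
    simp [hn0]

-- No mass escapes to infinity: the empirical tail is the full mean minus a finite sum over `F`.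
-- Both converge, so the tail converges to the limiting tail, which is small for large `F`.
include hnet hw in
open Classical in
lemma exists_tail {ε : ℝ} (hε : 0 < ε) : ∃ F : Finset X, Λ - ∑ x ∈ F, μ x * w x < ε ∧
    ∀ᶠ n in atTop, (∑ i with ty n i ∉ F, w (ty n i)) / n < ε := by
  have h := hw.hasSum
  obtain ⟨F, hF⟩ := (h.eventually_const_lt (show Λ - ε < Λ by linarith)).exists
  refine ⟨F, by linarith, ?_⟩
  have hlim : Tendsto (fun n => (∑ i, w (ty n i)) / n - ∑ x ∈ F, w x * typeFraction (ty n) x) atTop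
      (𝓝 (Λ - ∑ x ∈ F, w x * μ x)) :=
    hw.tendsto.sub (tendsto_finsetSum _ fun x _ => (hnet.fraction x).const_mul (w x))
  have hF' : Λ - ∑ x ∈ F, w x * μ x < ε := by
    simp_rw [mul_comm (w _)]; linarith
  filter_upwards [hlim.eventually_lt_const hF'] with n hn
  refine lt_of_eq_of_lt ?_ hn
  rw [sum_by_type (ty n) w Finset.univ F, add_div, Finset.sum_div F]
  simp only [typeFraction_eq, mul_div_assoc, add_sub_cancel_left]

end Tail

open Classical in
/-- The total weight of the agents that are solvent after the `k`-th reveal. -/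
def Reveal.solventSum {X : Type*} {p : Params X} {n : ℕ} {ty : Fin n → X} {Ω : Type*}
    (C : Reveal p ty Ω) (w : X → ℝ) (k : ℕ) (ω : Ω) : ℝ :=
  ∑ i with i ∉ C.ruinedAfter ω k, w (ty i)

open Classical in
lemma Reveal.solventSum_eq {X : Type*} {p : Params X} {n : ℕ} {ty : Fin n → X} {Ω : Type*}
    (C : Reveal p ty Ω) (w : X → ℝ) (k : ℕ) (ω : Ω) (F : Finset X) :
    C.solventSum w k ω = ∑ x ∈ F, w x * C.solventCount x k ω +
      ∑ i with i ∉ C.ruinedAfter ω k ∧ ty i ∉ F, w (ty i) := by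
  rw [Reveal.solventSum, sum_by_type ty w _ F, Finset.filter_filter]
  congr 1
  refine Finset.sum_congr rfl fun x _ => ?_
  rw [Reveal.solventCount, Finset.filter_filter]
  simp_rw [and_comm]

section Sums

variable {X : Type*} {p : Params X} {ty : ∀ n : ℕ, Fin n → X} {μ : X → ℝ} {lam : ℝ}
  (hnet : NetworkLimit p ty μ lam)
  {Ω : ℕ → Type*} [∀ n, MeasurableSpace (Ω n)] {P : ∀ n, Measure (Ω n)}
  {C : ∀ n, Reveal p (ty n) (Ω n)} {w : X → ℝ} {Λ : ℝ} (hw : MeanLimit ty μ w Λ)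
  {g : X → ℝ} (hg : ∀ x, g x ∈ Set.Icc (0 : ℝ) 1) {Q : (Σ n, Ω n) → ℕ → Prop}

include hnet hw hg in
lemma NetworkLimit.summable_mul : Summable fun x => μ x * w x * g x :=
  Summable.of_nonneg_of_le
    (fun x => mul_nonneg (mul_nonneg (hnet.μ_nonneg x) (hw.nonneg x)) (hg x).1)
    (fun x => mul_le_of_le_one_right (mul_nonneg (hnet.μ_nonneg x) (hw.nonneg x)) (hg x).2)
    hw.hasSum.summable

-- Types outside a large finite set are discarded, which only decreases the left-hand solvent
-- weight. The error `e` per type is scaled by the total weight of `F`. `Q` selects the reveals at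
-- which the estimate is wanted, so uniformity in `k` is kept.
include hnet hw hg in
lemma whp_solventSum_lower (h : ∀ x, ∀ ε > 0, ∀ᶠ z in whp P, ∀ k, Q z k →
      μ x * g x - ε < (C z.1).solventCount x k z.2 / (z.1 : ℝ)) {ε : ℝ} (hε : 0 < ε) :
    ∀ᶠ z in whp P, ∀ k, Q z k →
      ∑' x, μ x * w x * g x - ε < (C z.1).solventSum w k z.2 / (z.1 : ℝ) := by
  obtain ⟨F, hF, -⟩ := exists_tail hnet hw (half_pos hε)
  have hWF : 0 ≤ ∑ x ∈ F, w x := Finset.sum_nonneg fun x _ => hw.nonneg x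
  obtain ⟨e, he, hesum⟩ : ∃ e > 0, e * (1 + ∑ x ∈ F, w x) ≤ ε / 2 :=
    ⟨ε / 2 / (1 + ∑ x ∈ F, w x), by positivity, by rw [div_mul_cancel₀ _ (by positivity)]⟩
  have hall : ∀ᶠ z in whp P, ∀ x ∈ F, ∀ k, Q z k →
      μ x * g x - e < (C z.1).solventCount x k z.2 / (z.1 : ℝ) := by
    rw [Filter.eventually_all_finset]
    exact fun x _ => h x e he
  filter_upwards [hall] with z hz k hk
  have hsum := hnet.summable_mul hw hg
  have htail : ∑' x, μ x * w x * g x - ∑ x ∈ F, μ x * w x * g x ≤ Λ - ∑ x ∈ F, μ x * w x := by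
    have h1 := (hw.hasSum.sub hsum.hasSum).summable.sum_le_tsum F fun x _ => by
      have := mul_le_of_le_one_right (mul_nonneg (hnet.μ_nonneg x) (hw.nonneg x)) (hg x).2
      exact sub_nonneg.2 this
    rw [(hw.hasSum.sub hsum.hasSum).tsum_eq, Finset.sum_sub_distrib] at h1
    linarith
  have hle : ∑ x ∈ F, w x * (μ x * g x - e) ≤ (C z.1).solventSum w k z.2 / (z.1 : ℝ) := by
    classical
    rw [Reveal.solventSum_eq _ _ _ _ F, add_div, Finset.sum_div]
    refine le_add_of_le_of_nonneg (Finset.sum_le_sum fun x hx => ?_)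
      (div_nonneg (Finset.sum_nonneg fun i _ => hw.nonneg _) (Nat.cast_nonneg _))
    rw [mul_div_assoc]
    exact mul_le_mul_of_nonneg_left (hz x hx k hk).le (hw.nonneg x)
  have heq : ∑ x ∈ F, w x * (μ x * g x - e) =
      ∑ x ∈ F, μ x * w x * g x - e * ∑ x ∈ F, w x := by
    rw [Finset.mul_sum, ← Finset.sum_sub_distrib]
    exact Finset.sum_congr rfl fun x _ => by ring
  linarith

-- In contrast to the lower bound, the types outside `F` must be bounded; all agents of these types
-- are counted as solvent and controlled by `exists_tail`.
include hnet hw hg in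
lemma whp_solventSum_upper (h : ∀ x, ∀ ε > 0, ∀ᶠ z in whp P, ∀ k, Q z k →
      (C z.1).solventCount x k z.2 / (z.1 : ℝ) < μ x * g x + ε) {ε : ℝ} (hε : 0 < ε) :
    ∀ᶠ z in whp P, ∀ k, Q z k →
      (C z.1).solventSum w k z.2 / (z.1 : ℝ) < ∑' x, μ x * w x * g x + ε := by
  classical
  obtain ⟨F, -, hF⟩ := exists_tail hnet hw (half_pos hε)
  have hWF : 0 ≤ ∑ x ∈ F, w x := Finset.sum_nonneg fun x _ => hw.nonneg x
  obtain ⟨e, he, hesum⟩ : ∃ e > 0, e * (1 + ∑ x ∈ F, w x) ≤ ε / 2 :=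
    ⟨ε / 2 / (1 + ∑ x ∈ F, w x), by positivity, by rw [div_mul_cancel₀ _ (by positivity)]⟩
  have hall : ∀ᶠ z in whp P, ∀ x ∈ F, ∀ k, Q z k →
      (C z.1).solventCount x k z.2 / (z.1 : ℝ) < μ x * g x + e := by
    rw [Filter.eventually_all_finset]
    exact fun x _ => h x e he
  filter_upwards [hall, tendsto_fst_whp.eventually hF] with z hz htail k hk
  have hsum := hnet.summable_mul hw hg
  have h1 := hsum.sum_le_tsum F fun x _ =>
    mul_nonneg (mul_nonneg (hnet.μ_nonneg x) (hw.nonneg x)) (hg x).1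
  have hle : (C z.1).solventSum w k z.2 / (z.1 : ℝ) ≤ ∑ x ∈ F, w x * (μ x * g x + e) +
      (∑ i with ty z.1 i ∉ F, w (ty z.1 i)) / (z.1 : ℝ) := by
    rw [Reveal.solventSum_eq _ _ _ _ F, add_div, Finset.sum_div]
    refine add_le_add (Finset.sum_le_sum fun x hx => ?_) ?_
    · rw [mul_div_assoc]
      exact mul_le_mul_of_nonneg_left (hz x hx k hk).le (hw.nonneg x)
    · refine div_le_div_of_nonneg_right ?_ (Nat.cast_nonneg _)
      refine Finset.sum_le_sum_of_subset_of_nonneg (fun i hi => ?_) fun i _ _ => hw.nonneg _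
      simp only [Finset.mem_filter, Finset.mem_univ, true_and] at hi ⊢
      exact hi.2
  have heq : ∑ x ∈ F, w x * (μ x * g x + e) =
      ∑ x ∈ F, μ x * w x * g x + e * ∑ x ∈ F, w x := by
    rw [Finset.mul_sum, ← Finset.sum_add_distrib]
    exact Finset.sum_congr rfl fun x _ => by ring
  linarith

end Sums

/-! ### From solvent counts to ruined fractions. -/

section Conclusion

variable {X : Type*} {p : Params X}

lemma Reveal.finalRuinedOf_eq_sub {n : ℕ} {ty : Fin n → X} {Ω : Type*} {C : Reveal p ty Ω} {ω : Ω}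
    (hr : C.Regular ω) (x : X) : (C.finalRuinedOf x ω : ℝ) =
      n * typeFraction ty x - C.solventCount x (C.finalCount ω) ω := by
  classical
  rcases Nat.eq_zero_or_pos n with rfl | hn
  · rw [finalRuinedOf_eq hr, solventCount]
    simp [Set.eq_empty_of_isEmpty]
  have hn0 : (n : ℝ) ≠ 0 := by positivity
  have h := Finset.card_filter_add_card_filter_not (s := Finset.univ.filter fun i => ty i = x)
    (fun i => i ∈ C.ruinedAfter ω (C.finalCount ω))
  rw [Finset.filter_filter, Finset.filter_filter] at h
  have h2 : C.finalRuinedOf x ω = (Finset.univ.filter fun i =>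
      ty i = x ∧ i ∈ C.ruinedAfter ω (C.finalCount ω)).card := by
    rw [finalRuinedOf_eq hr, ← Set.ncard_coe_finset]
    congr 1
    ext i
    simp [and_comm]
  rw [typeFraction_eq, mul_div_cancel₀ _ hn0, ← h, h2, solventCount]
  push_cast
  ring

lemma Reveal.finalRuined_eq_sub {n : ℕ} {ty : Fin n → X} {Ω : Type*} {C : Reveal p ty Ω} {ω : Ω}
    (hr : C.Regular ω) : (C.finalRuined ω : ℝ) =
      n - C.solventSum (fun _ => 1) (C.finalCount ω) ω := by
  classical
  have h := Finset.card_filter_add_card_filter_not (s := (Finset.univ : Finset (Fin n)))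
    (fun i => i ∈ C.ruinedAfter ω (C.finalCount ω))
  rw [Finset.card_univ, Fintype.card_fin] at h
  have h2 : C.finalRuined ω = (Finset.univ.filter fun i =>
      i ∈ C.ruinedAfter ω (C.finalCount ω)).card := by
    rw [finalRuined_eq hr, ← Set.ncard_coe_finset]
    congr 1
    ext i
    simp
  rw [h2, solventSum, Finset.sum_const, nsmul_eq_mul, mul_one, eq_sub_iff_add_eq]
  exact_mod_cast h

variable {ty : ∀ n : ℕ, Fin n → X} {μ : X → ℝ} {lam : ℝ}
  (hnet : NetworkLimit p ty μ lam)
  {Ω : ℕ → Type*} [∀ n, MeasurableSpace (Ω n)] {P : ∀ n, Measure (Ω n)}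
  {C : ∀ n, Reveal p (ty n) (Ω n)} (hC : ∀ n, IsLossReveal (P n) (C n))
  {g : X → ℝ} (hg : ∀ x, g x ∈ Set.Icc (0 : ℝ) 1)

include hnet hC hg in
/-- The ruined fractions are determined by the final numbers of solvent agents of each type. -/
lemma convInProb_ruined
    (hlow : ∀ x, ∀ ε > 0, ∀ᶠ z in whp P, μ x * g x - ε <
      (C z.1).solventCount x ((C z.1).finalCount z.2) z.2 / (z.1 : ℝ))
    (hup : ∀ x, ∀ ε > 0, ∀ᶠ z in whp P,
      (C z.1).solventCount x ((C z.1).finalCount z.2) z.2 / (z.1 : ℝ) < μ x * g x + ε) :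
    (∀ x, 0 < μ x → ConvInProb P
      (fun n ω => ((C n).finalRuinedOf x ω : ℝ) / (n * typeFraction (ty n) x)) (1 - g x)) ∧
    ConvInProb P (fun n ω => ((C n).finalRuined ω : ℝ) / n) (∑' x, μ x * (1 - g x)) := by
  constructor
  · intro x hx
    rw [convInProb_iff]
    intro η hη
    set Y : (Σ n, Ω n) → ℝ := fun z =>
      (C z.1).solventCount x ((C z.1).finalCount z.2) z.2 / (z.1 : ℝ) with hY
    have hYlim : Tendsto Y (whp P) (𝓝 (μ x * g x)) := by
      rw [Metric.tendsto_nhds]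
      intro ε hε
      filter_upwards [hlow x ε hε, hup x ε hε] with z h1 h2
      rw [Real.dist_eq, abs_lt]
      constructor <;> linarith
    have hT : Tendsto (fun z : Σ n, Ω n => typeFraction (ty z.1) x) (whp P) (𝓝 (μ x)) :=
      (hnet.fraction x).comp tendsto_fst_whp
    have hlim := (hYlim.div hT hx.ne').const_sub 1
    rw [mul_div_cancel_left₀ _ hx.ne'] at hlim
    filter_upwards [Metric.tendsto_nhds.1 hlim η hη, whp_regular hC,
      hT.eventually_const_lt hx, tendsto_fst_whp.eventually (eventually_gt_atTop 0)]
      with z hz hr hpos hn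
    rw [Real.dist_eq] at hz
    have hn0 : (z.1 : ℝ) ≠ 0 := by positivity
    rw [Reveal.finalRuinedOf_eq_sub hr, sub_div, div_self (mul_ne_zero hn0 hpos.ne'), ← div_div]
    exact hz
  · rw [convInProb_iff]
    intro η hη
    have hone := hnet.meanLimit_one
    have h1 := whp_solventSum_lower hnet hone hg (P := P) (C := C)
      (Q := fun z k => k = (C z.1).finalCount z.2)
      (fun x ε hε => by filter_upwards [hlow x ε hε] with z hz k hk; rwa [hk]) hη
    have h2 := whp_solventSum_upper hnet hone hg (P := P) (C := C)
      (Q := fun z k => k = (C z.1).finalCount z.2)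
      (fun x ε hε => by filter_upwards [hup x ε hε] with z hz k hk; rwa [hk]) hη
    have hsum := hnet.summable_mul hone hg
    simp only [mul_one] at hsum
    have htot : ∑' x, μ x * (1 - g x) = 1 - ∑' x, μ x * 1 * g x := by
      simp only [mul_sub, mul_one]
      exact (hnet.μ_sum.sub hsum.hasSum).tsum_eq
    filter_upwards [h1, h2, whp_regular hC, tendsto_fst_whp.eventually (eventually_gt_atTop 0)]
      with z hz1 hz2 hr hn
    have hn0 : (z.1 : ℝ) ≠ 0 := by positivity
    rw [Reveal.finalRuined_eq_sub hr, sub_div, div_self hn0, htot, abs_lt]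
    have h3 := hz1 _ rfl
    have h4 := hz2 _ rfl
    constructor <;> linarith

end Conclusion

end RuinNetwork

namespace RuinNetwork

/-! ### The limiting fraction of unrevealed ruinous half-edges -/

section Drift

variable {X : Type*} {p : Params X} {lam : ℝ} {R : ℝ → ℝ} (hc : ContinuousOn R (Set.Ici 0))
  (hp : ∀ t, 0 ≤ t → 0 < R t)

include hc in
lemma continuous_mass : Continuous fun t : ℝ≥0 => mass R t :=
  (mass_continuousOn hc).comp_continuous NNReal.continuous_coe fun t => t.coe_nonneg

include hc hp in
lemma mass_le_iff {s t : ℝ≥0} : mass R s ≤ mass R t ↔ s ≤ t :=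
  (mass_strictMonoOn hc hp).le_iff_le s.coe_nonneg t.coe_nonneg

include hc hp in
lemma mass_lt_iff {s t : ℝ≥0} : mass R s < mass R t ↔ s < t :=
  (mass_strictMonoOn hc hp).lt_iff_lt s.coe_nonneg t.coe_nonneg

include hc in
lemma exists_mass_eq {t : ℝ≥0} {y : ℝ} (hy : y ∈ Set.Icc 0 (mass R t)) :
    ∃ s ≤ t, mass R s = y := by
  obtain ⟨h1, h2⟩ := massInv_spec hc t.coe_nonneg hy
  lift massInv R t y to ℝ≥0 using h1.1 with s
  exact ⟨s, h1.2, h2⟩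

-- `surviveProb_sub_le` is a Lipschitz estimate in terms of `mass R`, which is continuous.
include hc hp in
lemma continuousOn_surviveProb (x : X) (hl : 0 < lam) :
    ContinuousOn (fun t : ℝ≥0 => surviveProb p lam R x t) {t | mass R t < lam} := by
  have habs : ∀ s t : ℝ≥0, mass R s < lam → mass R t < lam →
      |surviveProb p lam R x s - surviveProb p lam R x t| ≤
        p.inDeg x * (|mass R s - mass R t| / lam) := by
    have key : ∀ s t : ℝ≥0, s ≤ t → mass R t < lam →
      |surviveProb p lam R x s - surviveProb p lam R x t| ≤
        p.inDeg x * (|mass R s - mass R t| / lam) := by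
      intro s t hst ht
      have hm := (mass_le_iff hc hp).2 hst
      rw [abs_of_nonneg (sub_nonneg.2 (surviveProb_anti p x hc hp hl hst ht)), abs_sub_comm,
        abs_of_nonneg (sub_nonneg.2 hm)]
      exact surviveProb_sub_le p x hc hp hl hst ht
    intro s t hs ht
    rcases le_total s t with h | h
    · exact key s t h ht
    · rw [abs_sub_comm, abs_sub_comm (mass R s)]
      exact key t s h hs
  intro t ht
  rw [ContinuousWithinAt, tendsto_iff_dist_tendsto_zero]
  have hlim : Tendsto (fun s : ℝ≥0 => p.inDeg x * (|mass R s - mass R t| / lam))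
      (𝓝[{t : ℝ≥0 | mass R t < lam}] t) (𝓝 0) := by
    have hcont : Continuous fun s : ℝ≥0 => p.inDeg x * (|mass R s - mass R t| / lam) := by
      have := continuous_mass hc
      fun_prop
    have := (hcont.tendsto t).mono_left (nhdsWithin_le_nhds (s := {t : ℝ≥0 | mass R t < lam}))
    simpa using this
  refine squeeze_zero' (Filter.Eventually.of_forall fun _ => dist_nonneg) ?_ hlim
  filter_upwards [self_mem_nhdsWithin] with s hs
  exact habs s t hs ht

variable {ty : ∀ n : ℕ, Fin n → X} {μ : X → ℝ} (hnet : NetworkLimit p ty μ lam)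

include hc hp in
lemma fW_eq (hl : 0 < lam) {t : ℝ≥0} (ht : mass R t < lam) : fW p μ lam R t =
    lam - mass R t - ∑' x, μ x * (p.outDeg x : ℝ) * surviveProb p lam R x t := by
  rw [fW]
  have : lam * (1 - phi lam R t) = lam - mass R t := by
    rw [phi_eq hc hp ht]
    field_simp
  rw [this]
  rfl

-- Each term of the series is dominated by `μ x * outDeg x`, which is summable, so the series
-- converges uniformly.
include hc hp hnet in
lemma continuousOn_fW : ContinuousOn (fW p μ lam R) {t | mass R t < lam} := by
  have hl := hnet.lam_pos
  refine ContinuousOn.congr ?_ fun t ht => fW_eq hc hp hl ht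
  refine (continuousOn_const.sub (continuous_mass hc).continuousOn).sub ?_
  refine continuousOn_tsum (u := fun x => μ x * (p.outDeg x : ℝ))
    (fun x => (continuousOn_surviveProb hc hp x hl).const_mul _) hnet.mean_out.summable ?_
  intro x t ht
  have hG := surviveProb_mem p x hc hp hl ht
  have h0 : 0 ≤ μ x * (p.outDeg x : ℝ) := mul_nonneg (hnet.μ_nonneg x) (Nat.cast_nonneg _)
  rw [Real.norm_of_nonneg (mul_nonneg h0 hG.1)]
  exact mul_le_of_le_one_right h0 hG.2

include hc hp hnet in
lemma fW_zero_nonneg : 0 ≤ fW p μ lam R 0 := by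
  have hl := hnet.lam_pos
  have h0 : mass R ((0 : ℝ≥0) : ℝ) < lam := by rw [NNReal.coe_zero, mass_zero]; exact hl
  rw [fW_eq hc hp hl h0, NNReal.coe_zero, mass_zero, sub_zero, sub_nonneg]
  have hg := fun x => surviveProb_mem p x hc hp hl h0
  refine le_of_le_of_eq ?_ hnet.mean_out.tsum_eq
  exact (hnet.summable_mul hnet.meanLimit_outDeg hg).tsum_le_tsum (fun x =>
    mul_le_of_le_one_right (mul_nonneg (hnet.μ_nonneg x) (Nat.cast_nonneg _)) (hg x).2)
    hnet.mean_out.summable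

-- `fW` is nonnegative at `0` and continuous. A nonpositive value at `t` would force a zero in `[0,
-- t]`, contradicting `t < tStar`.
include hc hp hnet in
lemma fW_pos {t : ℝ≥0} (ht : mass R t < lam) (hts : (t : ℝ≥0∞) < tStar p μ lam R) :
    0 < fW p μ lam R t := by
  by_contra! hneg
  have hcont : ContinuousOn (fW p μ lam R) (Set.Icc 0 t) := (continuousOn_fW hc hp hnet).mono
    fun s hs => ((mass_le_iff hc hp).2 hs.2).trans_lt ht
  obtain ⟨s, hs, hs0⟩ := intermediate_value_Icc' (zero_le (a := t)) hcont
    ⟨hneg, fW_zero_nonneg hc hp hnet⟩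
  have h1 : tStar p μ lam R ≤ s := iInf₂_le s hs0
  exact absurd (h1.trans (ENNReal.coe_le_coe.2 hs.2)) (not_le.2 hts)

end Drift

/-! ### The length of the cascade -/

section Length

variable {X : Type*} {p : Params X}

lemma Reveal.sum_ruined_eq {n : ℕ} {ty : Fin n → X} {Ω : Type*} (C : Reveal p ty Ω) (ω : Ω)
    (k : ℕ) [DecidablePred (· ∈ C.ruinedAfter ω k)] :
    ((∑ i with i ∈ C.ruinedAfter ω k, p.outDeg (ty i) : ℕ) : ℝ) =
      numLinks p ty - C.solventSum (fun x => (p.outDeg x : ℝ)) k ω := by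
  classical
  have h := Finset.sum_filter_add_sum_filter_not Finset.univ
    (fun i => i ∈ C.ruinedAfter ω k) (fun i => (p.outDeg (ty i) : ℝ))
  rw [Reveal.solventSum, eq_sub_iff_add_eq, numLinks]
  push_cast
  rw [← h]
  congr!

lemma Reveal.solventSum_le {n : ℕ} {ty : Fin n → X} {Ω : Type*} {C : Reveal p ty Ω} {ω : Ω}
    (hr : C.Regular ω) {k : ℕ} (hk : k ≤ C.finalCount ω) :
    C.solventSum (fun x => (p.outDeg x : ℝ)) k ω ≤ numLinks p ty - k := by
  classical
  have h := C.sum_ruined_eq ω k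
  have h2 : (k : ℝ) ≤ ((∑ i with i ∈ C.ruinedAfter ω k, p.outDeg (ty i) : ℕ) : ℝ) := by
    have := le_sum_outDeg hr hk
    exact_mod_cast (by convert this : k ≤ ∑ i with i ∈ C.ruinedAfter ω k, p.outDeg (ty i))
  linarith

lemma Reveal.le_solventSum {n : ℕ} {ty : Fin n → X} {Ω : Type*} {C : Reveal p ty Ω} {ω : Ω}
    (hr : C.Regular ω) (hs : C.stopTime ω ≠ ⊤) :
    numLinks p ty - (C.finalCount ω : ℝ) ≤
      C.solventSum (fun x => (p.outDeg x : ℝ)) (C.finalCount ω) ω := by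
  classical
  have h := C.sum_ruined_eq ω (C.finalCount ω)
  have h2 : ((∑ i with i ∈ C.ruinedAfter ω (C.finalCount ω), p.outDeg (ty i) : ℕ) : ℝ) ≤
      C.finalCount ω := by
    have := sum_outDeg_le hr hs
    exact_mod_cast (by convert this :
      ∑ i with i ∈ C.ruinedAfter ω (C.finalCount ω), p.outDeg (ty i) ≤ C.finalCount ω)
  linarith

variable {ty : ∀ n : ℕ, Fin n → X} {μ : X → ℝ} {lam : ℝ} (hnet : NetworkLimit p ty μ lam)
  {R : ℝ → ℝ} {Ω : ℕ → Type*} [∀ n, MeasurableSpace (Ω n)] {P : ∀ n, Measure (Ω n)}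
  [∀ n, IsProbabilityMeasure (P n)] {C : ∀ n, Reveal p (ty n) (Ω n)}
  (hC : ∀ n, IsLossReveal (P n) (C n)) (hR : IntensityLimit P C R)

include hnet in
lemma NetworkLimit.tendsto_numLinks :
    Tendsto (fun n : ℕ => (numLinks p (ty n) : ℝ) / n) atTop (𝓝 lam) := by
  have h := hnet.meanLimit_outDeg.tendsto
  refine h.congr fun n => ?_
  rw [numLinks]
  push_cast
  rfl

-- The local form of the statement that the cascade does not stop where `fW > 0`. It is stated on
-- neighbourhoods so that compactness of `[0, t]` gives a uniform version.
include hnet hC hR in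
lemma whp_finalCount_ne {t : ℝ≥0} (ht : mass R t < lam)
    (hts : (t : ℝ≥0∞) < tStar p μ lam R) {a : ℝ≥0} (ha : a ∈ Set.Icc 0 t) :
    ∃ A ∈ 𝓝[Set.Icc 0 t] a, ∀ᶠ z in whp P, (C z.1).stopTime z.2 ≠ ⊤ → ∀ a ∈ A,
      mass R a ≠ (C z.1).finalCount z.2 / (z.1 : ℝ) := by
  have hl := hnet.lam_pos
  have hm : ∀ b ∈ Set.Icc 0 t, mass R b < lam := fun b hb =>
    ((mass_le_iff hR.cont hR.pos).2 hb.2).trans_lt ht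
  have hfa : 0 < fW p μ lam R a := fW_pos hR.cont hR.pos hnet (hm a ha)
    ((ENNReal.coe_le_coe.2 ha.2).trans_lt hts)
  set c := fW p μ lam R a / 2 with hcdef
  have hc0 : 0 < c := half_pos hfa
  have h1 : ∀ᶠ b in 𝓝[Set.Icc 0 t] a, c < fW p μ lam R b :=
    ((continuousOn_fW hR.cont hR.pos hnet).mono hm a ha).eventually_const_lt (by linarith)
  have h2 : ∀ᶠ b : ℝ≥0 in 𝓝[Set.Icc 0 t] a, |mass R b - mass R a| < c / 4 := by
    have := (continuous_mass hR.cont).continuousWithinAt (s := Set.Icc 0 t) (x := a)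
    have := Metric.tendsto_nhds.1 this (c / 4) (by positivity)
    simpa only [Real.dist_eq] using this
  have h12 := h1.and h2
  rw [Filter.Eventually, Metric.mem_nhdsWithin_iff] at h12
  obtain ⟨δ, hδ, hball⟩ := h12
  lift δ to ℝ≥0 using hδ.le
  have hδ2 : (0 : ℝ) < δ / 2 := by positivity
  refine ⟨Metric.ball a (δ / 2) ∩ Set.Icc 0 t, Filter.inter_mem (mem_nhdsWithin_of_mem_nhds (Metric.ball_mem_nhds a hδ2))
    self_mem_nhdsWithin, ?_⟩
  -- The left end of the neighbourhood, truncated at zero: `a' ≤ b` for every `b` in it, so one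
  -- upper bound for solvent agents at `a'` serves all `b`.
  set a' : ℝ≥0 := a - δ / 2 with ha'
  have ha'eq : (a' : ℝ) = max ((a : ℝ) - δ / 2) 0 := by
    rw [ha', NNReal.coe_sub_def]; simp
  have ha'a : a' ≤ a := tsub_le_self
  have ha't : a' ∈ Set.Icc 0 t := ⟨zero_le, ha'a.trans ha.2⟩
  obtain ⟨h3, h4⟩ := hball (show a' ∈ Metric.ball a δ ∩ Set.Icc 0 t from ⟨by
    rw [Metric.mem_ball, NNReal.dist_eq, ha'eq, abs_lt]
    have := le_max_left ((a : ℝ) - δ / 2) 0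
    have := max_le (by linarith : (a : ℝ) - δ / 2 ≤ a) a.coe_nonneg
    constructor <;> linarith, ha't⟩)
  have hup := whp_solventSum_upper hnet hnet.meanLimit_outDeg (P := P) (C := C)
    (g := fun x => surviveProb p lam R x a')
    (fun x => surviveProb_mem p x hR.cont hR.pos hl (hm a' ha't))
    (Q := fun z k => k ≤ (C z.1).finalCount z.2 ∧ mass R a' ≤ (k : ℝ) / z.1)
    (fun x ε hε => by
      filter_upwards [whp_solventCount_upper hnet hC hR x (hm a' ha't) hε] with z hz k hk
      exact hz k hk.1 hk.2) (ε := c / 8) (by positivity)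
  have hlinks := hnet.tendsto_numLinks.eventually_const_lt
    (show lam - c / 8 < lam by linarith)
  filter_upwards [hup, whp_regular hC, tendsto_fst_whp.eventually hlinks] with z hz hr hn hs b hb
    heq
  obtain ⟨-, h5⟩ := hball (show b ∈ Metric.ball a δ ∩ Set.Icc 0 t from
    ⟨Metric.ball_subset_ball (by linarith) hb.1, hb.2⟩)
  have hab : a' ≤ b := by
    have h6 := hb.1
    rw [Metric.mem_ball, NNReal.dist_eq, abs_lt] at h6
    rw [← NNReal.coe_le_coe, ha'eq]
    exact max_le (by linarith) b.coe_nonneg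
  -- If `K / n = mass R b`, a stopped cascade leaves solvent out-degree at least `numLinks - K`,
  -- while the estimate at `a'` is smaller by `fW(a') > c`. The errors, `c / 8` twice and `|mass R b
  -- - mass R a'| < c / 2`, do not fill this gap.
  have h6 := hz _ ⟨le_rfl, ((mass_le_iff hR.cont hR.pos).2 hab).trans heq.le⟩
  have h7 := div_le_div_of_nonneg_right (Reveal.le_solventSum hr hs) (Nat.cast_nonneg z.1)
  rw [sub_div, ← heq] at h7
  rw [fW_eq hR.cont hR.pos hl (hm a' ha't)] at h3
  rw [abs_lt] at h4 h5
  linarith [h4.1, h5.2]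

include hnet hC hR in
/-- The cascade does not end while `f_W` is positive. -/
lemma whp_finalCount_lower {t : ℝ≥0} (ht : mass R t < lam) (hts : (t : ℝ≥0∞) < tStar p μ lam R)
    {ρ : ℝ} (hρ : 0 < ρ) :
    ∀ᶠ z in whp P, mass R t - ρ ≤ (C z.1).finalCount z.2 / (z.1 : ℝ) := by
  let H : Set ℝ≥0 → Prop := fun A => ∀ᶠ z in whp P, (C z.1).stopTime z.2 ≠ ⊤ → ∀ a ∈ A,
    mass R a ≠ (C z.1).finalCount z.2 / (z.1 : ℝ)
  have h0 : H ∅ := Filter.Eventually.of_forall fun z _ a ha => absurd ha (Set.notMem_empty a)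
  have hmono : ∀ ⦃A B⦄, A ⊆ B → H B → H A := by
    intro A B hAB hB
    filter_upwards [hB] with z hz hs a ha using hz hs a (hAB ha)
  have hunion : ∀ ⦃A B⦄, H A → H B → H (A ∪ B) := by
    intro A B hA hB
    filter_upwards [hA, hB] with z hz1 hz2 hs a ha
    exact ha.elim (hz1 hs a) (hz2 hs a)
  -- `H` passes to subsets and finite unions, so the local statements combine by compactness.
  have key : H (Set.Icc 0 t) := IsCompact.induction_on (p := H) isCompact_Icc h0 hmono hunion
    fun a ha => whp_finalCount_ne hnet hC hR ht hts ha
  filter_upwards [key, whp_finalCount_of_lt_stopTime hC hR t hρ] with z hz hz2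
  -- A cascade still running at `t` has enough reveals by the time change. Otherwise it has stopped,
  -- and a smaller `K / n` would equal `mass R s` for some `s ≤ t`, which `key` forbids.
  rcases lt_or_ge (t : ℝ≥0∞) ((C z.1).stopTime z.2) with h | h
  · exact hz2 h
  · by_contra! hlt
    obtain ⟨s, hs, hs2⟩ := exists_mass_eq (R := R) hR.cont (t := t)
      (y := (C z.1).finalCount z.2 / (z.1 : ℝ)) ⟨by positivity, by linarith⟩
    exact hz (ne_top_of_le_ne_top ENNReal.coe_ne_top h) s ⟨zero_le, hs⟩ hs2

include hnet hC hR in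
/-- The cascade ends before `f_W` becomes negative. -/
lemma whp_finalCount_upper {t : ℝ≥0} (ht : mass R t < lam) (hneg : fW p μ lam R t < 0) :
    ∀ᶠ z in whp P, (C z.1).finalCount z.2 / (z.1 : ℝ) ≤ mass R t := by
  have hl := hnet.lam_pos
  set c := -fW p μ lam R t with hc
  have hc0 : 0 < c := neg_pos.2 hneg
  have hm0 := mass_nonneg hR.cont hR.pos t.coe_nonneg
  have hlow := whp_solventSum_lower hnet hnet.meanLimit_outDeg (P := P) (C := C)
    (g := fun x => surviveProb p lam R x t)
    (fun x => surviveProb_mem p x hR.cont hR.pos hl ht)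
    (Q := fun z k => k ≤ (C z.1).finalCount z.2 ∧ (k : ℝ) / z.1 ≤ mass R t)
    (fun x ε hε => by
      filter_upwards [whp_solventCount_lower hnet hC hR x ht hε] with z hz k hk
      exact hz k hk.1 hk.2) (ε := c / 4) (by positivity)
  have hlinks := hnet.tendsto_numLinks.eventually_lt_const (show lam < lam + c / 4 by linarith)
  have hone := (tendsto_one_div_atTop_nhds_zero_nat (𝕜 := ℝ)).eventually_lt_const
    (show 0 < c / 4 by positivity)
  filter_upwards [hlow, whp_regular hC, tendsto_fst_whp.eventually hlinks,
    tendsto_fst_whp.eventually hone, tendsto_fst_whp.eventually (eventually_gt_atTop 0)]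
    with z hz hr hn hn1 hn2
  have hn0 : (0 : ℝ) < z.1 := by exact_mod_cast hn2
  by_contra! hgt
  -- If the cascade went beyond `n * mass R t` reveals it would pass through this `k`. Since `fW t =
  -- -c`, the ruined agents would then have fewer than `k` outgoing half-edges, contradicting
  -- `solventSum_le`.
  set k := ⌊mass R t * z.1⌋₊ with hk
  have h1 : (k : ℝ) ≤ mass R t * z.1 := Nat.floor_le (by positivity)
  have h2 : mass R t * z.1 < k + 1 := Nat.lt_floor_add_one _
  have hkK : k ≤ (C z.1).finalCount z.2 := by
    have h3 := (lt_div_iff₀ hn0).1 hgt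
    exact_mod_cast h1.trans h3.le
  have h3 := hz k ⟨hkK, (div_le_iff₀ hn0).2 h1⟩
  have h4 := div_le_div_of_nonneg_right (Reveal.solventSum_le hr hkK) hn0.le
  rw [sub_div] at h4
  have h5 := (lt_div_iff₀ hn0).2 h2
  rw [add_div] at h5
  rw [fW_eq hR.cont hR.pos hl ht] at hc
  linarith

end Length

end RuinNetwork

namespace RuinNetwork

/-! ### The three regimes -/

section Regimes

variable {X : Type*} {p : Params X} {ty : ∀ n : ℕ, Fin n → X} {μ : X → ℝ} {lam : ℝ}
  (hnet : NetworkLimit p ty μ lam)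
  {R : ℝ → ℝ} {Ω : ℕ → Type*} [∀ n, MeasurableSpace (Ω n)] {P : ∀ n, Measure (Ω n)}
  [∀ n, IsProbabilityMeasure (P n)] {C : ∀ n, Reveal p (ty n) (Ω n)}
  (hC : ∀ n, IsLossReveal (P n) (C n)) (hR : IntensityLimit P C R)

lemma mass_lt_normL1 (hc : ContinuousOn R (Set.Ici 0)) (hp : ∀ t, 0 ≤ t → 0 < R t)
    (hi : IntegrableOn R (Set.Ici 0)) (t : ℝ≥0) : mass R t < normL1 R := by
  have h1 : mass R t < mass R (t + 1 : ℝ≥0) :=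
    (mass_lt_iff hc hp).2 (lt_add_of_pos_right t one_pos)
  refine h1.trans_le (ge_of_tendsto (tendsto_mass hp hi) ?_)
  filter_upwards [eventually_ge_atTop (t + 1)] with s hs
  exact (mass_le_iff hc hp).2 hs

lemma cumul_top_eq_normL1 (hp : ∀ t, 0 ≤ t → 0 < R t) : cumul R ⊤ = normL1 R := by
  rw [cumul_top, normL1]
  exact setIntegral_congr_fun measurableSet_Ici fun s hs => (abs_of_pos (hp s hs)).symm

omit [∀ n, IsProbabilityMeasure (P n)] in
include hnet hR in
/-- If the accumulated intensity up to `t*` is `λ`, then it gets close to `λ` before `t*`. -/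
lemma exists_mass_near (h : cumul R (tStar p μ lam R) = lam) {ε : ℝ} (hε : 0 < ε) :
    ∃ t : ℝ≥0, (t : ℝ≥0∞) < tStar p μ lam R ∧ mass R t < lam ∧ lam - ε < mass R t := by
  have hl := hnet.lam_pos
  rcases eq_or_ne (tStar p μ lam R) ⊤ with htop | htop
  · rw [htop, cumul_top_eq_normL1 hR.pos] at h
    obtain ⟨t, ht⟩ := ((tendsto_mass hR.pos hR.integrable).eventually_const_lt
      (show lam - ε < normL1 R by linarith)).exists
    exact ⟨t, by rw [htop]; exact ENNReal.coe_lt_top,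
      h ▸ mass_lt_normL1 hR.cont hR.pos hR.integrable t, ht⟩
  · lift tStar p μ lam R to ℝ≥0 using htop with T
    rw [cumul_coe] at h
    have hy : max (lam - ε / 2) 0 < lam := max_lt (by linarith) hl
    obtain ⟨t, -, hmt⟩ := exists_mass_eq (R := R) hR.cont (t := T)
      (y := max (lam - ε / 2) 0) ⟨le_max_right _ _, by rw [h]; exact hy.le⟩
    refine ⟨t, ?_, by rw [hmt]; exact hy, ?_⟩
    · rw [ENNReal.coe_lt_coe, ← mass_lt_iff hR.cont hR.pos, hmt, h]
      exact hy
    · rw [hmt]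
      linarith [le_max_left (lam - ε / 2) 0]

include hnet hC hR in
/-- In the exhaustive regime, the cascade reveals almost all half-edges. -/
lemma convInProb_total (h : cumul R (tStar p μ lam R) = lam)
    (hd : ∀ x, 0 < μ x → 1 ≤ p.outDeg x) :
    ConvInProb P (fun n ω => ((C n).finalRuined ω : ℝ) / n) 1 := by
  classical
  rw [convInProb_iff]
  intro η hη
  have hone := hnet.meanLimit_one
  obtain ⟨F, -, hF⟩ := exists_tail hnet hone (show 0 < η / 4 by positivity)
  obtain ⟨t, hts, hmt, hnear⟩ := exists_mass_near hnet hR h (show 0 < η / 8 by positivity)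
  have hK := whp_finalCount_lower hnet hC hR hmt hts (show 0 < η / 8 by positivity)
  have hlinks := hnet.tendsto_numLinks.eventually_lt_const
    (show lam < lam + η / 4 by linarith)
  -- agents without outgoing half-edges
  have hzero : Tendsto (fun n => ∑ x ∈ F with p.outDeg x = 0, typeFraction (ty n) x) atTop
      (𝓝 0) := by
    have := tendsto_finsetSum (F.filter fun x => p.outDeg x = 0)
      fun x _ => hnet.fraction x
    convert this using 2
    refine (Finset.sum_eq_zero fun x hx => ?_).symm
    by_contra hne
    have := hd x ((hnet.μ_nonneg x).lt_of_ne' hne)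
    have := (Finset.mem_filter.1 hx).2
    omega
  filter_upwards [hK, whp_regular hC, tendsto_fst_whp.eventually hF,
    tendsto_fst_whp.eventually hlinks,
    tendsto_fst_whp.eventually (hzero.eventually_lt_const (show 0 < η / 4 by positivity)),
    tendsto_fst_whp.eventually (eventually_gt_atTop 0)] with z hKz hr htail hm hz0 hn
  have hn0 : (0 : ℝ) < z.1 := by exact_mod_cast hn
  set S : Finset (Fin z.1) := Finset.univ.filter fun i =>
    i ∉ (C z.1).ruinedAfter z.2 ((C z.1).finalCount z.2) with hS
  have h1 : (C z.1).solventSum (fun _ => 1) ((C z.1).finalCount z.2) z.2 = ∑ i ∈ S, (1 : ℝ) := rfl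
  have h2 : (C z.1).solventSum (fun x => (p.outDeg x : ℝ)) ((C z.1).finalCount z.2) z.2 =
      ∑ i ∈ S, (p.outDeg (ty z.1 i) : ℝ) := rfl
  have h3 := Reveal.solventSum_le hr (le_refl ((C z.1).finalCount z.2))
  have h4 := div_le_div_of_nonneg_right h3 hn0.le
  rw [sub_div, h2] at h4
  -- A solvent agent has an outgoing half-edge, or its type is outside `F`, or its type is in `F`
  -- with out-degree zero. After division by `n` the three contributions are below `η / 2`, `η / 4`
  -- and `η / 4`.
  have h5 : ∑ i ∈ S, (1 : ℝ) ≤ ∑ i ∈ S, (p.outDeg (ty z.1 i) : ℝ) +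
      (∑ i with ty z.1 i ∉ F, (1 : ℝ)) +
        ∑ x ∈ F with p.outDeg x = 0, z.1 * typeFraction (ty z.1) x := by
    have h6 : ∑ x ∈ F with p.outDeg x = 0, z.1 * typeFraction (ty z.1) x =
        ∑ i : Fin z.1, if ty z.1 i ∈ F ∧ p.outDeg (ty z.1 i) = 0 then (1 : ℝ) else 0 := by
      have h7 := sum_by_type (ty z.1) (fun x => if x ∈ F ∧ p.outDeg x = 0 then (1 : ℝ) else 0)
        Finset.univ (F.filter fun x => p.outDeg x = 0)
      rw [h7]
      have h8 : ∑ i with ty z.1 i ∉ F.filter (fun x => p.outDeg x = 0),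
          (if ty z.1 i ∈ F ∧ p.outDeg (ty z.1 i) = 0 then (1 : ℝ) else 0) = 0 := by
        refine Finset.sum_eq_zero fun i hi => if_neg ?_
        simpa using (Finset.mem_filter.1 hi).2
      rw [h8, add_zero]
      refine Finset.sum_congr rfl fun x hx => ?_
      rw [if_pos (by simpa using hx), one_mul, typeFraction_eq, mul_div_cancel₀ _ hn0.ne']
    rw [h6, Finset.sum_filter, hS, Finset.sum_filter, Finset.sum_filter,
      ← Finset.sum_add_distrib, ← Finset.sum_add_distrib]
    refine Finset.sum_le_sum fun i _ => ?_
    have hdeg : (0 : ℝ) ≤ p.outDeg (ty z.1 i) := Nat.cast_nonneg _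
    have hdeg' : p.outDeg (ty z.1 i) ≠ 0 → (1 : ℝ) ≤ p.outDeg (ty z.1 i) := fun hne => by
      exact_mod_cast Nat.one_le_iff_ne_zero.2 hne
    by_cases hA : i ∉ (C z.1).ruinedAfter z.2 ((C z.1).finalCount z.2)
    · by_cases hB : ty z.1 i ∈ F
      · by_cases hD : p.outDeg (ty z.1 i) = 0
        · simp [hA, hB, hD]
        · simp [hA, hB, hD]
          exact Nat.one_le_iff_ne_zero.2 hD
      · simp [hA, hB]
    · simp only [hA, if_false]
      positivity
  have h6 := div_le_div_of_nonneg_right h5 hn0.le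
  rw [add_div, add_div, ← Finset.mul_sum, mul_div_cancel_left₀ _ hn0.ne'] at h6
  rw [Reveal.finalRuined_eq_sub hr, sub_div, div_self hn0.ne', h1, abs_lt]
  have h7 : 0 ≤ (∑ i ∈ S, (1 : ℝ)) / z.1 :=
    div_nonneg (Finset.sum_nonneg fun _ _ => zero_le_one) hn0.le
  constructor <;> linarith

include hnet hC hR in
/-- In the stable regime, the cascade stops at a stable zero of `f_W`. -/
lemma convInProb_stable {t : ℝ≥0} (ht : tStar p μ lam R = t) (hs : IsStableZero p μ lam R t)
    (hm : mass R t < lam) :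
    (∀ x, 0 < μ x → ConvInProb P
      (fun n ω => ((C n).finalRuinedOf x ω : ℝ) / (n * typeFraction (ty n) x))
      (1 - surviveProb p lam R x t)) ∧
    ConvInProb P (fun n ω => ((C n).finalRuined ω : ℝ) / n)
      (∑' x, μ x * (1 - surviveProb p lam R x t)) := by
  have hl := hnet.lam_pos
  have hlt : ∀ s ≤ t, mass R s < lam := fun s hst =>
    ((mass_le_iff hR.cont hR.pos).2 hst).trans_lt hm
  have hopen : IsOpen {s : ℝ≥0 | mass R s < lam} :=
    isOpen_lt (continuous_mass hR.cont) continuous_const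
  refine convInProb_ruined hnet hC (fun x => surviveProb_mem p x hR.cont hR.pos hl hm) ?_ ?_
  all_goals intro x ε hε
  all_goals have hμ := hnet.μ_nonneg x
  all_goals have hμ1 : μ x ≤ 1 := le_hasSum hnet.μ_sum x fun y _ => hnet.μ_nonneg y
  all_goals
    have hcont : ContinuousAt (fun s : ℝ≥0 => μ x * surviveProb p lam R x s) t :=
      ((continuousOn_surviveProb hR.cont hR.pos x hl).const_mul (μ x)).continuousAt
        (hopen.mem_nhds hm)
  -- Stability gives times `s` just after `t` with `fW s < 0`. The cascade ends before `mass R s`,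
  -- and at least the agents solvent at `s` remain.
  · obtain ⟨e, he, hneg⟩ := hs.2
    have h1 : ∀ᶠ s in 𝓝 t, μ x * surviveProb p lam R x t - ε / 2 < μ x * surviveProb p lam R x s :=
      hcont.eventually_const_lt (by linarith)
    have h2 : ∀ᶠ s in 𝓝[>] t, s ∈ Set.Ioo t (t + e) :=
      Ioo_mem_nhdsGT (lt_add_of_pos_right t he)
    obtain ⟨s, ⟨hs1, hs2⟩, hs3⟩ := (((h1.and (hopen.mem_nhds hm)).filter_mono
      nhdsWithin_le_nhds).and h2).exists
    filter_upwards [whp_finalCount_upper hnet hC hR hs2 (hneg s hs3.1 hs3.2),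
      whp_solventCount_lower hnet hC hR x hs2 (half_pos hε)] with z hz1 hz2
    linarith [hz2 _ le_rfl hz1]
  -- For the upper bound `s` is just before `t`, where the cascade cannot have stopped. If `t = 0`,
  -- then `s = 0` and nothing has to be shown about the length of the cascade.
  · obtain ⟨s, hst, hs0, hs1⟩ : ∃ s ≤ t, (s < t ∨ s = 0) ∧
        μ x * surviveProb p lam R x s < μ x * surviveProb p lam R x t + ε / 2 := by
      rcases eq_or_ne t 0 with h0 | h0
      · exact ⟨t, le_rfl, Or.inr h0, by linarith⟩
      · have h1 : ∀ᶠ s in 𝓝 t, μ x * surviveProb p lam R x s <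
            μ x * surviveProb p lam R x t + ε / 2 :=
          hcont.eventually_lt_const (by linarith)
        have h2 : ∀ᶠ s in 𝓝[<] t, s ∈ Set.Ioo 0 t := Ioo_mem_nhdsLT (pos_iff_ne_zero.2 h0)
        have h3 : (𝓝[<] t).NeBot := nhdsLT_neBot_of_exists_lt ⟨0, pos_iff_ne_zero.2 h0⟩
        obtain ⟨s, hs1, hs3⟩ := ((h1.filter_mono nhdsWithin_le_nhds).and h2).exists
        exact ⟨s, hs3.2.le, Or.inl hs3.2, hs1⟩
    have hK : ∀ᶠ z in whp P, mass R s ≤ (C z.1).finalCount z.2 / (z.1 : ℝ) := by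
      rcases hs0 with h0 | rfl
      · obtain ⟨u, hsu, hut⟩ := exists_between h0
        have hmu := (mass_lt_iff hR.cont hR.pos).2 hsu
        filter_upwards [whp_finalCount_lower hnet hC hR (hlt u hut.le)
          (by rw [ht]; exact ENNReal.coe_lt_coe.2 hut) (sub_pos.2 hmu)] with z hz
        linarith
      · refine Filter.Eventually.of_forall fun z => ?_
        rw [NNReal.coe_zero, mass_zero]
        positivity
    filter_upwards [hK, whp_solventCount_upper hnet hC hR x (hlt s hst) (half_pos hε)]
      with z hz1 hz2
    linarith [hz2 _ le_rfl hz1]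

/-- Each reveal ruins at most one agent. -/
lemma Reveal.solventCount_le_add {n : ℕ} {ty : Fin n → X} {Ω : Type*} (C : Reveal p ty Ω) (x : X)
    (ω : Ω) (k l : ℕ) :
    C.solventCount x k ω ≤ C.solventCount x l ω + (l - k) := by
  classical
  set A := Finset.univ.filter fun i => ty i = x ∧ i ∉ C.ruinedAfter ω k
  set B := Finset.univ.filter fun i => ty i = x ∧ i ∉ C.ruinedAfter ω l
  -- An agent solvent after `k` reveals but not after `l` was hit by some reveal in `(k, l]`.
  -- Distinct agents have distinct such reveals, as ranks are injective.
  have hnew : ∀ i ∈ A \ B, ∃ j, C.rank ω ⟨i, j⟩ ∈ Finset.Ioc k l := by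
    intro i hi
    simp only [A, B, Finset.mem_sdiff, Finset.mem_filter, Finset.mem_univ, true_and, not_and,
      not_not] at hi
    by_contra! hno
    refine (hi.2 hi.1.1 : i ∈ C.ruinedAfter ω l) ?_
    have h0 := hi.1.2
    simp only [Reveal.ruinedAfter, Set.mem_ofPred_eq, not_not] at h0
    refine ⟨h0.1, fun j hj => h0.2 j ?_⟩
    have h1 := hno j
    rw [Finset.mem_Ioc] at h1
    have h2 : C.rank ω ⟨i, j⟩ ≤ l := hj
    change C.rank ω ⟨i, j⟩ ≤ k
    omega
  have hcard : (A \ B).card ≤ (Finset.Ioc k l).card := by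
    have hch : ∀ i : Fin n, ∃ r : ℕ, i ∈ A \ B → ∃ j, C.rank ω ⟨i, j⟩ = r ∧ r ∈ Finset.Ioc k l := by
      intro i
      by_cases hi : i ∈ A \ B
      · obtain ⟨j, hj⟩ := hnew i hi
        exact ⟨_, fun _ => ⟨j, rfl, hj⟩⟩
      · exact ⟨0, fun h => absurd h hi⟩
    choose r hr using hch
    refine Finset.card_le_card_of_injOn r (fun i hi => ?_) fun i hi i' hi' hii => ?_
    · obtain ⟨j, -, h2⟩ := hr i hi
      exact h2
    · obtain ⟨j, h1, -⟩ := hr i hi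
      obtain ⟨j', h1', -⟩ := hr i' hi'
      have := C.rank_injective ω (h1.trans (hii.trans h1'.symm))
      exact congrArg Sigma.fst this
  rw [Nat.card_Ioc] at hcard
  have h1 : A.card ≤ (A \ B).card + B.card := by
    rw [add_comm]
    exact (Finset.card_le_card (fun i hi => by
      by_cases hB : i ∈ B <;> simp [hB, hi])).trans (Finset.card_union_le B (A \ B))
  change A.card ≤ B.card + (l - k)
  omega

include hnet hC hR in
/-- If the intensity converges in `L¹`, the number of reveals is bounded by its integral. -/
lemma whp_finalCount_le_normL1 (hL : IntensityLimitL1 P C R) {ρ : ℝ} (hρ : 0 < ρ) :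
    ∀ᶠ z in whp P, (C z.1).finalCount z.2 / (z.1 : ℝ) ≤ normL1 R + ρ := by
  have hρ2 := half_pos hρ
  have h1 : ∀ᶠ z in whp P, ∫⁻ t in {t : ℝ | 0 ≤ t ∧ ENNReal.ofReal t < (C z.1).stopTime z.2},
      ENNReal.ofReal |(C z.1).intensity t.toNNReal z.2 / z.1 - R t| < ENNReal.ofReal (ρ / 2) := by
    have := hL (ENNReal.ofReal (ρ / 2)) (by simpa using hρ)
    simp_rw [eventually_whp, not_lt]
    exact this
  -- The number of reveals is at most the number of links, eventually below `(lam + 1) * n`; this is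
  -- the bounded range required for the uniform clock estimate.
  have hlinks := hnet.tendsto_numLinks.eventually_lt_const (show lam < lam + 1 by linarith)
  filter_upwards [h1, whp_regular hC, whp_clockSum hC (lam + 1) hρ2,
    tendsto_fst_whp.eventually hlinks, tendsto_fst_whp.eventually (eventually_gt_atTop 0)]
    with z hz hr hcl hm hn
  have hn0 : (0 : ℝ) < z.1 := by exact_mod_cast hn
  have hspec := Reveal.countBy_spec (C := C z.1) (ω := z.2) ((C z.1).stopTime z.2)
  have h2 := Reveal.ofReal_clockSum_sub_mass_le hr hR.cont (le_refl ((C z.1).finalCount z.2))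
  have h3 : ∫⁻ t in Set.Ico 0 ((C z.1).revealTime ((C z.1).finalCount z.2) z.2).toReal,
        ENNReal.ofReal |(C z.1).intensity t.toNNReal z.2 / z.1 - R t| ≤
      ∫⁻ t in {t : ℝ | 0 ≤ t ∧ ENNReal.ofReal t < (C z.1).stopTime z.2},
        ENNReal.ofReal |(C z.1).intensity t.toNNReal z.2 / z.1 - R t| := by
    refine lintegral_mono_set fun t ht => ⟨ht.1, ?_⟩
    exact ((ENNReal.ofReal_lt_iff_lt_toReal ht.1 hspec.2).2 ht.2).trans_le hspec.1
  have h4 := (ENNReal.ofReal_lt_ofReal_iff hρ2).1 ((h2.trans h3).trans_lt hz)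
  have h5 : ((C z.1).finalCount z.2 : ℝ) ≤ numLinks p (ty z.1) := by
    exact_mod_cast Reveal.finalCount_le (C := C z.1) (ω := z.2)
  have h6 := (abs_lt.1 (hcl ((C z.1).finalCount z.2)
    (h5.trans ((div_lt_iff₀ hn0).1 hm).le))).1
  have h7 := mass_lt_normL1 hR.cont hR.pos hR.integrable
    ((C z.1).revealTime ((C z.1).finalCount z.2) z.2).toNNReal
  change mass R ((C z.1).revealTime ((C z.1).finalCount z.2) z.2).toReal < _ at h7
  linarith

include hnet hC hR in
/-- In the subcritical regime, the cascade goes on until the intensity has vanished. -/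
lemma convInProb_subcritical (ht : tStar p μ lam R = ⊤) (hm : normL1 R < lam)
    (hL : IntensityLimitL1 P C R) {g : X → ℝ}
    (hg : ∀ x, Tendsto (fun t : ℝ≥0 => surviveProb p lam R x t) atTop (𝓝 (g x))) :
    (∀ x, 0 < μ x → ConvInProb P
      (fun n ω => ((C n).finalRuinedOf x ω : ℝ) / (n * typeFraction (ty n) x)) (1 - g x)) ∧
    ConvInProb P (fun n ω => ((C n).finalRuined ω : ℝ) / n) (∑' x, μ x * (1 - g x)) := by
  have hl := hnet.lam_pos
  have hlt : ∀ s : ℝ≥0, mass R s < lam := fun s =>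
    (mass_lt_normL1 hR.cont hR.pos hR.integrable s).trans hm
  have hmem : ∀ x, g x ∈ Set.Icc (0 : ℝ) 1 := fun x =>
    isClosed_Icc.mem_of_tendsto (hg x) (Filter.Eventually.of_forall fun t =>
      surviveProb_mem p x hR.cont hR.pos hl (hlt t))
  refine convInProb_ruined hnet hC hmem ?_ ?_
  all_goals intro x ε hε
  -- Solvent counts are controlled only up to intensities `mass R t < normL1 R`. With `mass R t`
  -- within `ε / 8` of `normL1 R`, at most `3 ε n / 8` reveals come after the cut `k`. They are paid
  -- for by `solventCount_le_add`.
  · have h1 := ((hg x).const_mul (μ x)).eventually_const_lt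
      (show μ x * g x - ε / 4 < μ x * g x by linarith)
    have h2 := (tendsto_mass hR.pos hR.integrable).eventually_const_lt
      (show normL1 R - ε / 8 < normL1 R by linarith)
    obtain ⟨t, ht1, ht2⟩ := (h1.and h2).exists
    have hone := (tendsto_one_div_atTop_nhds_zero_nat (𝕜 := ℝ)).eventually_lt_const
      (show 0 < ε / 8 by positivity)
    have hm0 := mass_nonneg hR.cont hR.pos t.coe_nonneg
    filter_upwards [whp_finalCount_le_normL1 hnet hC hR hL (show 0 < ε / 8 by positivity),
      whp_solventCount_lower hnet hC hR x (hlt t) (show 0 < ε / 4 by positivity),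
      tendsto_fst_whp.eventually hone, tendsto_fst_whp.eventually (eventually_gt_atTop 0)]
      with z hK hz hn1 hn
    have hn0 : (0 : ℝ) < z.1 := by exact_mod_cast hn
    set K := (C z.1).finalCount z.2
    set k := min ⌊mass R t * z.1⌋₊ K with hk
    have hkK : k ≤ K := min_le_right _ _
    have hkt : (k : ℝ) / z.1 ≤ mass R t := by
      rw [div_le_iff₀ hn0]
      exact (Nat.cast_le.2 (min_le_left _ _)).trans (Nat.floor_le (by positivity))
    have h3 := hz k hkK hkt
    have h4 : ((C z.1).solventCount x k z.2 : ℝ) ≤ (C z.1).solventCount x K z.2 + (K - k) := by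
      rw [← Nat.cast_sub hkK]
      exact_mod_cast (C z.1).solventCount_le_add x z.2 k K
    have h5 := div_le_div_of_nonneg_right h4 hn0.le
    rw [add_div, sub_div] at h5
    have h6 : (K : ℝ) / z.1 - k / z.1 ≤ 3 * (ε / 8) := by
      rcases min_choice ⌊mass R t * z.1⌋₊ K with h | h
      · have h7 := (Nat.lt_floor_add_one (mass R t * z.1)).le
        rw [← h, ← hk] at h7
        have h8 := (le_div_iff₀ hn0).2 h7
        rw [add_div] at h8
        linarith
      · rw [hk, h]; linarith
    linarith
  -- Since `tStar` is infinite, the cascade reaches intensity `mass R s` for every finite `s`; the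
  -- later time `s + 1` provides the slack `ρ` in `whp_finalCount_lower`.
  · have h1 := ((hg x).const_mul (μ x)).eventually_lt_const
      (show μ x * g x < μ x * g x + ε / 2 by linarith)
    obtain ⟨s, hs⟩ := h1.exists
    have hmu : mass R s < mass R (s + 1 : ℝ≥0) :=
      (mass_lt_iff hR.cont hR.pos).2 (lt_add_of_pos_right s one_pos)
    filter_upwards [whp_finalCount_lower hnet hC hR (hlt (s + 1))
        (by rw [ht]; exact ENNReal.coe_lt_top) (sub_pos.2 hmu),
      whp_solventCount_upper hnet hC hR x (hlt s) (half_pos hε)] with z hz1 hz2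
    linarith [hz2 _ le_rfl (by linarith)]

omit [∀ n, IsProbabilityMeasure (P n)] in
include hR in
lemma tendsto_surviveProb (hm : normL1 R < lam) (x : X) {S : ℕ → ℝ}
    (hS : ∀ θ ≤ p.inDeg x, Tendsto (fun t : ℝ≥0 => survival p R x θ t) atTop (𝓝 (S θ))) :
    Tendsto (fun t : ℝ≥0 => surviveProb p lam R x t) atTop
      (𝓝 (∑ θ ∈ Finset.range (p.inDeg x + 1), binom (p.inDeg x) (normL1 R / lam) θ * S θ)) := by
  have hphi : Tendsto (fun t : ℝ≥0 => phi lam R t) atTop (𝓝 (normL1 R / lam)) := by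
    refine ((tendsto_mass hR.pos hR.integrable).div_const lam).congr fun t => ?_
    exact (phi_eq hR.cont hR.pos
      ((mass_lt_normL1 hR.cont hR.pos hR.integrable t).trans hm)).symm
  refine tendsto_finsetSum _ fun θ hθ => ?_
  refine Tendsto.mul ?_ (hS θ (Nat.lt_succ_iff.1 (Finset.mem_range.1 hθ)))
  have hcont : Continuous fun z : ℝ => binom (p.inDeg x) z θ := by
    unfold binom
    fun_prop
  exact (hcont.tendsto _).comp hphi

end Regimes

end RuinNetwork

end

theorem mainTheorem2 {X : Type*} [Countable X] (p : RuinNetwork.Params X)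
    (ty : ∀ n : ℕ, Fin n → X) (μ : X → ℝ) (lam : ℝ)
    (hnet : RuinNetwork.NetworkLimit p ty μ lam)
    {Ω : ℕ → Type*} [∀ n, MeasurableSpace (Ω n)] (P : ∀ n, Measure (Ω n))
    [∀ n, IsProbabilityMeasure (P n)]
    (C : ∀ n, RuinNetwork.Reveal p (ty n) (Ω n))
    (hC : ∀ n, RuinNetwork.IsLossReveal (P n) (C n))
    (R : ℝ → ℝ) (hR : RuinNetwork.IntensityLimit P C R) :
    -- (i)
    (RuinNetwork.cumul R (RuinNetwork.tStar p μ lam R) = lam →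
      (∀ x, 0 < μ x → 1 ≤ p.outDeg x) →
      RuinNetwork.ConvInProb P (fun n ω => ((C n).finalRuined ω : ℝ) / n) 1) ∧
    -- (ii)
    (∀ t : ℝ≥0, RuinNetwork.tStar p μ lam R = t → RuinNetwork.IsStableZero p μ lam R t →
      RuinNetwork.cumul R t < lam →
      (∀ x, 0 < μ x →
        RuinNetwork.ConvInProb P
          (fun n ω => ((C n).finalRuinedOf x ω : ℝ) / (n * RuinNetwork.typeFraction (ty n) x))
          (1 - ∑ θ ∈ Finset.range (p.inDeg x + 1),
            RuinNetwork.binom (p.inDeg x) (RuinNetwork.phi lam R t) θ *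
              RuinNetwork.survival p R x θ t)) ∧
      RuinNetwork.ConvInProb P (fun n ω => ((C n).finalRuined ω : ℝ) / n)
        (∑' x, μ x * (1 - ∑ θ ∈ Finset.range (p.inDeg x + 1),
          RuinNetwork.binom (p.inDeg x) (RuinNetwork.phi lam R t) θ *
            RuinNetwork.survival p R x θ t))) ∧
    -- (iii)
    (RuinNetwork.tStar p μ lam R = ⊤ → RuinNetwork.normL1 R < lam →
      RuinNetwork.IntensityLimitL1 P C R →
      ∃ Sinf : X → ℕ → ℝ,
        (∀ x, ∀ θ ≤ p.inDeg x,
          Tendsto (fun t : ℝ≥0 => RuinNetwork.survival p R x θ t) atTop (𝓝 (Sinf x θ))) ∧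
        (∀ x, 0 < μ x →
          RuinNetwork.ConvInProb P
            (fun n ω => ((C n).finalRuinedOf x ω : ℝ) / (n * RuinNetwork.typeFraction (ty n) x))
            (1 - ∑ θ ∈ Finset.range (p.inDeg x + 1),
              RuinNetwork.binom (p.inDeg x) (RuinNetwork.normL1 R / lam) θ * Sinf x θ)) ∧
        RuinNetwork.ConvInProb P (fun n ω => ((C n).finalRuined ω : ℝ) / n)
          (∑' x, μ x * (1 - ∑ θ ∈ Finset.range (p.inDeg x + 1),
            RuinNetwork.binom (p.inDeg x) (RuinNetwork.normL1 R / lam) θ * Sinf x θ))) := by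
  have hl := hnet.lam_pos
  refine ⟨fun h hd => RuinNetwork.convInProb_total hnet hC hR h hd, fun t ht hs hm => ?_,
    fun ht hm hL => ?_⟩
  · rw [RuinNetwork.cumul_coe] at hm
    exact RuinNetwork.convInProb_stable hnet hC hR ht hs hm
  · choose S hS using fun x θ =>
      RuinNetwork.exists_tendsto_survival p x hR.cont hR.pos hl hR.integrable θ
    exact ⟨S, fun x θ _ => hS x θ, RuinNetwork.convInProb_subcritical hnet hC hR ht hm hL
      fun x => RuinNetwork.tendsto_surviveProb hR hm x fun θ _ => hS x θ⟩
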